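/- **Setting.** Let $\eta\in\mathbb C$ be such that $q=e^{\eta}$ is not a root of unity (i.e. $q^m\neq1$ for all $m\ge1$), write $q^{x}=e^{x\eta}$, and let $(\lambda_j)_{j\in\mathbb Z}$ be complex numbers with $\sinh(\lambda_i-\lambda_j)\ne0$ and $\sinh(\lambda_i-\lambda_j+\eta)\neq0$ for all $i\ne j$; put $\xi_j=e^{\lambda_j}$. Let $\varphi(\mu;\alpha)$ be an arbitrary complex function of two complex variables (in the application to the XXZ chain it is the function that determines the magnetization). For $k\le l$ put $V_{[k,l]}=V_k\otimes\dots\otimes V_l$ with $V_j=\mathbb C^2$. Let $W^+=\bigoplus_{m\ge0}\mathbb C|m\rangle$ with $q^{D}|m\rangle=q^m|m\rangle$, $a|m\rangle=(1-q^{2m})|m-1\rangle$, $a^*|m\rangle=|m+1\rangle$. For an operator $B$ on $W^+$ let $\mathrm{tr}^+(q^{2\alpha D}B)=\sum_{m}q^{2\alpha m}\langle m|B|m\rangle$, continued as a rational function of $q^{2\alpha}$. Let $$L^+(\zeta)=i\zeta^{-1/2}q^{-1/4}\bigl(1-\zeta a^*\sigma^+-\zeta a\sigma^--\zeta^2q^{2D+2}\sigma^-\sigma^+\bigr)q^{\sigma^zD},$$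 and let $R(\zeta)$ be the six-vertex $R$-matrix on $\mathbb C^2\otimes\mathbb C^2$, with diagonal entries $q\zeta-q^{-1}\zeta^{-1}$ (equal spins) and $\zeta-\zeta^{-1}$ (opposite spins), and off-diagonal entries $q-q^{-1}$ between the two states with opposite spins. With an auxiliary space $A=W^+$, respectively $a=\mathbb C^2$, put $T_{A,[k,l]}(\zeta)=L^+_{A,l}(\zeta/\xi_l)\cdots L^+_{A,k}(\zeta/\xi_k)$ and $T_{a,[k,l]}(\zeta)=R_{a,l}(\zeta/\xi_l)\cdots R_{a,k}(\zeta/\xi_k)$. For $X\in\mathrm{End}(V_{[k,l]})$ put $$\mathbf H_{[k,l]}(\zeta;\alpha)(X)=\mathrm{tr}_a\,\mathrm{tr}^+_A\bigl(q^{2\alpha D_A}\,T_a(\zeta)^{-1}T_A(\zeta)^{-1}\,X\,T_A(\zeta)T_a(\zeta)\bigr).$$ For $k\le j\le l$ let $\mathbf H_j=\mathbf H_j^{[k,l]}$ be the linear operator on $\mathrm{End}(V_{[k,l]})$ with $$\mathbf H_j(X)=\lim_{\alpha\to0}\operatorname*{res}_{\mu=\lambda_j}\mathbf H_{[k,l]}(e^{\mu};\alpha)(X)$$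 if $X$ has spin zero, i.e. commutes with $S^z_{[k,l]}=\frac12\sum_{j=k}^{l}\sigma^z_j$, and $\mathbf H_j(X)=0$ if $[S^z_{[k,l]},X]=sX$ with $s\ne0$. Finally put $$(\Omega_2)_{[k,l]}=-\sum_{j=k}^l\varphi(\lambda_j;0)\,\mathbf H_j .$$ Empty segments are allowed; for them $V=\mathbb C$ and $\Omega_2=0$. **Proposition (reduction identity for $\Omega_2$).** 1. For every segment, the traces exist (the generating functions are rational, without pole at $q^{2\alpha}$) for all small $\alpha\neq0$; for spin-zero $X$ and small $\alpha\ne0$ the function $\mathbf H_{[k,l]}(e^\mu;\alpha)(X)$ has at most simple poles at $\mu=\lambda_j$, $k\le j\le l$; and the limits $\alpha\to0$ of its residues exist. If moreover, for every $j$ in $[k,l]$, $\varphi(\cdot\,;\alpha)$ is continuous at $\lambda_j$ for all small $\alpha\neq0$ and $\varphi(\lambda_j;\cdot)$ is continuous at $0$, then for spin-zero $X$ $$(\Omega_2)_{[k,l]}(X)=-\lim_{\alpha\to0}\sum_{j=k}^l\operatorname*{res}_{\mu=\lambda_j}\varphi(\mu;\alpha)\,\mathbf H_{[k,l]}(e^\mu;\alpha)(X).$$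 2. For all segments and all $X$, $$(\Omega_2)_{[k,l]}(X_{[k,l-1]}\,I_l)=(\Omega_2)_{[k,l-1]}(X_{[k,l-1]})\,I_l,\qquad (\Omega_2)_{[k,l]}(I_k\,X_{[k+1,l]})=I_k\,(\Omega_2)_{[k+1,l]}(X_{[k+1,l]});$$ in particular this holds for $[k,l]=[1,n]$. 3. Hence $\Omega_2$ extends to the infinite chain as an inductive limit: on the space $\mathcal W$ of local operators of the chain with sites $j\in\mathbb Z$ there is exactly one linear operator $\Omega_2:\mathcal W\to\mathcal W$ that acts as $(\Omega_2)_{[k,l]}$ on the operators supported on $[k,l]$, for every segment. Moreover $\Omega_2=\lim_{k\to-\infty}\lim_{l\to\infty}(\Omega_2)_{[k,l]}$, in the sense that for every $O\in\mathcal W$, for all sufficiently small $k$ and then all sufficiently large $l$, $O$ is supported on $[k,l]$ and $\Omega_2(O)=(\Omega_2)_{[k,l]}(O)$. -/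

import Mathlib

open Filter Topology

noncomputable section

namespace XXZ

/-- Spin configurations of a segment of `n` sites: `0` is spin up, `1` is spin down. -/
abbrev Conf (n : ℕ) := Fin n → Fin 2

/-- `End(V)` for the space of states `V = (ℂ²)^{⊗ n}` of a segment of `n` sites,
as matrices (row index first) in the basis of spin configurations. -/
abbrev SegOp (n : ℕ) := Matrix (Conf n) (Conf n) ℂ

/-! ### The q-oscillator algebra in the module `W⁺`, with `q = exp η` -/

/-- The module `W⁺`, with basis `|k⟩`, `k ≥ 0`. -/
abbrev Fock := ℕ →₀ ℂ

/-- `q^D |k⟩ = q^k |k⟩`. -/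
def qD (η : ℂ) : Module.End ℂ Fock :=
  Finsupp.linearCombination ℂ fun k : ℕ => Finsupp.single k (Complex.exp (k * η))

/-- `q^{-D} |k⟩ = q^{-k} |k⟩`. -/
def qDinv (η : ℂ) : Module.End ℂ Fock :=
  Finsupp.linearCombination ℂ fun k : ℕ => Finsupp.single k (Complex.exp (-(k * η)))

/-- `a |k⟩ = (1 - q^{2k}) |k - 1⟩`; the coefficient vanishes at `k = 0`. -/
def oscA (η : ℂ) : Module.End ℂ Fock :=
  Finsupp.linearCombination ℂ fun k : ℕ =>
    Finsupp.single (k - 1) (1 - Complex.exp (2 * k * η))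

/-- `a* |k⟩ = |k + 1⟩`. -/
def oscAdag : Module.End ℂ Fock :=
  Finsupp.linearCombination ℂ fun k : ℕ => Finsupp.single (k + 1) 1

/-- The generating function `∑ k, ⟨k| B |k⟩ x^k` of the diagonal of an operator on `W⁺`. -/
def diagSeries (B : Module.End ℂ Fock) : PowerSeries ℂ :=
  PowerSeries.mk fun k => B (Finsupp.single k 1) k

/-- `v` is the value at `x` of the weighted trace `tr⁺ (x^D B) = ∑ k, x^k ⟨k| B |k⟩`: the
series is the expansion at `0` of a rational function without pole at `x`, whose value at
`x` is `v`. -/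
def HasOscTrace (x : ℂ) (B : Module.End ℂ Fock) (v : ℂ) : Prop :=
  ∃ F : RatFunc ℂ, (F : LaurentSeries ℂ) = (diagSeries B : LaurentSeries ℂ) ∧
    F.denom.eval x ≠ 0 ∧ F.eval (RingHom.id ℂ) x = v

open Classical in
/-- The weighted trace `tr⁺ (x^D B)` (the value `0` is used where it does not exist). -/
def oscTrace (x : ℂ) (B : Module.End ℂ Fock) : ℂ :=
  if h : ∃ v, HasOscTrace x B v then h.choose else 0

/-! ### L-operators and monodromy matrices

An operator on `(auxiliary space) ⊗ (quantum space)` is a matrix indexed by the quantum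
space with entries in the algebra `A` of endomorphisms of the auxiliary space. The spectral
parameter is written `ζ = exp μ`. -/

/-- `L⁺(ζ) = i ζ^{-1/2} q^{-1/4} (1 - ζ a* σ⁺ - ζ a σ⁻ - ζ² q^{2D+2} σ⁻σ⁺) q^{σᶻ D}`. -/
def lPlus (η μ : ℂ) : Matrix (Fin 2) (Fin 2) (Module.End ℂ Fock) :=
  (Complex.I * Complex.exp (-μ / 2) * Complex.exp (-η / 4)) •
    (!![1, -(Complex.exp μ • oscAdag);
        -(Complex.exp μ • oscA η),
          1 - (Complex.exp (2 * μ) * Complex.exp (2 * η)) • (qD η * qD η)] *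
      !![qD η, 0; 0, qDinv η])

/-- The six-vertex R-matrix, with the prefactor `qζ - q⁻¹ζ⁻¹` multiplied out: its weights
are `qζ - q⁻¹ζ⁻¹`, `ζ - ζ⁻¹` and `q - q⁻¹`. The outer matrix belongs to the quantum site,
its entries act on the auxiliary space `ℂ²`. -/
def rMat (η μ : ℂ) : Matrix (Fin 2) (Fin 2) (Matrix (Fin 2) (Fin 2) ℂ) :=
  let a := Complex.exp (μ + η) - Complex.exp (-(μ + η))
  let b := Complex.exp μ - Complex.exp (-μ)
  let c := Complex.exp η - Complex.exp (-η)
  !![!![a, 0; 0, b], !![0, 0; c, 0];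
     !![0, c; 0, 0], !![b, 0; 0, a]]

section Monodromy

variable {A : Type*} [Ring A] [Algebra ℂ A] {n : ℕ}

/-- A one-site matrix acting on site `j` of a segment. -/
def siteOp (j : Fin n) (M : Matrix (Fin 2) (Fin 2) A) : Matrix (Conf n) (Conf n) A :=
  Matrix.of fun s t => if ∀ i, i ≠ j → s i = t i then M (s j) (t j) else 0

/-- The monodromy matrix `L_n ⋯ L_2 L_1`. -/
def monodromy (L : Fin n → Matrix (Fin 2) (Fin 2) A) : Matrix (Conf n) (Conf n) A :=
  ((List.finRange n).reverse.map fun j => siteOp j (L j)).prod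

/-- The inverse adjoint action `X ↦ T⁻¹ X T`; the inverse is that of the algebra of
operators on the product of auxiliary and quantum space. -/
def invAdj (T : Matrix (Conf n) (Conf n) A) (X : SegOp n) : Matrix (Conf n) (Conf n) A :=
  Ring.inverse T * X.map (algebraMap ℂ A) * T

end Monodromy

variable {n : ℕ}

/-- `𝕋⁺_A(ζ)⁻¹ (X)`, for the monodromy matrix with auxiliary space `W⁺` and inhomogeneities
`ξ_j = exp (lam j)`. -/
def oscAdj (η : ℂ) (lam : Fin n → ℂ) (μ : ℂ) (X : SegOp n) :
    Matrix (Conf n) (Conf n) (Module.End ℂ Fock) :=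
  invAdj (monodromy fun j => lPlus η (μ - lam j)) X

/-- `Q(ζ; α)(X) = tr⁺_A (q^{2αD} T_A(ζ)⁻¹ X T_A(ζ))`. -/
def opQ (η : ℂ) (lam : Fin n → ℂ) (μ α : ℂ) (X : SegOp n) : SegOp n :=
  Matrix.of fun s t => oscTrace (Complex.exp (2 * α * η)) (oscAdj η lam μ X s t)

/-- `t(ζ)(X) = tr_a (T_a(ζ)⁻¹ X T_a(ζ))`. -/
def opT (η : ℂ) (lam : Fin n → ℂ) (μ : ℂ) (X : SegOp n) : SegOp n :=
  Matrix.of fun s t => (invAdj (monodromy fun j => rMat η (μ - lam j)) X s t).trace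

/-- `H(ζ; α)(X) = tr_a tr⁺_A (q^{2αD} T_a⁻¹ T_A⁻¹ X T_A T_a)`. -/
def opH (η : ℂ) (lam : Fin n → ℂ) (μ α : ℂ) (X : SegOp n) : SegOp n :=
  opT η lam μ (opQ η lam μ α X)

/-- The residue of `f` at a simple pole `z`. -/
def simpleResidue (f : ℂ → SegOp n) (z : ℂ) : SegOp n :=
  limUnder (𝓝[≠] z) fun w => (w - z) • f w

/-- The projection of `End(V)` onto the spin-zero sector `{X | [Sᶻ, X] = 0}`. -/
def spinZeroPart (X : SegOp n) : SegOp n :=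
  Matrix.of fun s t => if ∑ i, (s i : ℕ) = ∑ i, (t i : ℕ) then X s t else 0

/-- The residue of `H(exp μ; α)(X)` at `μ = lam j`. -/
def resH (η : ℂ) (lam : Fin n → ℂ) (j : Fin n) (α : ℂ) (X : SegOp n) : SegOp n :=
  simpleResidue (fun μ => opH η lam μ α X) (lam j)

/-- `H_j`: the limit `α → 0` of the residue of `H` at `ζ = ξ_j` on the spin-zero sector,
and zero on the other spin sectors. -/
def opHj (η : ℂ) (lam : Fin n → ℂ) (j : Fin n) (X : SegOp n) : SegOp n :=
  limUnder (𝓝[≠] 0) fun α => resH η lam j α (spinZeroPart X)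

/-- `(Ω₂)(X) = - ∑ j, φ(λ_j; 0) H_j(X)` for a segment with inhomogeneities `exp (lam j)`. -/
def omega2 (η : ℂ) (φ : ℂ → ℂ → ℂ) (lam : Fin n → ℂ) (X : SegOp n) : SegOp n :=
  -∑ j, φ (lam j) 0 • opHj η lam j X

/-- `X ↦ X ⊗ I`, with the identity on an additional last site. -/
def tensorIdRight (X : SegOp n) : SegOp (n + 1) :=
  Matrix.of fun s t =>
    if s (Fin.last n) = t (Fin.last n) then X (Fin.init s) (Fin.init t) else 0

/-- `X ↦ I ⊗ X`, with the identity on an additional first site. -/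
def tensorIdLeft (X : SegOp n) : SegOp (n + 1) :=
  Matrix.of fun s t => if s 0 = t 0 then X (Fin.tail s) (Fin.tail t) else 0

/-! ### The infinite chain with sites `j ∈ ℤ` -/

/-- The parameters of the segment `[k, k + n - 1]`. -/
def seg (lam : ℤ → ℂ) (k : ℤ) (n : ℕ) : Fin n → ℂ := fun i => lam (k + i)

/-- The configuration `s` of the chain, replaced by `t` on `[k, k + n - 1]`. -/
def overwrite (k : ℤ) (s : ℤ → Fin 2) (t : Conf n) : ℤ → Fin 2 := fun i =>
  if h : (i - k).toNat < n ∧ k ≤ i then t ⟨(i - k).toNat, h.1⟩ else s i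

/-- The operator on the chain that acts as `X` on `[k, k + n - 1]` and as the identity on
all other sites, realized on the functions of the spin configurations of the chain. -/
def embed (k : ℤ) (X : SegOp n) : Module.End ℂ ((ℤ → Fin 2) → ℂ) where
  toFun f := fun s => ∑ t : Conf n, X (fun i => s (k + i)) t * f (overwrite k s t)
  map_add' f g := by
    funext s
    simp [mul_add, Finset.sum_add_distrib]
  map_smul' c f := by
    funext s
    simp [Finset.mul_sum, mul_left_comm]

/-- The space `𝒲` of local operators of the infinite chain. -/
def localOps : Submodule ℂ (Module.End ℂ ((ℤ → Fin 2) → ℂ)) :=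
  Submodule.span ℂ {O | ∃ (k : ℤ) (n : ℕ) (X : SegOp n), O = embed k X}

/-- The local operator given by an operator on the segment `[k, k + n - 1]`. -/
def toLocal (k : ℤ) (X : SegOp n) : localOps :=
  ⟨embed k X, Submodule.subset_span ⟨k, n, X, rfl⟩⟩

end XXZ

end

open Filter Topology

noncomputable section

namespace XXZ

/-! Taking matrix elements in the quantum space turns the dressing of `X` into ordered products of
auxiliary operators. The last site stands innermost, next to `X`; the first site stands outermost.

Right reduction is therefore elementary and holds before the limit `α → 0`. If `X` is the identity
at the last site, then `L⁻¹L` and `R⁻¹R` meet there and cancel to scalars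
(`sandwich_tensorIdRight`). These scalars match the change of normalization. At `ζ = ξ_last` the
scalar `1 - z²` vanishes and removes the pole.

Left reduction concerns the outermost factors, so it needs a cyclic trace, and the weighted trace is
not cyclic for general `α`. The form of the residue repairs this. At `ζ = ξ_j` the R-matrix of site
`j` is a multiple of the permutation, while `L` and `(1 - z²)L⁻¹` become rank-one products of a
column and a row with oscillator entries. The resulting vectors `v` and `w` pass through the sites
to the left of `j` by fusion (`fuse_colV`, `rowW_fuse`), so the whole dressing has the form `v G w`
(`fullDressed_eq_core`). Its double trace is proportional to `(q^{2α} - 1) tr⁺(q^{2αD} G a*)`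
(`traceT_traceQ`). Hence only the residue of the weighted trace at `q^{2α} = 1` survives, as the
functional `eps`.

Because `q` is not a root of unity, `eps` is a true trace (`eps_mul_comm`) that kills operators of
nonzero degree and positive powers of `q^D` (`eps_eq_zero`). Spin conservation couples the degree to
the power of `q^D`. For spin-zero `X` every unwanted term of the left reduction then has nonzero
degree or a positive power of `q^D`: the commutator of `a` and `a*` at site `j`
(`eps_core_zero_tensorIdLeft`) and `crossDefect` at the other sites (`eps_core_succ_tensorIdLeft`).

Both reductions make the segment operators compatible with enlargement of the segment
(`exists_extension`). Since operators on a segment embed injectively into the chain, the relation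
`omegaGraph` is the graph of a unique linear operator. -/

/-! ### Weighted traces as values of rational functions -/

open scoped LaurentSeries in
-- Clearing denominators: any fraction `p / r` for the series will do, reduced or not, as long as
-- `r` does not vanish at `x`. Operations on traces become polynomial arithmetic.
theorem hasOscTrace_iff {x : ℂ} {B : Module.End ℂ Fock} {v : ℂ} :
    HasOscTrace x B v ↔ ∃ p r : Polynomial ℂ, r.eval x ≠ 0 ∧
      (r : PowerSeries ℂ) * diagSeries B = p ∧ v = p.eval x / r.eval x := by
  have coe_eq (p : Polynomial ℂ) :
      ((algebraMap (Polynomial ℂ) (RatFunc ℂ) p : RatFunc ℂ) : LaurentSeries ℂ) =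
        ((p : PowerSeries ℂ) : LaurentSeries ℂ) := by
    rw [RatFunc.coe_coe, RatFunc.coePolynomial_eq_algebraMap]
  have coe_ne {p : Polynomial ℂ} (hp : p ≠ 0) :
      ((p : PowerSeries ℂ) : LaurentSeries ℂ) ≠ 0 := by
    intro h
    apply hp
    rw [← coe_eq] at h
    have h2 := (map_eq_zero _).1 h
    exact RatFunc.algebraMap_injective ℂ (h2.trans (map_zero _).symm)
  constructor
  · rintro ⟨F, hF, hx, rfl⟩
    refine ⟨F.num, F.denom, hx, ?_, ?_⟩
    · apply HahnSeries.ofPowerSeries_injective (Γ := ℤ)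
      have hF' : ((F.num : PowerSeries ℂ) : LaurentSeries ℂ) /
          ((F.denom : PowerSeries ℂ) : LaurentSeries ℂ) = (diagSeries B : LaurentSeries ℂ) := by
        rw [← hF, ← coe_eq, ← coe_eq, ← map_div₀, RatFunc.num_div_denom]
      rw [map_mul, ← hF', mul_div_cancel₀ _ (coe_ne F.denom_ne_zero)]
    · rfl
  · rintro ⟨p, r, hr, h, rfl⟩
    have hr0 : r ≠ 0 := by rintro rfl; simp at hr
    refine ⟨algebraMap _ _ p / algebraMap _ _ r, ?_, ?_, ?_⟩
    · rw [map_div₀, coe_eq, coe_eq, ← h, PowerSeries.coe_mul,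
        mul_div_cancel_left₀ _ (coe_ne hr0)]
    · intro h0
      obtain ⟨c, hc⟩ := RatFunc.denom_div_dvd p r
      exact hr (by rw [hc, Polynomial.eval_mul, h0, zero_mul])
    · have hd : Polynomial.eval x
          (RatFunc.denom (algebraMap (Polynomial ℂ) (RatFunc ℂ) p / algebraMap _ _ r)) ≠ 0 := by
        intro h0
        obtain ⟨c, hc⟩ := RatFunc.denom_div_dvd p r
        exact hr (by rw [hc, Polynomial.eval_mul, h0, zero_mul])
      have key := (RatFunc.num_mul_eq_mul_denom_iff
        (x := algebraMap (Polynomial ℂ) (RatFunc ℂ) p / algebraMap _ _ r) (p := p) hr0).2 rfl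
      have key2 := congrArg (Polynomial.eval x) key
      rw [Polynomial.eval_mul, Polynomial.eval_mul] at key2
      rw [RatFunc.eval]
      change Polynomial.eval x _ / Polynomial.eval x _ = _
      rw [div_eq_div_iff hd hr, key2]

theorem HasOscTrace.unique {x : ℂ} {B : Module.End ℂ Fock} {v w : ℂ}
    (hv : HasOscTrace x B v) (hw : HasOscTrace x B w) : v = w := by
  obtain ⟨p, r, hr, h, rfl⟩ := hasOscTrace_iff.1 hv
  obtain ⟨p', r', hr', h', rfl⟩ := hasOscTrace_iff.1 hw
  rw [div_eq_div_iff hr hr', ← Polynomial.eval_mul, ← Polynomial.eval_mul]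
  congr 1
  -- Both cross products equal `r * r' * diagSeries B` as power series.
  apply Polynomial.coe_injective ℂ
  rw [Polynomial.coe_mul, Polynomial.coe_mul, ← h, ← h']
  ring

theorem HasOscTrace.oscTrace_eq {x : ℂ} {B : Module.End ℂ Fock} {v : ℂ}
    (hv : HasOscTrace x B v) : oscTrace x B = v := by
  have h : ∃ v, HasOscTrace x B v := ⟨v, hv⟩
  rw [oscTrace, dif_pos h]
  exact h.choose_spec.unique hv

theorem diagSeries_add (B C : Module.End ℂ Fock) :
    diagSeries (B + C) = diagSeries B + diagSeries C := by
  ext k; simp [diagSeries]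

theorem diagSeries_smul (c : ℂ) (B : Module.End ℂ Fock) :
    diagSeries (c • B) = PowerSeries.C c * diagSeries B := by
  ext k; simp [diagSeries]

theorem HasOscTrace.add {x : ℂ} {B C : Module.End ℂ Fock} {v w : ℂ}
    (hv : HasOscTrace x B v) (hw : HasOscTrace x C w) : HasOscTrace x (B + C) (v + w) := by
  obtain ⟨p, r, hr, h, rfl⟩ := hasOscTrace_iff.1 hv
  obtain ⟨p', r', hr', h', rfl⟩ := hasOscTrace_iff.1 hw
  refine hasOscTrace_iff.2 ⟨p * r' + r * p', r * r', ?_, ?_, ?_⟩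
  · rw [Polynomial.eval_mul]; exact mul_ne_zero hr hr'
  · rw [diagSeries_add, Polynomial.coe_add, Polynomial.coe_mul, Polynomial.coe_mul,
      Polynomial.coe_mul, ← h, ← h']
    ring
  · rw [div_add_div _ _ hr hr', Polynomial.eval_add, Polynomial.eval_mul, Polynomial.eval_mul,
      Polynomial.eval_mul]

theorem HasOscTrace.smul {x : ℂ} {B : Module.End ℂ Fock} {v : ℂ}
    (hv : HasOscTrace x B v) (c : ℂ) : HasOscTrace x (c • B) (c * v) := by
  obtain ⟨p, r, hr, h, rfl⟩ := hasOscTrace_iff.1 hv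
  refine hasOscTrace_iff.2 ⟨Polynomial.C c * p, r, hr, ?_, ?_⟩
  · rw [diagSeries_smul, Polynomial.coe_mul, ← h, Polynomial.coe_C]
    ring
  · rw [Polynomial.eval_mul, Polynomial.eval_C, mul_div_assoc]

theorem HasOscTrace.of_diag_zero {x : ℂ} {B : Module.End ℂ Fock}
    (h : ∀ k, B (Finsupp.single k 1) k = 0) : HasOscTrace x B 0 := by
  refine hasOscTrace_iff.2 ⟨0, 1, by simp, ?_, by simp⟩
  ext k
  simp [diagSeries, h]

/-- The operators on `W⁺` whose weighted trace exists at `x`. -/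
def traceDomain (x : ℂ) : Submodule ℂ (Module.End ℂ Fock) where
  carrier := {B | HasOscTrace x B (oscTrace x B)}
  add_mem' {B C} hB hC := by
    have := HasOscTrace.add hB hC
    change HasOscTrace _ _ _
    rwa [this.oscTrace_eq]
  zero_mem' := by
    have : HasOscTrace x 0 0 := .of_diag_zero (by simp)
    change HasOscTrace _ _ _
    rwa [this.oscTrace_eq]
  smul_mem' c B hB := by
    have := HasOscTrace.smul hB c
    change HasOscTrace _ _ _
    rwa [this.oscTrace_eq]

theorem HasOscTrace.mem {x : ℂ} {B : Module.End ℂ Fock} {v : ℂ}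
    (h : HasOscTrace x B v) : B ∈ traceDomain x := by
  change HasOscTrace _ _ _
  rwa [h.oscTrace_eq]

theorem hasOscTrace_of_mem {x : ℂ} {B : Module.End ℂ Fock} (h : B ∈ traceDomain x) :
    HasOscTrace x B (oscTrace x B) := h

theorem oscTrace_zero (x : ℂ) : oscTrace x 0 = 0 :=
  (HasOscTrace.of_diag_zero (by simp)).oscTrace_eq

theorem oscTrace_add {x : ℂ} {B C : Module.End ℂ Fock} (hB : B ∈ traceDomain x)
    (hC : C ∈ traceDomain x) : oscTrace x (B + C) = oscTrace x B + oscTrace x C :=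
  (hasOscTrace_of_mem hB |>.add (hasOscTrace_of_mem hC)).oscTrace_eq

theorem oscTrace_smul {x : ℂ} {B : Module.End ℂ Fock} (hB : B ∈ traceDomain x) (c : ℂ) :
    oscTrace x (c • B) = c * oscTrace x B :=
  ((hasOscTrace_of_mem hB).smul c).oscTrace_eq

theorem oscTrace_sum {x : ℂ} {ι : Type*} (s : Finset ι) {B : ι → Module.End ℂ Fock}
    (hB : ∀ i ∈ s, B i ∈ traceDomain x) :
    oscTrace x (∑ i ∈ s, B i) = ∑ i ∈ s, oscTrace x (B i) := by
  classical
  induction s using Finset.induction_on with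
  | empty => simp [oscTrace_zero]
  | insert i s hi ih =>
    rw [Finset.sum_insert hi, Finset.sum_insert hi, oscTrace_add (hB i (by simp))
      (Submodule.sum_mem _ fun j hj => hB j (by simp [hj])), ih fun j hj => hB j (by simp [hj])]

/-- The weighted trace of the operator with diagonal `c y ^ k`. -/
theorem HasOscTrace.of_diag_geom {x : ℂ} {B : Module.End ℂ Fock} (y : ℂ)
    (h : ∀ k, B (Finsupp.single k 1) k = y ^ k) (hx : y * x ≠ 1) :
    HasOscTrace x B (1 / (1 - y * x)) := by
  have hr : (1 - Polynomial.C y * Polynomial.X : Polynomial ℂ).eval x ≠ 0 := by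
    simpa [sub_eq_zero] using hx.symm
  refine hasOscTrace_iff.2 ⟨1, 1 - Polynomial.C y * Polynomial.X, hr, ?_, by simp⟩
  have : diagSeries B = PowerSeries.mk fun k => y ^ k := by
    ext k; simp [diagSeries, h]
  rw [this]
  ext k
  simp only [Polynomial.coe_sub, Polynomial.coe_one, Polynomial.coe_mul, Polynomial.coe_C,
    Polynomial.coe_X, sub_mul, one_mul, map_sub, mul_assoc, PowerSeries.coeff_C_mul,
    PowerSeries.coeff_mk]
  cases k with
  | zero => simp
  | succ k => simp [PowerSeries.coeff_succ_X_mul, PowerSeries.coeff_one, pow_succ']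

/-- A trace depends on the diagonal only. -/
theorem HasOscTrace.congr_diag {x v : ℂ} {B C : Module.End ℂ Fock} (hB : HasOscTrace x B v)
    (h : ∀ k, B (Finsupp.single k 1) k = C (Finsupp.single k 1) k) : HasOscTrace x C v := by
  have : diagSeries C = diagSeries B := by
    ext k; simp [diagSeries, h]
  unfold HasOscTrace at *
  rwa [this]

/-- The trace of an operator whose diagonal is shifted by one step. -/
theorem HasOscTrace.of_shift {x v : ℂ} {B C : Module.End ℂ Fock} (hB : HasOscTrace x B v)
    (h : ∀ k, C (Finsupp.single (k + 1) 1) (k + 1) = B (Finsupp.single k 1) k) :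
    HasOscTrace x C (C (Finsupp.single 0 1) 0 + x * v) := by
  obtain ⟨p, r, hr, h1, rfl⟩ := hasOscTrace_iff.1 hB
  refine hasOscTrace_iff.2
    ⟨Polynomial.C (C (Finsupp.single 0 1) 0) * r + Polynomial.X * p, r, hr, ?_, ?_⟩
  · have : diagSeries C = PowerSeries.C (C (Finsupp.single 0 1) 0) +
        PowerSeries.X * diagSeries B := by
      ext k
      cases k with
      | zero => simp [diagSeries]
      | succ k => simp [diagSeries, h, PowerSeries.coeff_succ_X_mul]
    rw [this, Polynomial.coe_add, Polynomial.coe_mul, Polynomial.coe_mul, ← h1,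
      Polynomial.coe_C, Polynomial.coe_X]
    ring
  · simp only [Polynomial.eval_add, Polynomial.eval_mul, Polynomial.eval_C, Polynomial.eval_X]
    field_simp

/-! ### Relations and normal ordering in the q-oscillator algebra -/

/-- `q^{mD}`. -/
def qPow (η : ℂ) (m : ℤ) : Module.End ℂ Fock :=
  Finsupp.linearCombination ℂ fun k : ℕ => Finsupp.single k (Complex.exp (m * k * η))

theorem qPow_single (η : ℂ) (m : ℤ) (k : ℕ) (c : ℂ) :
    qPow η m (Finsupp.single k c) = Finsupp.single k (c * Complex.exp (m * k * η)) := by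
  simp [qPow]

theorem oscA_single (η : ℂ) (k : ℕ) (c : ℂ) :
    oscA η (Finsupp.single k c) =
      Finsupp.single (k - 1) (c * (1 - Complex.exp (2 * k * η))) := by
  rw [oscA, Finsupp.linearCombination_single, Finsupp.smul_single, smul_eq_mul]

theorem oscAdag_single (k : ℕ) (c : ℂ) :
    oscAdag (Finsupp.single k c) = Finsupp.single (k + 1) c := by
  simp [oscAdag]

theorem qD_eq (η : ℂ) : qD η = qPow η 1 := by simp [qD, qPow]

theorem qDinv_eq (η : ℂ) : qDinv η = qPow η (-1) := by simp [qDinv, qPow]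

theorem fock_ext {A B : Module.End ℂ Fock}
    (h : ∀ k, A (Finsupp.single k 1) = B (Finsupp.single k 1)) : A = B := by
  apply Finsupp.lhom_ext'
  intro k
  apply LinearMap.ext_ring
  simpa using h k

theorem qPow_zero (η : ℂ) : qPow η 0 = 1 := by
  refine fock_ext fun k => ?_
  simp [qPow_single]

theorem qPow_mul (η : ℂ) (m n : ℤ) : qPow η m * qPow η n = qPow η (m + n) := by
  refine fock_ext fun k => ?_
  simp only [Module.End.mul_apply, qPow_single, one_mul, ← Complex.exp_add]
  congr 2
  push_cast
  ring

theorem qPow_mul_adag (η : ℂ) (m : ℤ) :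
    qPow η m * oscAdag = Complex.exp (m * η) • (oscAdag * qPow η m) := by
  refine fock_ext fun k => ?_
  simp only [Module.End.mul_apply, LinearMap.smul_apply, qPow_single, oscAdag_single, one_mul,
    Finsupp.smul_single, smul_eq_mul, ← Complex.exp_add]
  congr 2
  push_cast
  ring

theorem a_mul_qPow (η : ℂ) (m : ℤ) :
    oscA η * qPow η m = Complex.exp (m * η) • (qPow η m * oscA η) := by
  refine fock_ext fun k => ?_
  simp only [Module.End.mul_apply, LinearMap.smul_apply, qPow_single, oscA_single, one_mul,
    Finsupp.smul_single, smul_eq_mul]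
  cases k with
  | zero => simp
  | succ k =>
    rw [mul_left_comm, ← Complex.exp_add]
    simp only [Nat.add_sub_cancel]
    rw [mul_comm]
    congr 3
    push_cast
    ring

theorem adag_mul_a (η : ℂ) : oscAdag * oscA η = 1 - qPow η 2 := by
  refine fock_ext fun k => ?_
  simp only [Module.End.mul_apply, LinearMap.sub_apply, qPow_single, oscA_single, one_mul,
    oscAdag_single, Module.End.one_apply]
  cases k with
  | zero => simp
  | succ k => simp [← Finsupp.single_sub]

theorem a_mul_adag (η : ℂ) :
    oscA η * oscAdag = 1 - Complex.exp (2 * η) • qPow η 2 := by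
  refine fock_ext fun k => ?_
  simp only [Module.End.mul_apply, LinearMap.sub_apply, qPow_single, oscA_single, one_mul,
    oscAdag_single, Module.End.one_apply, LinearMap.smul_apply, Finsupp.smul_single, smul_eq_mul,
    ← Finsupp.single_sub, ← Complex.exp_add, Nat.add_sub_cancel]
  congr 3
  push_cast
  ring

/-- The normally ordered monomial `a*^i q^{mD} a^j`. -/
def oscMono (η : ℂ) (i : ℕ) (m : ℤ) (j : ℕ) : Module.End ℂ Fock :=
  oscAdag ^ i * qPow η m * oscA η ^ j

/-- The span of the monomials `a*^i q^{(δ + 2m)D} a^j` with `m ≥ 0` and `i - j = d`. -/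
def oscGraded (η : ℂ) (δ d : ℤ) : Submodule ℂ (Module.End ℂ Fock) :=
  Submodule.span ℂ {B | ∃ (i m j : ℕ), (i : ℤ) - j = d ∧ B = oscMono η i (δ + 2 * m) j}

/-- The q-oscillator algebra in its representation on `W⁺`. -/
def oscAlg (η : ℂ) : Submodule ℂ (Module.End ℂ Fock) :=
  Submodule.span ℂ {B | ∃ (i j : ℕ) (m : ℤ), B = oscMono η i m j}

variable {η : ℂ}

theorem oscMono_mem (i m j : ℕ) (δ d : ℤ) (h : (i : ℤ) - j = d) :
    oscMono η i (δ + 2 * m) j ∈ oscGraded η δ d :=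
  Submodule.subset_span ⟨i, m, j, h, rfl⟩

theorem mul_mem_of_span {S : Set (Module.End ℂ Fock)} {W : Submodule ℂ (Module.End ℂ Fock)}
    {A B : Module.End ℂ Fock} (hB : B ∈ Submodule.span ℂ S) (h : ∀ C ∈ S, A * C ∈ W) :
    A * B ∈ W := by
  induction hB using Submodule.span_induction with
  | mem C hC => exact h C hC
  | zero => simp
  | add x y _ _ hx hy => rw [mul_add]; exact W.add_mem hx hy
  | smul c x _ hx => rw [mul_smul_comm]; exact W.smul_mem _ hx

theorem adag_mul_mem {δ d : ℤ} {B : Module.End ℂ Fock} (hB : B ∈ oscGraded η δ d) :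
    oscAdag * B ∈ oscGraded η δ (d + 1) := by
  refine mul_mem_of_span hB ?_
  rintro _ ⟨i, m, j, h, rfl⟩
  have : oscAdag * oscMono η i (δ + 2 * m) j = oscMono η (i + 1) (δ + 2 * m) j := by
    simp only [oscMono, pow_succ', mul_assoc]
  rw [this]
  exact oscMono_mem _ _ _ _ _ (by push_cast; omega)

theorem qPow_mul_adag_pow (m : ℤ) (i : ℕ) :
    qPow η m * oscAdag ^ i = Complex.exp (m * η) ^ i • (oscAdag ^ i * qPow η m) := by
  induction i with
  | zero => simp
  | succ i ih =>
    rw [pow_succ, ← mul_assoc, ih, smul_mul_assoc, mul_assoc, qPow_mul_adag, mul_smul_comm,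
      smul_smul, ← pow_succ, mul_assoc]

theorem qPow_mul_oscMono (n : ℤ) (i : ℕ) (m : ℤ) (j : ℕ) :
    qPow η n * oscMono η i m j = Complex.exp (n * η) ^ i • oscMono η i (n + m) j := by
  rw [oscMono, ← mul_assoc, ← mul_assoc, qPow_mul_adag_pow, smul_mul_assoc, smul_mul_assoc,
    mul_assoc (oscAdag ^ i), qPow_mul, oscMono]

theorem qPow_mul_mem {δ d : ℤ} {B : Module.End ℂ Fock} (n : ℤ) (hB : B ∈ oscGraded η δ d) :
    qPow η n * B ∈ oscGraded η (n + δ) d := by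
  refine mul_mem_of_span hB ?_
  rintro _ ⟨i, m, j, h, rfl⟩
  rw [qPow_mul_oscMono, ← add_assoc]
  exact Submodule.smul_mem _ _ (oscMono_mem _ _ _ _ _ h)

/-- The filtration decreases in steps of two, because every reordering of `a` and `a*` produces
`q^{2D}`; the parity of the exponent is kept. -/
theorem oscGraded_mono (n : ℕ) {δ d : ℤ} {B : Module.End ℂ Fock}
    (hB : B ∈ oscGraded η (2 * n + δ) d) : B ∈ oscGraded η δ d := by
  rw [← one_mul B]
  refine mul_mem_of_span hB ?_
  rintro _ ⟨i, m, j, h, rfl⟩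
  rw [one_mul, show 2 * (n : ℤ) + δ + 2 * m = δ + 2 * ((n + m : ℕ) : ℤ) by push_cast; ring]
  exact oscMono_mem _ _ _ _ _ h

theorem one_sub_smul_mul {A : Type*} [Ring A] [Algebra ℂ A] (c : ℂ) (x y : A) :
    (1 - c • x) * y = y + (-c) • (x * y) := by
  rw [sub_mul, one_mul, smul_mul_assoc, neg_smul, sub_eq_add_neg]

theorem a_mul_oscMono (i : ℕ) (m : ℤ) (j : ℕ) :
    oscA η * oscMono η (i + 1) m j =
      oscMono η i m j + (-Complex.exp (2 * η)) • (qPow η 2 * oscMono η i m j) := by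
  have : oscA η * oscMono η (i + 1) m j = (oscA η * oscAdag) * oscMono η i m j := by
    simp only [oscMono, pow_succ', mul_assoc]
  rw [this, a_mul_adag]
  exact one_sub_smul_mul (A := Module.End ℂ Fock) _ _ _

theorem a_mul_oscMono_zero (m : ℤ) (j : ℕ) :
    oscA η * oscMono η 0 m j = Complex.exp (m * η) • oscMono η 0 m (j + 1) := by
  simp only [oscMono, pow_zero, one_mul]
  rw [← mul_assoc, a_mul_qPow, smul_mul_assoc, pow_succ', mul_assoc]

/-- Moving `a` to the right past one `a*` only adds a term with an extra `q^{2D}`, so the lowest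
power of `q^D` never drops. -/
theorem a_mul_mem {δ d : ℤ} {B : Module.End ℂ Fock} (hB : B ∈ oscGraded η δ d) :
    oscA η * B ∈ oscGraded η δ (d - 1) := by
  refine mul_mem_of_span hB ?_
  rintro _ ⟨i, m, j, h, rfl⟩
  cases i with
  | zero =>
    rw [a_mul_oscMono_zero]
    exact Submodule.smul_mem _ _ (oscMono_mem _ _ _ _ _ (by push_cast at *; omega))
  | succ i =>
    have hm : oscMono η i (δ + 2 * m) j ∈ oscGraded η δ (d - 1) :=
      oscMono_mem _ _ _ _ _ (by push_cast at *; omega)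
    rw [a_mul_oscMono]
    exact Submodule.add_mem _ hm
      (Submodule.smul_mem _ _ (oscGraded_mono 1 (by simpa using qPow_mul_mem 2 hm)))

theorem oscMono_mul_mem (i m j : ℕ) {δ δ' d : ℤ} {B : Module.End ℂ Fock}
    (hB : B ∈ oscGraded η δ' d) :
    oscMono η i (δ + 2 * m) j * B ∈ oscGraded η (δ + δ') (i - j + d) := by
  have h1 : ∀ j : ℕ, oscA η ^ j * B ∈ oscGraded η δ' (d - j) := by
    intro j
    induction j with
    | zero => simpa using hB
    | succ j ih =>
      rw [pow_succ', mul_assoc]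
      convert a_mul_mem ih using 1
      push_cast; ring_nf
  have h2 : qPow η (δ + 2 * m) * (oscA η ^ j * B) ∈ oscGraded η (δ + δ') (d - j) := by
    apply oscGraded_mono m
    convert qPow_mul_mem (δ + 2 * m) (h1 j) using 1
    ring_nf
  have h3 : ∀ i : ℕ, oscAdag ^ i * (qPow η (δ + 2 * m) * (oscA η ^ j * B)) ∈
      oscGraded η (δ + δ') (i - j + d) := by
    intro i
    induction i with
    | zero =>
      rw [pow_zero, one_mul]
      convert h2 using 1
      congr 1
      push_cast
      ring
    | succ i ih =>
      rw [pow_succ', mul_assoc]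
      convert adag_mul_mem ih using 1
      push_cast; ring_nf
  simpa only [oscMono, mul_assoc] using h3 i

theorem oscGraded_mul {δ δ' d d' : ℤ} {A B : Module.End ℂ Fock}
    (hA : A ∈ oscGraded η δ d) (hB : B ∈ oscGraded η δ' d') :
    A * B ∈ oscGraded η (δ + δ') (d + d') := by
  induction hA using Submodule.span_induction with
  | mem C hC =>
    obtain ⟨i, m, j, h, rfl⟩ := hC
    rw [← h]
    exact oscMono_mul_mem i m j hB
  | zero => simp
  | add x y _ _ hx hy => rw [add_mul]; exact Submodule.add_mem _ hx hy
  | smul c x _ hx => rw [smul_mul_assoc]; exact Submodule.smul_mem _ _ hx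

theorem oscGraded_le (δ d : ℤ) : oscGraded η δ d ≤ oscAlg η := by
  refine Submodule.span_le.2 ?_
  rintro _ ⟨i, m, j, -, rfl⟩
  exact Submodule.subset_span ⟨i, j, _, rfl⟩

theorem oscMono_mem' (i : ℕ) (m : ℤ) (j : ℕ) : oscMono η i m j ∈ oscGraded η m (i - j) := by
  simpa using oscMono_mem (η := η) i 0 j m (i - j) rfl

theorem oscAlg_mul {A B : Module.End ℂ Fock} (hA : A ∈ oscAlg η) (hB : B ∈ oscAlg η) :
    A * B ∈ oscAlg η := by
  refine mul_mem_of_span hB ?_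
  rintro _ ⟨i, j, m, rfl⟩
  induction hA using Submodule.span_induction with
  | mem C hC =>
    obtain ⟨i', j', m', rfl⟩ := hC
    exact oscGraded_le _ _ (oscGraded_mul (oscMono_mem' i' m' j') (oscMono_mem' i m j))
  | zero => simp
  | add x y _ _ hx hy => rw [add_mul]; exact Submodule.add_mem _ hx hy
  | smul c x _ hx => rw [smul_mul_assoc]; exact Submodule.smul_mem _ _ hx

theorem one_mem_oscGraded : (1 : Module.End ℂ Fock) ∈ oscGraded η 0 0 := by
  have := oscMono_mem' (η := η) 0 0 0
  simpa [oscMono, qPow_zero] using this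

theorem qPow_mem_oscGraded (m : ℤ) : qPow η m ∈ oscGraded η m 0 := by
  have := oscMono_mem' (η := η) 0 m 0
  simpa [oscMono] using this

theorem a_mem_oscGraded : oscA η ∈ oscGraded η 0 (-1) := by
  have := oscMono_mem' (η := η) 0 0 1
  simpa [oscMono, qPow_zero] using this

theorem adag_mem_oscGraded : oscAdag ∈ oscGraded η 0 1 := by
  have := oscMono_mem' (η := η) 1 0 0
  simpa [oscMono, qPow_zero] using this

/-! ### The residue of the weighted trace at `q^{2α} = 1` -/

/-- `c` is the limit of `(1 - q^{2α}) tr⁺ (q^{2αD} B)` for `α → 0`. -/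
def HasEps (η : ℂ) (B : Module.End ℂ Fock) (c : ℂ) : Prop :=
  (∀ᶠ α in 𝓝[≠] (0 : ℂ), B ∈ traceDomain (Complex.exp (2 * α * η))) ∧
    Tendsto (fun α => (1 - Complex.exp (2 * α * η)) * oscTrace (Complex.exp (2 * α * η)) B)
      (𝓝[≠] 0) (𝓝 c)

/-- The limit of `(1 - q^{2α}) tr⁺ (q^{2αD} B)` for `α → 0`. -/
def eps (η : ℂ) (B : Module.End ℂ Fock) : ℂ :=
  limUnder (𝓝[≠] 0) fun α =>
    (1 - Complex.exp (2 * α * η)) * oscTrace (Complex.exp (2 * α * η)) B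

theorem HasEps.eps_eq {B : Module.End ℂ Fock} {c : ℂ} (h : HasEps η B c) : eps η B = c :=
  h.2.limUnder_eq

theorem HasEps.add {B C : Module.End ℂ Fock} {b c : ℂ} (hB : HasEps η B b)
    (hC : HasEps η C c) : HasEps η (B + C) (b + c) := by
  refine ⟨?_, (hB.2.add hC.2).congr' ?_⟩
  · filter_upwards [hB.1, hC.1] with α h1 h2 using Submodule.add_mem _ h1 h2
  · filter_upwards [hB.1, hC.1] with α h1 h2
    rw [oscTrace_add h1 h2, mul_add]

theorem HasEps.smul {B : Module.End ℂ Fock} {b : ℂ} (hB : HasEps η B b) (c : ℂ) :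
    HasEps η (c • B) (c * b) := by
  refine ⟨?_, (hB.2.const_mul c).congr' ?_⟩
  · filter_upwards [hB.1] with α h1 using Submodule.smul_mem _ _ h1
  · filter_upwards [hB.1] with α h1
    rw [oscTrace_smul h1]
    ring

theorem HasEps.of_diag_zero {B : Module.End ℂ Fock}
    (h : ∀ k, B (Finsupp.single k 1) k = 0) : HasEps η B 0 := by
  refine ⟨Eventually.of_forall fun α => (HasOscTrace.of_diag_zero h).mem, ?_⟩
  simp [(HasOscTrace.of_diag_zero h).oscTrace_eq]

theorem HasEps.sum {ι : Type*} (s : Finset ι) {B : ι → Module.End ℂ Fock} {b : ι → ℂ}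
    (h : ∀ i ∈ s, HasEps η (B i) (b i)) : HasEps η (∑ i ∈ s, B i) (∑ i ∈ s, b i) := by
  classical
  induction s using Finset.induction_on with
  | empty => simpa using HasEps.of_diag_zero (η := η) (B := 0) (by simp)
  | insert i s hi ih =>
    rw [Finset.sum_insert hi, Finset.sum_insert hi]
    exact (h i (by simp)).add (ih fun j hj => h j (by simp [hj]))

theorem HasEps.congr_diag {B C : Module.End ℂ Fock} {b : ℂ} (hB : HasEps η B b)
    (h : ∀ k, B (Finsupp.single k 1) k = C (Finsupp.single k 1) k) : HasEps η C b := by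
  refine ⟨?_, hB.2.congr' ?_⟩
  · filter_upwards [hB.1] with α h1 using ((hasOscTrace_of_mem h1).congr_diag h).mem
  · filter_upwards [hB.1] with α h1
    rw [((hasOscTrace_of_mem h1).congr_diag h).oscTrace_eq]

theorem tendsto_exp_two_mul (η : ℂ) :
    Tendsto (fun α : ℂ => Complex.exp (2 * α * η)) (𝓝[≠] 0) (𝓝 1) := by
  have : Continuous fun α : ℂ => Complex.exp (2 * α * η) := by fun_prop
  simpa using (this.tendsto 0).mono_left nhdsWithin_le_nhds

/-- Shifting the diagonal by one step multiplies the trace by `x` and adds a single entry. After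
multiplication by `1 - x`, as `x → 1`, neither change is visible. This is the source of the
cyclicity of `eps`. -/
theorem HasEps.of_shift {B C : Module.End ℂ Fock} {b : ℂ} (hB : HasEps η B b)
    (h : ∀ k, C (Finsupp.single (k + 1) 1) (k + 1) = B (Finsupp.single k 1) k) :
    HasEps η C b := by
  have hx := tendsto_exp_two_mul η
  refine ⟨?_, ?_⟩
  · filter_upwards [hB.1] with α h1 using ((hasOscTrace_of_mem h1).of_shift h).mem
  · have h2 := (((tendsto_const_nhds (x := (1 : ℂ))).sub hx).mul_const
      (C (Finsupp.single 0 1) 0)).add (hx.mul hB.2)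
    rw [sub_self, zero_mul, zero_add, one_mul] at h2
    refine h2.congr' ?_
    filter_upwards [hB.1] with α h1
    rw [((hasOscTrace_of_mem h1).of_shift h).oscTrace_eq]
    ring

/-! ### Existence, vanishing and cyclicity of the residue functional -/

section NotRootOfUnity

variable (hη : ∀ m : ℕ, 0 < m → Complex.exp (m * η) ≠ 1)
include hη

theorem eta_ne_zero : η ≠ 0 := by
  rintro rfl
  simpa using hη 1 one_pos

theorem exp_int_mul_ne_one {m : ℤ} (hm : m ≠ 0) : Complex.exp (m * η) ≠ 1 := by
  rcases lt_or_gt_of_ne hm with h | h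
  · intro h1
    obtain ⟨n, rfl⟩ : ∃ n : ℕ, m = -n := ⟨m.natAbs, by omega⟩
    apply hη n (by omega)
    have := congrArg (·⁻¹) h1
    simpa [← Complex.exp_neg] using this
  · obtain ⟨n, rfl⟩ : ∃ n : ℕ, m = n := ⟨m.natAbs, by omega⟩
    simpa using hη n (by omega)

theorem eventually_exp_mul_ne_one (m : ℤ) :
    ∀ᶠ α in 𝓝[≠] (0 : ℂ), Complex.exp (m * η) * Complex.exp (2 * α * η) ≠ 1 := by
  by_cases hm : m = 0
  -- For `m = 0` the excluded value is attained at `α = 0` itself; the derivative `2η ≠ 0` makes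
  -- that solution isolated.
  · subst hm
    have h : HasDerivAt (fun α : ℂ => Complex.exp (2 * α * η)) (2 * η) 0 := by
      have h1 : HasDerivAt (fun α : ℂ => 2 * α * η) (2 * η) 0 := by
        simpa using ((hasDerivAt_id (0 : ℂ)).const_mul 2).mul_const η
      simpa using h1.cexp
    have := h.eventually_ne (c := 1) (mul_ne_zero two_ne_zero (eta_ne_zero hη))
    simpa using this
  · have h := (tendsto_exp_two_mul η).const_mul (Complex.exp (m * η))
    rw [mul_one] at h
    exact h.eventually_ne (exp_int_mul_ne_one hη hm)

/-- The trace is the geometric series `1 / (1 - q^m x)`, which has a pole at `x = 1` only for `m =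
0`. -/
theorem hasEps_qPow (m : ℤ) : HasEps η (qPow η m) (if m = 0 then 1 else 0) := by
  have hd : ∀ k, qPow η m (Finsupp.single k 1) k = Complex.exp (m * η) ^ k := by
    intro k
    rw [qPow_single, one_mul, Finsupp.single_eq_same, ← Complex.exp_nat_mul]
    congr 1
    ring
  have he := eventually_exp_mul_ne_one hη m
  refine ⟨?_, ?_⟩
  · filter_upwards [he] with α h1 using (HasOscTrace.of_diag_geom _ hd h1).mem
  · split_ifs with hm
    · refine tendsto_const_nhds.congr' ?_
      filter_upwards [he] with α h1
      rw [(HasOscTrace.of_diag_geom _ hd h1).oscTrace_eq]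
      subst hm
      simp only [Int.cast_zero, zero_mul, Complex.exp_zero, one_mul] at h1 ⊢
      rw [mul_one_div_cancel (sub_ne_zero.2 (Ne.symm h1))]
    · have h1 := tendsto_exp_two_mul η
      have h2 := ((tendsto_const_nhds (x := (1 : ℂ))).sub h1).mul
        ((tendsto_const_nhds (x := (1 : ℂ))).div
          ((tendsto_const_nhds (x := (1 : ℂ))).sub (h1.const_mul (Complex.exp (m * η))))
          (by rw [mul_one]; exact sub_ne_zero.2 (exp_int_mul_ne_one hη hm).symm))
      rw [sub_self, zero_mul] at h2
      refine h2.congr' ?_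
      filter_upwards [he] with α h1
      rw [(HasOscTrace.of_diag_geom _ hd h1).oscTrace_eq]
      rfl

omit hη in
theorem a_pow_single (j k : ℕ) :
    (oscA η ^ j) (Finsupp.single k 1) = Finsupp.single (k - j)
      (∏ r ∈ Finset.range j, (1 - Complex.exp (-(2 * r) * η) * Complex.exp (2 * η) ^ k)) := by
  induction j with
  | zero => simp
  | succ j ih =>
    rw [pow_succ', Module.End.mul_apply, ih, oscA_single, Finset.prod_range_succ, Nat.sub_sub]
    rcases le_or_gt j k with h | h
    · congr 3
      rw [Nat.cast_sub h, ← Complex.exp_nat_mul, ← Complex.exp_add]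
      congr 1
      ring
    · rw [Finset.prod_eq_zero (Finset.mem_range.2 h), zero_mul, zero_mul]
      rw [← Complex.exp_nat_mul, ← Complex.exp_add]
      ring_nf
      simp

omit hη in
theorem adag_pow_single (i k : ℕ) (c : ℂ) :
    (oscAdag ^ i) (Finsupp.single k c) = Finsupp.single (k + i) c := by
  induction i with
  | zero => simp
  | succ i ih => rw [pow_succ', Module.End.mul_apply, ih, oscAdag_single, add_assoc]

/-- Off-balance monomials have zero diagonal. Balanced ones have the diagonal of a combination of
`q^{(m + 2l)D}` with `l ≥ 0`, so for `m > 0` the pole is absent. -/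
theorem hasEps_oscMono (i : ℕ) (m : ℤ) (j : ℕ) :
    ∃ c, HasEps η (oscMono η i m j) c ∧ (i ≠ j ∨ 0 < m → c = 0) := by
  by_cases hij : i = j
  · subst hij
    -- The diagonal entry at `|k⟩` is `q^{m(k-i)} P(q^{2k})`; the coefficients of `P` give the
    -- expansion in powers of `q^D`.
    let P : Polynomial ℂ := ∏ r ∈ Finset.range i,
      (1 - Polynomial.C (Complex.exp (-(2 * r) * η)) * Polynomial.X)
    have hP : ∀ y, P.eval y = ∏ r ∈ Finset.range i, (1 - Complex.exp (-(2 * r) * η) * y) := by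
      intro y
      simp [P, Polynomial.eval_prod]
    have h1 := HasEps.sum (η := η) (Finset.range (P.natDegree + 1))
      (fun l _ => (hasEps_qPow hη (m + 2 * l)).smul (Complex.exp (-(m * i * η)) * P.coeff l))
    refine ⟨_, h1.congr_diag ?_, ?_⟩
    · intro k
      simp only [oscMono, Module.End.mul_apply, a_pow_single, qPow_single, adag_pow_single,
        LinearMap.coe_sum, Finset.sum_apply, LinearMap.smul_apply, Finsupp.coe_finsetSum,
        Finsupp.smul_apply, Finsupp.single_eq_same, one_mul, smul_eq_mul]
      rw [← hP]
      rcases le_or_gt i k with h | h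
      · rw [Nat.sub_add_cancel h, Finsupp.single_eq_same, Polynomial.eval_eq_sum_range,
          Finset.sum_mul]
        refine Finset.sum_congr rfl fun l _ => ?_
        rw [Nat.cast_sub h, ← Complex.exp_nat_mul, ← Complex.exp_nat_mul, mul_right_comm,
          mul_comm _ (P.coeff l), mul_assoc (P.coeff l), ← Complex.exp_add, ← Complex.exp_add]
        congr 2
        push_cast
        ring
      -- For `k < i` the subtraction `k - i` is truncated, but the factor `r = k` of `P` vanishes,
      -- so both diagonals are zero.
      · have h0 : P.eval (Complex.exp (2 * η) ^ k) = 0 := by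
          rw [hP]
          refine Finset.prod_eq_zero (Finset.mem_range.2 h) ?_
          rw [← Complex.exp_nat_mul, ← Complex.exp_add]
          ring_nf
          simp
        rw [h0, zero_mul, Finsupp.single_zero, Finsupp.zero_apply]
        rw [Polynomial.eval_eq_sum_range] at h0
        trans Complex.exp (-(m * i * η)) * Complex.exp (m * k * η) *
          ∑ l ∈ Finset.range (P.natDegree + 1), P.coeff l * (Complex.exp (2 * η) ^ k) ^ l
        · rw [Finset.mul_sum]
          refine Finset.sum_congr rfl fun l _ => ?_
          rw [show ((m + 2 * l : ℤ) : ℂ) * k * η = m * k * η + (l : ℂ) * ((k : ℂ) * (2 * η)) by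
            push_cast; ring, Complex.exp_add, Complex.exp_nat_mul, Complex.exp_nat_mul]
          ring
        · rw [h0, mul_zero]
    · intro h
      refine Finset.sum_eq_zero fun l _ => ?_
      rw [if_neg (by rcases h with h | h <;> [exact absurd rfl h; omega]), mul_zero]
  · refine ⟨0, HasEps.of_diag_zero ?_, fun _ => rfl⟩
    intro k
    simp only [oscMono, Module.End.mul_apply, a_pow_single, qPow_single, adag_pow_single]
    rcases le_or_gt j k with h | h
    · rw [Finsupp.single_eq_of_ne (by omega)]
    · rw [Finset.prod_eq_zero (Finset.mem_range.2 h), zero_mul, Finsupp.single_zero,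
        Finsupp.zero_apply]
      rw [← Complex.exp_nat_mul, ← Complex.exp_add]
      ring_nf
      simp

theorem hasEps_eps {B : Module.End ℂ Fock} (hB : B ∈ oscAlg η) : HasEps η B (eps η B) := by
  have : ∃ c, HasEps η B c := by
    induction hB using Submodule.span_induction with
    | mem C hC =>
      obtain ⟨i, j, m, rfl⟩ := hC
      exact (hasEps_oscMono hη i m j).imp fun c hc => hc.1
    | zero => exact ⟨0, .of_diag_zero (by simp)⟩
    | add x y _ _ hx hy => exact ⟨_, hx.choose_spec.add hy.choose_spec⟩
    | smul c x _ hx => exact ⟨_, hx.choose_spec.smul c⟩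
  obtain ⟨c, hc⟩ := this
  rwa [hc.eps_eq]

theorem eps_add {B C : Module.End ℂ Fock} (hB : B ∈ oscAlg η) (hC : C ∈ oscAlg η) :
    eps η (B + C) = eps η B + eps η C :=
  ((hasEps_eps hη hB).add (hasEps_eps hη hC)).eps_eq

theorem eps_smul {B : Module.End ℂ Fock} (hB : B ∈ oscAlg η) (c : ℂ) :
    eps η (c • B) = c * eps η B :=
  ((hasEps_eps hη hB).smul c).eps_eq

theorem eps_eq_zero {δ d : ℤ} (h : d ≠ 0 ∨ 0 < δ) {B : Module.End ℂ Fock}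
    (hB : B ∈ oscGraded η δ d) : eps η B = 0 := by
  refine HasEps.eps_eq ?_
  induction hB using Submodule.span_induction with
  | mem C hC =>
    obtain ⟨i, m, j, hij, rfl⟩ := hC
    obtain ⟨c, hc, h0⟩ := hasEps_oscMono hη i (δ + 2 * m) j
    rw [h0 (by rcases h with h | h <;> [left; right] <;> omega)] at hc
    exact hc
  | zero => exact .of_diag_zero (by simp)
  | add x y _ _ hx hy => simpa using hx.add hy
  | smul c x _ hx => simpa using hx.smul c

omit hη in
theorem adag_mem : oscAdag ∈ oscAlg η := oscGraded_le _ _ adag_mem_oscGraded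

omit hη in
theorem a_mem : oscA η ∈ oscAlg η := oscGraded_le _ _ a_mem_oscGraded

omit hη in
theorem qPow_mem (m : ℤ) : qPow η m ∈ oscAlg η := oscGraded_le _ _ (qPow_mem_oscGraded m)

omit hη in
theorem one_mem : (1 : Module.End ℂ Fock) ∈ oscAlg η := oscGraded_le _ _ one_mem_oscGraded

omit hη in
theorem adag_apply (f : Fock) (k : ℕ) : oscAdag f (k + 1) = f k := by
  induction f using Finsupp.induction_linear with
  | zero => simp
  | add f g hf hg => simp [hf, hg]
  | single m c => simp [oscAdag_single, Finsupp.single_apply]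

omit hη in
theorem a_apply (f : Fock) (k : ℕ) :
    oscA η f k = (1 - Complex.exp (2 * ((k + 1 : ℕ) : ℂ) * η)) * f (k + 1) := by
  induction f using Finsupp.induction_linear with
  | zero => simp
  | add f g hf hg => simp [hf, hg, mul_add]
  | single m c =>
    rw [oscA_single]
    cases m with
    | zero => simp
    | succ m =>
      by_cases h : m = k
      · subst h; simp [mul_comm]
      · simp [h]

omit hη in
theorem qPow_apply (m : ℤ) (f : Fock) (k : ℕ) :
    qPow η m f k = Complex.exp (m * k * η) * f k := by
  induction f using Finsupp.induction_linear with
  | zero => simp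
  | add f g hf hg => simp [hf, hg, mul_add]
  | single l c =>
    rw [qPow_single]
    by_cases h : l = k
    · subst h; simp [mul_comm]
    · simp [h]

/-- The diagonals of `a* B` and `B a*` are shifts of each other, so `HasEps.of_shift` applies; the
same holds for `a`. For powers of `q^D` the two diagonals are equal. -/
theorem eps_adag_mul {B : Module.End ℂ Fock} (hB : B ∈ oscAlg η) :
    eps η (oscAdag * B) = eps η (B * oscAdag) := by
  refine ((hasEps_eps hη (oscAlg_mul hB adag_mem)).of_shift fun k => ?_).eps_eq
  rw [Module.End.mul_apply, Module.End.mul_apply, adag_apply, oscAdag_single]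

theorem eps_a_mul {B : Module.End ℂ Fock} (hB : B ∈ oscAlg η) :
    eps η (oscA η * B) = eps η (B * oscA η) := by
  refine (((hasEps_eps hη (oscAlg_mul a_mem hB)).of_shift fun k => ?_).eps_eq).symm
  rw [Module.End.mul_apply, Module.End.mul_apply, a_apply, oscA_single, Nat.add_sub_cancel,
    one_mul, ← mul_one (1 - _), ← smul_eq_mul, ← Finsupp.smul_single, map_smul,
    Finsupp.smul_apply, smul_eq_mul, smul_eq_mul, mul_one]

theorem eps_qPow_mul {B : Module.End ℂ Fock} (hB : B ∈ oscAlg η) (m : ℤ) :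
    eps η (qPow η m * B) = eps η (B * qPow η m) := by
  refine ((hasEps_eps hη (oscAlg_mul hB (qPow_mem m))).congr_diag fun k => ?_).eps_eq
  rw [Module.End.mul_apply, Module.End.mul_apply, qPow_apply, qPow_single,
    one_mul, ← mul_one (Complex.exp _), ← smul_eq_mul, ← Finsupp.smul_single, map_smul,
    Finsupp.smul_apply, smul_eq_mul, smul_eq_mul, mul_one]

/-- The functional `eps` is a trace. -/
theorem eps_mul_comm {A B : Module.End ℂ Fock} (hA : A ∈ oscAlg η) (hB : B ∈ oscAlg η) :
    eps η (A * B) = eps η (B * A) := by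
  have key : ∀ (A C : Module.End ℂ Fock), A ∈ oscAlg η → C ∈ oscAlg η →
      (∀ B ∈ oscAlg η, eps η (A * B) = eps η (B * A)) →
      (∀ B ∈ oscAlg η, eps η (C * B) = eps η (B * C)) →
      ∀ B ∈ oscAlg η, eps η ((A * C) * B) = eps η (B * (A * C)) := by
    intro A C hA hC h1 h2 B hB
    rw [mul_assoc, h1 _ (oscAlg_mul hC hB), mul_assoc, h2 _ (oscAlg_mul hB hA), mul_assoc]
  have hpow : ∀ (A : Module.End ℂ Fock), A ∈ oscAlg η →
      (∀ B ∈ oscAlg η, eps η (A * B) = eps η (B * A)) → ∀ n : ℕ, A ^ n ∈ oscAlg η ∧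
      ∀ B ∈ oscAlg η, eps η (A ^ n * B) = eps η (B * A ^ n) := by
    intro A hA h n
    induction n with
    | zero => exact ⟨by simpa using one_mem, by simp⟩
    | succ n ih =>
      rw [pow_succ']
      exact ⟨oscAlg_mul hA ih.1, key _ _ hA ih.1 h ih.2⟩
  induction hA using Submodule.span_induction with
  | mem C hC =>
    obtain ⟨i, j, m, rfl⟩ := hC
    have h1 := hpow _ adag_mem (fun B hB => eps_adag_mul hη hB) i
    have h2 := hpow _ a_mem (fun B hB => eps_a_mul hη hB) j
    have h3 := key _ _ h1.1 (qPow_mem m) h1.2 (fun B hB => eps_qPow_mul hη hB m)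
    exact key _ _ (oscAlg_mul h1.1 (qPow_mem m)) h2.1 h3 h2.2 B hB
  | zero => simp
  | add x y hx' hy' hx hy =>
    rw [add_mul, mul_add, eps_add hη (oscAlg_mul hx' hB) (oscAlg_mul hy' hB),
      eps_add hη (oscAlg_mul hB hx') (oscAlg_mul hB hy'), hx, hy]
  | smul c x hx' hx =>
    rw [smul_mul_assoc, mul_smul_comm, eps_smul hη (oscAlg_mul hx' hB),
      eps_smul hη (oscAlg_mul hB hx'), hx]

end NotRootOfUnity

/-! ### Identities for one site -/

/-- The relations of the q-oscillator algebra, for `a`, `d = a*`, `k = q^D`, `k' = q^{-D}`. -/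
structure OscRel {A : Type*} [Ring A] [Algebra ℂ A] (Q : ℂ) (a d k k' : A) : Prop where
  k_k' : k * k' = 1
  k'_k : k' * k = 1
  d_k : d * k = Q⁻¹ • (k * d)
  d_k' : d * k' = Q • (k' * d)
  a_k : a * k = Q • (k * a)
  a_k' : a * k' = Q⁻¹ • (k' * a)
  d_a : d * a = 1 - k * k
  a_d : a * d = 1 - Q ^ 2 • (k * k)

section Site

set_option linter.unusedSimpArgs false

variable {A : Type*} [Ring A] [Algebra ℂ A]

/-- The L-operator `L⁺`, with its scalar prefactor `c`, multiplied out. -/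
def siteL (c z Q : ℂ) (a d k k' : A) : Matrix (Fin 2) (Fin 2) A :=
  !![c • k, -(c * z) • (d * k'); -(c * z) • (a * k), c • k' - (c * z ^ 2 * Q ^ 2) • k]

/-- The inverse of `L⁺`, multiplied by `1 - z²`. -/
def siteLCo (c z : ℂ) (a d k k' : A) : Matrix (Fin 2) (Fin 2) A :=
  !![c⁻¹ • k' - (c⁻¹ * z ^ 2) • k, (c⁻¹ * z) • (k' * d); (c⁻¹ * z) • (k * a), c⁻¹ • k]

/-- The R-matrix with weights `x`, `y`, `w`. -/
def siteR (x y w : ℂ) : Matrix (Fin 2) (Fin 2) (Matrix (Fin 2) (Fin 2) ℂ) :=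
  !![!![x, 0; 0, y], !![0, 0; w, 0]; !![0, w; 0, 0], !![y, 0; 0, x]]

/-- `L R`, with the entries in the auxiliary space `ℂ²` as last two arguments. -/
def fuseL (L : Matrix (Fin 2) (Fin 2) A) (R : Matrix (Fin 2) (Fin 2) (Matrix (Fin 2) (Fin 2) ℂ))
    (s t p q : Fin 2) : A :=
  ∑ u, R u t p q • L s u

/-- `R' L'` for (multiples of) the inverses `R'`, `L'` of `R` and `L`. -/
def fuseU (R' : Matrix (Fin 2) (Fin 2) (Matrix (Fin 2) (Fin 2) ℂ))
    (L' : Matrix (Fin 2) (Fin 2) A) (s t p q : Fin 2) : A :=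
  ∑ u, R' s u p q • L' u t

/-- The row vector `w` with `L⁺ ∼ w' w` at the degenerate point `z = 1`. -/
def rowW (d k k' : A) : Fin 2 → A := ![k, -(d * k')]

/-- The column vector `w'` with `L⁺ ∼ w' w` at the degenerate point. -/
def colW (a : A) : Fin 2 → A := ![1, -a]

/-- The column vector `v` with `(1 - z²) (L⁺)⁻¹ ∼ v v'` at the degenerate point. -/
def colV (d k k' : A) : Fin 2 → A := ![k' * d, k]

/-- The row vector `v'` with `(1 - z²) (L⁺)⁻¹ ∼ v v'` at the degenerate point. -/
def rowV (a : A) : Fin 2 → A := ![a, 1]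

/-- The quotient of `L R` on which `w` projects. -/
def fusedL (c z Q : ℂ) (a d k k' : A) : Matrix (Fin 2) (Fin 2) A :=
  (c * (z * Q - (z * Q)⁻¹)) •
    !![k, -z • (d * k'); -(z * Q⁻¹) • (a * k), Q • k' - (Q * z ^ 2) • (k' * (k * k))]

/-- The restriction of `R' L'` to the image of `v`. -/
def fusedU (c z Q : ℂ) (a d k k' : A) : Matrix (Fin 2) (Fin 2) A :=
  (c⁻¹ * Q⁻¹ * (z⁻¹ * Q - z * Q⁻¹)) •
    !![k' - (z ^ 2 * Q ^ 2) • k, (z * Q) • (k' * d); (z * Q ^ 2) • (k * a), Q • k]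

/-- The deviation of the crossed product of `fusedL` and `fusedU` from a multiple of `a*`. -/
def crossDefect (z Q : ℂ) (d k : A) : Matrix (Fin 2) (Fin 2) A :=
  ((z * Q - (z * Q)⁻¹) * (z⁻¹ * Q - z * Q⁻¹)) •
    !![(z ^ 2 * (Q ^ 2 - 1) * Q ^ 2) • (d * (k * k)), (z ^ 3 * (1 - Q ^ 2)) • (d * d);
      (z * (Q ^ 2 - 1)) • (k * (k * (k * k))), (z ^ 2 * (1 - Q ^ 2)) • (d * (k * k))]

variable {Q : ℂ} {a d k k' : A} (h : OscRel Q a d k k')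
include h

namespace OscRel

theorem k_k'_assoc (x : A) : k * (k' * x) = x := by rw [← mul_assoc, h.k_k', one_mul]

theorem k'_k_assoc (x : A) : k' * (k * x) = x := by rw [← mul_assoc, h.k'_k, one_mul]

theorem d_k_assoc (x : A) : d * (k * x) = Q⁻¹ • (k * (d * x)) := by
  rw [← mul_assoc, h.d_k, smul_mul_assoc, mul_assoc]

theorem d_k'_assoc (x : A) : d * (k' * x) = Q • (k' * (d * x)) := by
  rw [← mul_assoc, h.d_k', smul_mul_assoc, mul_assoc]

theorem a_k_assoc (x : A) : a * (k * x) = Q • (k * (a * x)) := by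
  rw [← mul_assoc, h.a_k, smul_mul_assoc, mul_assoc]

theorem a_k'_assoc (x : A) : a * (k' * x) = Q⁻¹ • (k' * (a * x)) := by
  rw [← mul_assoc, h.a_k', smul_mul_assoc, mul_assoc]

theorem a_d_assoc (x : A) : a * (d * x) = x - Q ^ 2 • (k * (k * x)) := by
  rw [← mul_assoc, h.a_d, sub_mul, one_mul, smul_mul_assoc, mul_assoc]

end OscRel

/-- Leaving the factor `1 - z²` undivided keeps `siteLCo` meaningful at the points `z² = 1`, where
`L⁺` is not invertible and the residue is taken. -/
theorem siteL_mul_siteLCo {c z : ℂ} (hc : c ≠ 0) (hQ : Q ≠ 0) :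
    siteL c z Q a d k k' * siteLCo c z a d k k' =
      (1 - z ^ 2) • (1 : Matrix (Fin 2) (Fin 2) A) := by
  ext i j
  fin_cases i <;> fin_cases j <;>
  · simp [siteL, siteLCo, Matrix.mul_apply, Fin.sum_univ_two, mul_sub, sub_mul, smul_sub, mul_assoc,
      smul_smul, h.k_k', h.k'_k, h.d_k, h.d_k', h.a_k, h.a_k', h.d_a, h.a_d, h.k_k'_assoc,
      h.k'_k_assoc, h.d_k_assoc, h.d_k'_assoc, h.a_k_assoc, h.a_k'_assoc,
      h.a_d_assoc]
    match_scalars <;> field_simp <;> ring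

theorem siteLCo_mul_siteL {c z : ℂ} (hc : c ≠ 0) (hQ : Q ≠ 0) :
    siteLCo c z a d k k' * siteL c z Q a d k k' =
      (1 - z ^ 2) • (1 : Matrix (Fin 2) (Fin 2) A) := by
  ext i j
  fin_cases i <;> fin_cases j <;>
  · simp [siteL, siteLCo, Matrix.mul_apply, Fin.sum_univ_two, mul_sub, sub_mul, smul_sub, mul_assoc,
      smul_smul, h.k_k', h.k'_k, h.d_k, h.d_k', h.a_k, h.a_k', h.d_a, h.a_d, h.k_k'_assoc,
      h.k'_k_assoc, h.d_k_assoc, h.d_k'_assoc, h.a_k_assoc, h.a_k'_assoc,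
      h.a_d_assoc]
    match_scalars <;> field_simp <;> ring

/-- Fusion: the row vector `w` intertwines `L R` with `fusedL`. -/
theorem rowW_fuse {c z : ℂ} (hz : z ≠ 0) (hQ : Q ≠ 0) (s t q : Fin 2) :
    ∑ p, rowW d k k' p * fuseL (siteL c z Q a d k k')
        (siteR (z * Q - (z * Q)⁻¹) (z - z⁻¹) (Q - Q⁻¹)) s t p q =
      fusedL c z Q a d k k' s t * rowW d k k' q := by
  fin_cases s <;> fin_cases t <;> fin_cases q <;>
  · simp [siteL, fuseL, siteR, rowW, fusedL, Fin.sum_univ_two, mul_sub, sub_mul, smul_sub,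
      mul_assoc, smul_smul, h.k_k', h.k'_k, h.d_k, h.d_k', h.a_k, h.a_k', h.d_a, h.a_d,
      h.k_k'_assoc, h.k'_k_assoc, h.d_k_assoc, h.d_k'_assoc, h.a_k_assoc, h.a_k'_assoc,
      h.a_d_assoc]
    try (match_scalars <;> field_simp <;> ring)

/-- Fusion: the column vector `v` intertwines `R' L'` with `fusedU`. -/
theorem fuse_colV {c z : ℂ} (hc : c ≠ 0) (hz : z ≠ 0) (hQ : Q ≠ 0) (s t p : Fin 2) :
    ∑ q, fuseU (siteR (z⁻¹ * Q - z * Q⁻¹) (z⁻¹ - z) (Q - Q⁻¹)) (siteLCo c z a d k k') s t p q *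
        colV d k k' q =
      colV d k k' p * fusedU c z Q a d k k' s t := by
  fin_cases s <;> fin_cases t <;> fin_cases p <;>
  · simp [siteLCo, fuseU, siteR, colV, fusedU, Fin.sum_univ_two, mul_sub, sub_mul, smul_sub,
      mul_assoc, smul_smul, h.k_k', h.k'_k, h.d_k, h.d_k', h.a_k, h.a_k', h.d_a, h.a_d,
      h.k_k'_assoc, h.k'_k_assoc, h.d_k_assoc, h.d_k'_assoc, h.a_k_assoc, h.a_k'_assoc,
      h.a_d_assoc]
    try (match_scalars <;> field_simp <;> ring)

/-- Cyclicity of the trace moves the outer `fusedU` behind `d`, which produces this order of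
factors. Up to terms with a higher power of `q^D`, the site then acts as a scalar, and this scalar
is its contribution to the normalization. -/
theorem fused_cross {c z : ℂ} (hc : c ≠ 0) (hz : z ≠ 0) (hQ : Q ≠ 0) (s t : Fin 2) :
    ∑ u, fusedL c z Q a d k k' u t * (d * fusedU c z Q a d k k' s u) =
      (if s = t then (((z * Q - (z * Q)⁻¹) * (z⁻¹ * Q - z * Q⁻¹)) * (1 - z ^ 2)) • d else 0) +
        crossDefect z Q d k s t := by
  fin_cases s <;> fin_cases t <;>
  · simp [fusedL, fusedU, crossDefect, Fin.sum_univ_two, mul_sub, sub_mul, smul_sub,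
      mul_assoc, smul_smul, h.k_k', h.k'_k, h.d_k, h.d_k', h.a_k, h.a_k', h.d_a, h.a_d,
      h.k_k'_assoc, h.k'_k_assoc, h.d_k_assoc, h.d_k'_assoc, h.a_k_assoc, h.a_k'_assoc,
      h.a_d_assoc]
    match_scalars <;> field_simp <;> ring

/-- The lower right corner factorizes because `a a* = 1 - q² q^{2D}`. The companion statement for
`siteLCo` uses `a* a = 1 - q^{2D}`. -/
theorem siteL_one (c : ℂ) (hQ : Q ≠ 0) (p q : Fin 2) :
    siteL c 1 Q a d k k' p q = c • (colW a p * rowW d k k' q) := by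
  fin_cases p <;> fin_cases q <;>
  simp [siteL, colW, rowW, mul_sub, sub_mul, smul_sub,
      mul_assoc, smul_smul, h.k_k', h.k'_k, h.d_k, h.d_k', h.a_k, h.a_k', h.d_a, h.a_d,
      h.k_k'_assoc, h.k'_k_assoc, h.d_k_assoc, h.d_k'_assoc, h.a_k_assoc, h.a_k'_assoc,
      h.a_d_assoc]
  all_goals
    match_scalars <;> field_simp

theorem siteLCo_one (c : ℂ) (p q : Fin 2) :
    siteLCo c 1 a d k k' p q = c⁻¹ • (colV d k k' p * rowV a q) := by
  fin_cases p <;> fin_cases q <;>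
  simp [siteLCo, colV, rowV, mul_sub, sub_mul, smul_sub,
      mul_assoc, smul_smul, h.k_k', h.k'_k, h.d_k, h.d_k', h.a_k, h.a_k', h.d_a, h.a_d,
      h.k_k'_assoc, h.k'_k_assoc, h.d_k_assoc, h.d_k'_assoc, h.a_k_assoc, h.a_k'_assoc,
      h.a_d_assoc]

/-- At the degenerate points `L⁺` has a left annihilator. -/
theorem annihilator_mul_siteL (c : ℂ) {z : ℂ} (hz : z ^ 2 = 1) (hQ : Q ≠ 0) :
    !![z • a, 1; z • a, 1] * siteL c z Q a d k k' = 0 := by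
  ext i j
  fin_cases i <;> fin_cases j <;>
  · simp [siteL, Matrix.mul_apply, Fin.sum_univ_two, mul_sub, sub_mul, smul_sub, mul_assoc, hz,
      smul_smul, h.k_k', h.k'_k, h.d_k, h.d_k', h.a_k, h.a_k', h.d_a, h.a_d, h.k_k'_assoc,
      h.k'_k_assoc, h.d_k_assoc, h.d_k'_assoc, h.a_k_assoc, h.a_k'_assoc,
      h.a_d_assoc]
    try (match_scalars <;> field_simp <;> simp [hz])

end Site

/-! ### The monodromy matrix -/

section Monodromy

set_option linter.unusedSectionVars false

theorem sum_conf_succ {M : Type*} [AddCommMonoid M] {n : ℕ} (f : Conf (n + 1) → M) :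
    ∑ s, f s = ∑ c, ∑ s : Conf n, f (Fin.cons c s) := by
  rw [← Fintype.sum_prod_type']
  exact (Fintype.sum_equiv (Fin.consEquiv fun _ => Fin 2) _ _ fun _ => rfl).symm

variable {A : Type*} [Ring A] [Algebra ℂ A]

/-- Matrix elements of the product `L_n ⋯ L_1` of local operators. -/
def outProd : ∀ {n : ℕ}, (Fin n → Matrix (Fin 2) (Fin 2) A) → Matrix (Conf n) (Conf n) A
  | 0, _ => 1
  | _ + 1, L => Matrix.of fun s t =>
      outProd (Fin.tail L) (Fin.tail s) (Fin.tail t) * L 0 (s 0) (t 0)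

/-- Matrix elements of the product `U_1 ⋯ U_n` of local operators. -/
def inProd : ∀ {n : ℕ}, (Fin n → Matrix (Fin 2) (Fin 2) A) → Matrix (Conf n) (Conf n) A
  | 0, _ => 1
  | _ + 1, U => Matrix.of fun s t =>
      U 0 (s 0) (t 0) * inProd (Fin.tail U) (Fin.tail s) (Fin.tail t)

theorem siteOp_mul {n : ℕ} (j : Fin n) (M N : Matrix (Fin 2) (Fin 2) A) :
    siteOp j (M * N) = siteOp j M * siteOp j N := by
  ext s t
  rw [Matrix.mul_apply]
  simp only [siteOp, Matrix.of_apply]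
  by_cases hst : ∀ i, i ≠ j → s i = t i
  · rw [if_pos hst, Matrix.mul_apply]
    -- Only configurations that differ from `s` at site `j` alone contribute.
    rw [← Finset.sum_subset (Finset.subset_univ (Finset.univ.image fun c => Function.update s j c))]
    · rw [Finset.sum_image (fun c _ c' _ h => by
        simpa using congrFun h j)]
      refine Finset.sum_congr rfl fun c _ => ?_
      rw [if_pos (fun i hi => by simp [hi]), if_pos (fun i hi => by simpa [hi] using hst i hi)]
      simp
    · intro u _ hu
      rw [if_neg, zero_mul]
      intro h
      apply hu
      refine Finset.mem_image.2 ⟨u j, Finset.mem_univ _, ?_⟩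
      ext i
      by_cases hi : i = j
      · subst hi; simp
      · simp [hi, h i hi]
  · rw [if_neg hst]
    refine (Finset.sum_eq_zero fun u _ => ?_).symm
    by_cases h1 : ∀ i, i ≠ j → s i = u i
    · rw [if_neg (c := ∀ i, i ≠ j → u i = t i), mul_zero]
      exact fun h2 => hst fun i hi => (h1 i hi).trans (h2 i hi)
    · rw [if_neg h1, zero_mul]

theorem siteOp_one {n : ℕ} (j : Fin n) : siteOp j (1 : Matrix (Fin 2) (Fin 2) A) = 1 := by
  ext s t
  simp only [siteOp, Matrix.of_apply, Matrix.one_apply]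
  by_cases hst : s = t
  · subst hst; simp
  · rw [if_neg hst]
    split_ifs with h1 h2
    · exact absurd (funext fun i => if hi : i = j then hi ▸ h2 else h1 i hi) hst
    · rfl
    · rfl

theorem siteOp_smul {n : ℕ} (j : Fin n) (c : ℂ) (M : Matrix (Fin 2) (Fin 2) A) :
    siteOp j (c • M) = c • siteOp j M := by
  ext s t
  simp [siteOp]

/-- A matrix on `n` sites acting on the last `n` of `n + 1` sites. -/
def liftTail {n : ℕ} (M : Matrix (Conf n) (Conf n) A) : Matrix (Conf (n + 1)) (Conf (n + 1)) A :=
  Matrix.of fun s t => if s 0 = t 0 then M (Fin.tail s) (Fin.tail t) else 0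

theorem liftTail_mul {n : ℕ} (M N : Matrix (Conf n) (Conf n) A) :
    liftTail (M * N) = liftTail M * liftTail N := by
  ext s t
  simp only [liftTail, Matrix.mul_apply, Matrix.of_apply, sum_conf_succ, Fin.cons_zero,
    Fin.tail_cons]
  rw [Finset.sum_eq_single (s 0)]
  · simp
  · intro c _ hc
    simp [Ne.symm hc]
  · simp

theorem liftTail_one {n : ℕ} : liftTail (1 : Matrix (Conf n) (Conf n) A) = 1 := by
  ext s t
  simp only [liftTail, Matrix.of_apply, Matrix.one_apply]
  rw [← ite_and]
  congr 1
  rw [eq_iff_iff, ← Fin.cons_self_tail s, ← Fin.cons_self_tail t, Fin.cons_inj]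
  simp

theorem liftTail_siteOp {n : ℕ} (j : Fin n) (M : Matrix (Fin 2) (Fin 2) A) :
    liftTail (siteOp j M) = siteOp j.succ M := by
  ext s t
  simp only [liftTail, siteOp, Matrix.of_apply]
  rw [← ite_and]
  refine if_congr ?_ rfl rfl
  rw [Fin.forall_fin_succ]
  simp [(Fin.succ_ne_zero _).symm, Fin.tail]

theorem monodromy_succ {n : ℕ} (L : Fin (n + 1) → Matrix (Fin 2) (Fin 2) A) :
    monodromy L = liftTail (monodromy (Fin.tail L)) * siteOp 0 (L 0) := by
  have hprod : ∀ l : List (Matrix (Conf n) (Conf n) A),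
      liftTail l.prod = (l.map liftTail).prod := by
    intro l
    induction l with
    | nil => simpa using liftTail_one
    | cons x l ih => rw [List.prod_cons, liftTail_mul, ih, List.map_cons, List.prod_cons]
  rw [monodromy, List.finRange_succ, List.reverse_cons, List.map_append, List.prod_append,
    monodromy, hprod, ← List.map_reverse, List.map_map, List.map_map]
  simp only [List.map_cons, List.map_nil, List.prod_singleton]
  congr 3
  funext j
  simp [liftTail_siteOp, Fin.tail]

theorem outProd_eq {n : ℕ} (L : Fin n → Matrix (Fin 2) (Fin 2) A) :
    outProd L = monodromy L := by
  induction n with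
  | zero => simp [outProd, monodromy]
  | succ n ih =>
    rw [monodromy_succ, ← ih]
    ext s t
    simp only [outProd, Matrix.of_apply, Matrix.mul_apply, liftTail, siteOp, sum_conf_succ,
      Fin.cons_zero, Fin.tail_cons]
    rw [Finset.sum_eq_single (s 0), Finset.sum_eq_single (Fin.tail t)]
    · rw [if_pos rfl, if_pos]
      intro i hi
      obtain ⟨i, rfl⟩ := Fin.exists_succ_eq.2 hi
      simp [Fin.tail]
    · intro u _ hu
      rw [if_neg (c := ∀ i, _), mul_zero]
      intro h
      exact hu (funext fun i => h i.succ (Fin.succ_ne_zero i))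
    · simp
    · intro c _ hc
      simp [Ne.symm hc]
    · simp

theorem inProd_succ {n : ℕ} (U : Fin (n + 1) → Matrix (Fin 2) (Fin 2) A) :
    inProd U = siteOp 0 (U 0) * liftTail (inProd (Fin.tail U)) := by
  ext s t
  simp only [inProd, Matrix.of_apply, Matrix.mul_apply, liftTail, siteOp, sum_conf_succ,
    Fin.cons_zero, Fin.tail_cons]
  rw [Finset.sum_eq_single (t 0), Finset.sum_eq_single (Fin.tail s)]
  · rw [if_pos rfl, if_pos]
    intro i hi
    obtain ⟨i, rfl⟩ := Fin.exists_succ_eq.2 hi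
    simp [Fin.tail]
  · intro u _ hu
    rw [if_neg (c := ∀ i, _), zero_mul]
    intro h
    exact hu (funext fun i => (h i.succ (Fin.succ_ne_zero i)).symm)
  · simp
  · intro c _ hc
    simp [hc]
  · simp

theorem liftTail_smul {n : ℕ} (c : ℂ) (M : Matrix (Conf n) (Conf n) A) :
    liftTail (c • M) = c • liftTail M := by
  ext s t
  simp [liftTail]

theorem outProd_succ {n : ℕ} (L : Fin (n + 1) → Matrix (Fin 2) (Fin 2) A) :
    outProd L = liftTail (outProd (Fin.tail L)) * siteOp 0 (L 0) := by
  rw [outProd_eq, monodromy_succ, outProd_eq]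

/-- The first-site factors are adjacent in `L_n ⋯ L_1 U_1 ⋯ U_n`, so the product telescopes from the
middle. -/
theorem outProd_mul_inProd {n : ℕ} {L U : Fin n → Matrix (Fin 2) (Fin 2) A} {κ : Fin n → ℂ}
    (h : ∀ j, L j * U j = κ j • (1 : Matrix (Fin 2) (Fin 2) A)) :
    outProd L * inProd U = (∏ j, κ j) • (1 : Matrix (Conf n) (Conf n) A) := by
  induction n with
  | zero => simp [outProd, inProd]
  | succ n ih =>
    rw [outProd_succ, inProd_succ, mul_assoc, ← mul_assoc (siteOp 0 (L 0)), ← siteOp_mul, h 0,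
      siteOp_smul, siteOp_one, smul_mul_assoc, one_mul, mul_smul_comm, ← liftTail_mul,
      ih (L := Fin.tail L) (U := Fin.tail U) (κ := Fin.tail κ) fun j => h j.succ, liftTail_smul, liftTail_one, smul_smul,
      Fin.prod_univ_succ]
    rfl

theorem inProd_mul_outProd {n : ℕ} {L U : Fin n → Matrix (Fin 2) (Fin 2) A} {κ : Fin n → ℂ}
    (h : ∀ j, U j * L j = κ j • (1 : Matrix (Fin 2) (Fin 2) A)) :
    inProd U * outProd L = (∏ j, κ j) • (1 : Matrix (Conf n) (Conf n) A) := by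
  induction n with
  | zero => simp [outProd, inProd]
  | succ n ih =>
    rw [outProd_succ, inProd_succ, mul_assoc, ← mul_assoc (liftTail _), ← liftTail_mul,
      ih (L := Fin.tail L) (U := Fin.tail U) (κ := Fin.tail κ) fun j => h j.succ, liftTail_smul, liftTail_one, smul_mul_assoc,
      one_mul, mul_smul_comm, ← siteOp_mul, h 0, siteOp_smul, siteOp_one, smul_smul,
      Fin.prod_univ_succ, mul_comm]
    rfl

/-- `∑ U_{su} X_{uv} T_{vt}` for the products `U = U_1 ⋯ U_n` and `T = L_n ⋯ L_1`. -/
def sandwich {n : ℕ} (U L : Fin n → Matrix (Fin 2) (Fin 2) A) (X : SegOp n) (s t : Conf n) : A :=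
  ∑ u, ∑ v, X u v • (inProd U s u * outProd L v t)

theorem invAdj_eq_sandwich {n : ℕ} {L U : Fin n → Matrix (Fin 2) (Fin 2) A} {κ : Fin n → ℂ}
    (h : ∀ j, L j * U j = κ j • (1 : Matrix (Fin 2) (Fin 2) A))
    (h' : ∀ j, U j * L j = κ j • (1 : Matrix (Fin 2) (Fin 2) A)) (hκ : ∀ j, κ j ≠ 0)
    (X : SegOp n) (s t : Conf n) :
    invAdj (monodromy L) X s t = (∏ j, κ j)⁻¹ • sandwich U L X s t := by
  have hne : ∏ j, κ j ≠ 0 := Finset.prod_ne_zero_iff.2 fun j _ => hκ j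
  have hinv : Ring.inverse (monodromy L) = (∏ j, κ j)⁻¹ • inProd U := by
    rw [← outProd_eq]
    let u : (Matrix (Conf n) (Conf n) A)ˣ :=
      ⟨outProd L, (∏ j, κ j)⁻¹ • inProd U,
        by rw [mul_smul_comm, outProd_mul_inProd h, smul_smul, inv_mul_cancel₀ hne, one_smul],
        by rw [smul_mul_assoc, inProd_mul_outProd h', smul_smul, inv_mul_cancel₀ hne, one_smul]⟩
    exact Ring.inverse_unit u
  rw [invAdj, hinv, ← outProd_eq, smul_mul_assoc, smul_mul_assoc, Matrix.smul_apply]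
  congr 1
  rw [Matrix.mul_assoc, Matrix.mul_apply, sandwich]
  refine Finset.sum_congr rfl fun u _ => ?_
  rw [Matrix.mul_apply, Finset.mul_sum]
  refine Finset.sum_congr rfl fun v _ => ?_
  rw [Matrix.map_apply, ← Algebra.smul_def, mul_smul_comm]

/-- A unit product does not force its factors to be units in an algebra of operators on an
infinite-dimensional space. Left annihilators provide the missing obstruction and let the factors be
stripped off from the left. -/
theorem ring_inverse_monodromy_eq_zero {n : ℕ} {L N : Fin n → Matrix (Fin 2) (Fin 2) A}
    (hL : ∀ j, IsUnit (L j) ∨ (N j ≠ 0 ∧ N j * L j = 0)) (hj : ∃ j, ¬ IsUnit (L j)) :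
    Ring.inverse (monodromy L) = 0 := by
  refine Ring.inverse_non_unit _ fun hu => ?_
  have key : ∀ l : List (Fin n), IsUnit (l.map fun j => siteOp j (L j)).prod →
      ∀ j ∈ l, IsUnit (L j) := by
    intro l
    induction l with
    | nil => simp
    | cons i l ih =>
      intro h
      rw [List.map_cons, List.prod_cons] at h
      -- An annihilator of the leftmost factor annihilates the whole unit product and hence
      -- vanishes, which leaves the unit alternative.
      have hi : IsUnit (L i) := by
        rcases hL i with h1 | ⟨h1, h2⟩
        · exact h1
        · refine absurd ?_ h1
          have h3 : siteOp i (N i) = 0 := by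
            have h0 : siteOp i (0 : Matrix (Fin 2) (Fin 2) A) = 0 := by
              ext s t
              simp [siteOp]
            rw [← h.mul_left_eq_zero, ← mul_assoc, ← siteOp_mul, h2, h0, zero_mul]
          ext p q
          have h4 := congrFun (congrFun h3 (fun _ => p)) (Function.update (fun _ => p) i q)
          have h5 : ∀ l, l ≠ i → p = Function.update (fun _ => p) i q l := fun l hl => by
            simp [hl]
          rw [siteOp, Matrix.of_apply, if_pos h5] at h4
          simpa using h4
      have hs : IsUnit (siteOp i (L i)) := by
        obtain ⟨u, hu⟩ := hi
        refine ⟨⟨siteOp i (L i), siteOp i (↑u⁻¹ : Matrix (Fin 2) (Fin 2) A), ?_, ?_⟩, rfl⟩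
        · rw [← siteOp_mul, ← hu, Units.mul_inv, siteOp_one]
        · rw [← siteOp_mul, ← hu, Units.inv_mul, siteOp_one]
      have h5 : IsUnit (l.map fun j => siteOp j (L j)).prod := by
        obtain ⟨u, hu⟩ := hs
        rwa [← hu, Units.isUnit_units_mul] at h
      intro j hj
      rcases List.mem_cons.1 hj with rfl | hj
      · exact hi
      · exact ih h5 j hj
  obtain ⟨j, hj⟩ := hj
  exact hj (key _ hu j (by simp))

end Monodromy

/-! ### Peeling off the first, outermost site -/

section Recursion

variable {A : Type*} [Ring A] [Algebra ℂ A] {n : ℕ}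

/-- The blocks of an operator with respect to the first site. -/
def headBlock (c d : Fin 2) (X : SegOp (n + 1)) : SegOp n :=
  Matrix.of fun s t => X (Fin.cons c s) (Fin.cons d t)

theorem sandwich_succ (U L : Fin (n + 1) → Matrix (Fin 2) (Fin 2) A) (X : SegOp (n + 1))
    (s t : Conf (n + 1)) :
    sandwich U L X s t = ∑ c, ∑ d, U 0 (s 0) c *
      sandwich (Fin.tail U) (Fin.tail L) (headBlock c d X) (Fin.tail s) (Fin.tail t) *
        L 0 d (t 0) := by
  rw [sandwich, sum_conf_succ]
  refine Finset.sum_congr rfl fun c _ => ?_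
  simp only [sum_conf_succ, sandwich]
  rw [Finset.sum_comm]
  refine Finset.sum_congr rfl fun d _ => ?_
  simp only [Finset.mul_sum, Finset.sum_mul]
  refine Finset.sum_congr rfl fun u _ => Finset.sum_congr rfl fun v _ => ?_
  simp only [inProd, outProd, Matrix.of_apply, Fin.cons_zero, Fin.tail_cons, headBlock,
    mul_smul_comm, smul_mul_assoc, mul_assoc]

theorem sandwich_add (U L : Fin n → Matrix (Fin 2) (Fin 2) A) (X Y : SegOp n) (s t : Conf n) :
    sandwich U L (X + Y) s t = sandwich U L X s t + sandwich U L Y s t := by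
  simp only [sandwich, Matrix.add_apply, add_smul, Finset.sum_add_distrib]

theorem sandwich_smul (U L : Fin n → Matrix (Fin 2) (Fin 2) A) (c : ℂ) (X : SegOp n)
    (s t : Conf n) : sandwich U L (c • X) s t = c • sandwich U L X s t := by
  simp only [sandwich, Matrix.smul_apply, smul_eq_mul, mul_smul, Finset.smul_sum]

theorem sandwich_nil (U L : Fin 0 → Matrix (Fin 2) (Fin 2) A) (X : SegOp 0) (s t : Conf 0) :
    sandwich U L X s t = X s t • (1 : A) := by
  have h : ∀ u v : Conf 0, (1 : Matrix (Conf 0) (Conf 0) A) u v = 1 := fun u v => by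
    rw [Subsingleton.elim u v, Matrix.one_apply_eq]
  rw [sandwich, Fintype.sum_subsingleton _ s, Fintype.sum_subsingleton _ t]
  simp only [inProd, outProd, h, mul_one]

theorem headBlock_tensorIdRight (c d : Fin 2) (X : SegOp (n + 1)) :
    headBlock c d (tensorIdRight X) = tensorIdRight (headBlock c d X) := by
  ext s t
  simp only [headBlock, tensorIdRight, Matrix.of_apply]
  have h : ∀ (c : Fin 2) (s : Conf (n + 1)),
      Fin.init (Fin.cons c s : Conf (n + 2)) = Fin.cons c (Fin.init s) := by
    intro c s
    funext i
    induction i using Fin.cases <;> rfl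
  rw [← Fin.succ_last, Fin.cons_succ, Fin.cons_succ, h, h]

theorem headBlock_tensorIdLeft (c d : Fin 2) (X : SegOp n) :
    headBlock c d (tensorIdLeft X) = if c = d then X else 0 := by
  ext s t
  simp only [headBlock, tensorIdLeft, Matrix.of_apply, Fin.cons_zero, Fin.tail_cons]
  split_ifs <;> rfl

/-- Reduction from the right: an identity at the last site stays an identity. -/
theorem sandwich_tensorIdRight (U L : Fin (n + 1) → Matrix (Fin 2) (Fin 2) A) (κ : ℂ)
    (h : U (Fin.last n) * L (Fin.last n) = κ • (1 : Matrix (Fin 2) (Fin 2) A)) (X : SegOp n)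
    (s t : Conf (n + 1)) :
    sandwich U L (tensorIdRight X) s t =
      if s (Fin.last n) = t (Fin.last n) then
        κ • sandwich (Fin.init U) (Fin.init L) X (Fin.init s) (Fin.init t) else 0 := by
  induction n with
  | zero =>
    have h1 : ∀ p q, ∑ c, U 0 p c * L 0 c q = κ • (1 : Matrix (Fin 2) (Fin 2) A) p q := by
      intro p q
      have := congrFun (congrFun h p) q
      rwa [Matrix.mul_apply] at this
    have h2 : ∀ c d, headBlock c d (tensorIdRight X) (Fin.tail s) (Fin.tail t) =
        if c = d then X (Fin.init s) (Fin.init t) else 0 := by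
      intro c d
      simp only [headBlock, tensorIdRight, Matrix.of_apply]
      exact if_congr Iff.rfl (congrArg₂ X (Subsingleton.elim _ _) (Subsingleton.elim _ _)) rfl
    rw [sandwich_succ]
    have h3 : ∀ c d, U 0 (s 0) c * sandwich (Fin.tail U) (Fin.tail L)
        (headBlock c d (tensorIdRight X)) (Fin.tail s) (Fin.tail t) * L 0 d (t 0) =
        if c = d then X (Fin.init s) (Fin.init t) • (U 0 (s 0) c * L 0 d (t 0)) else 0 := by
      intro c d
      rw [sandwich_nil, h2]
      split_ifs
      · rw [mul_smul_comm, mul_one, smul_mul_assoc]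
      · rw [zero_smul, mul_zero, zero_mul]
    rw [Finset.sum_congr rfl fun c _ => Finset.sum_congr rfl fun d _ => h3 c d]
    rw [Finset.sum_congr rfl fun c _ => Finset.sum_ite_eq Finset.univ c _]
    simp only [Finset.mem_univ, if_true]
    rw [← Finset.smul_sum, h1, sandwich_nil, Matrix.one_apply]
    change _ = if s 0 = t 0 then _ else _
    split_ifs
    · rw [smul_comm]
    · rw [smul_zero, smul_zero]
  | succ n ih =>
    rw [sandwich_succ]
    simp only [headBlock_tensorIdRight]
    have h' : Fin.tail U (Fin.last n) * Fin.tail L (Fin.last n) = κ • 1 := by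
      simpa [Fin.tail] using h
    simp only [ih (Fin.tail U) (Fin.tail L) h']
    have h3 : ∀ s : Conf (n + 2), Fin.tail s (Fin.last n) = s (Fin.last (n + 1)) := fun s => by
      simp [Fin.tail]
    simp only [h3]
    split_ifs
    · simp only [mul_smul_comm, smul_mul_assoc, ← Finset.smul_sum]
      rw [sandwich_succ (n := n)]
      rfl
    · simp

/-- The dressing of a family of operators by the R-matrices, with the entries in the auxiliary
space `ℂ²` as last two arguments. -/
def dressed (R' R : Fin n → Matrix (Fin 2) (Fin 2) (Matrix (Fin 2) (Fin 2) ℂ))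
    (Z : Conf n → Conf n → A) (s t : Conf n) (p q : Fin 2) : A :=
  ∑ u, ∑ v, (inProd R' s u * outProd R v t) p q • Z u v

theorem dressed_succ_aux (R' R : Fin (n + 1) → Matrix (Fin 2) (Fin 2) (Matrix (Fin 2) (Fin 2) ℂ))
    (Z : Conf (n + 1) → Conf (n + 1) → A) (s t : Conf (n + 1)) (p q : Fin 2) :
    dressed R' R Z s t p q = ∑ e, ∑ f, ∑ p', ∑ q',
      (R' 0 (s 0) e p p' * R 0 f (t 0) q' q) •
        dressed (Fin.tail R') (Fin.tail R) (fun u v => Z (Fin.cons e u) (Fin.cons f v))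
          (Fin.tail s) (Fin.tail t) p' q' := by
  rw [dressed, sum_conf_succ]
  refine Finset.sum_congr rfl fun e _ => ?_
  simp only [sum_conf_succ]
  rw [Finset.sum_comm]
  refine Finset.sum_congr rfl fun f _ => ?_
  simp only [dressed, Fin.sum_univ_two, Finset.smul_sum, smul_smul, ← Finset.sum_add_distrib,
    ← add_smul]
  refine Finset.sum_congr rfl fun u _ => Finset.sum_congr rfl fun v _ => ?_
  congr 1
  simp only [inProd, outProd, Matrix.of_apply, Fin.cons_zero, Fin.tail_cons, Matrix.mul_apply,
    Fin.sum_univ_two]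
  ring

theorem dressed_sum (R' R : Fin n → Matrix (Fin 2) (Fin 2) (Matrix (Fin 2) (Fin 2) ℂ))
    (x y : Fin 2 → A) (Z : Fin 2 → Fin 2 → Conf n → Conf n → A) (s t : Conf n) (p q : Fin 2) :
    dressed R' R (fun u v => ∑ c, ∑ d, x c * Z c d u v * y d) s t p q =
      ∑ c, ∑ d, x c * dressed R' R (Z c d) s t p q * y d := by
  simp only [dressed, Fin.sum_univ_two, Finset.mul_sum, Finset.sum_mul, mul_smul_comm,
    smul_mul_assoc, smul_add, Finset.sum_add_distrib]

/-- The quantum indices between `R` and `L` of the first site are summed here, so the site enters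
only through `L R` and `R' L'`, the objects to which fusion applies. -/
theorem dressed_succ (R' R : Fin (n + 1) → Matrix (Fin 2) (Fin 2) (Matrix (Fin 2) (Fin 2) ℂ))
    (U L : Fin (n + 1) → Matrix (Fin 2) (Fin 2) A) (X : SegOp (n + 1))
    (s t : Conf (n + 1)) (p q : Fin 2) :
    dressed R' R (sandwich U L X) s t p q = ∑ c, ∑ d, ∑ p', ∑ q',
      fuseU (R' 0) (U 0) (s 0) c p p' *
        dressed (Fin.tail R') (Fin.tail R)
          (sandwich (Fin.tail U) (Fin.tail L) (headBlock c d X)) (Fin.tail s) (Fin.tail t) p' q' *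
        fuseL (L 0) (R 0) d (t 0) q' q := by
  rw [dressed_succ_aux]
  simp only [sandwich_succ, Fin.cons_zero, Fin.tail_cons]
  simp only [fun e f => dressed_sum (Fin.tail R') (Fin.tail R) (U 0 e) (fun d => L 0 d f)
    (fun c d u v => sandwich (Fin.tail U) (Fin.tail L) (headBlock c d X) u v)]
  have comm6 : ∀ F : Fin 2 → Fin 2 → Fin 2 → Fin 2 → Fin 2 → Fin 2 → A,
      ∑ e, ∑ f, ∑ p, ∑ q, ∑ c, ∑ d, F e f p q c d =
        ∑ c, ∑ d, ∑ p, ∑ q, ∑ f, ∑ e, F e f p q c d := by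
    intro F
    simp only [Fin.sum_univ_two]
    abel
  simp only [Finset.smul_sum]
  rw [comm6]
  refine Finset.sum_congr rfl fun c _ => Finset.sum_congr rfl fun d _ =>
    Finset.sum_congr rfl fun p' _ => Finset.sum_congr rfl fun q' _ => ?_
  simp only [fuseU, fuseL, Finset.sum_mul, Finset.mul_sum]
  refine Finset.sum_congr rfl fun f _ => Finset.sum_congr rfl fun e _ => ?_
  simp only [smul_mul_assoc, mul_smul_comm, smul_smul]
  rw [mul_comm]

theorem dressed_add (R' R : Fin n → Matrix (Fin 2) (Fin 2) (Matrix (Fin 2) (Fin 2) ℂ))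
    (Z Z' : Conf n → Conf n → A) (s t : Conf n) (p q : Fin 2) :
    dressed R' R (fun u v => Z u v + Z' u v) s t p q =
      dressed R' R Z s t p q + dressed R' R Z' s t p q := by
  simp only [dressed, smul_add, Finset.sum_add_distrib]

theorem dressed_smul (R' R : Fin n → Matrix (Fin 2) (Fin 2) (Matrix (Fin 2) (Fin 2) ℂ))
    (c : ℂ) (Z : Conf n → Conf n → A) (s t : Conf n) (p q : Fin 2) :
    dressed R' R (fun u v => c • Z u v) s t p q = c • dressed R' R Z s t p q := by
  simp only [dressed, Finset.smul_sum]
  refine Finset.sum_congr rfl fun u _ => Finset.sum_congr rfl fun v _ => smul_comm _ _ _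

/-- The weights `w, 0, w` make the R-matrix `w` times the permutation, which exchanges the spin of
the site with the auxiliary spin. -/
theorem fuseU_degenerate (w : ℂ) (N : Matrix (Fin 2) (Fin 2) A) (s t p q : Fin 2) :
    fuseU (siteR w 0 w) N s t p q = if q = s then w • N p t else 0 := by
  fin_cases s <;> fin_cases p <;> fin_cases q <;> simp [fuseU, siteR]

theorem fuseL_degenerate (w : ℂ) (N : Matrix (Fin 2) (Fin 2) A) (s t p q : Fin 2) :
    fuseL N (siteR w 0 w) s t p q = if p = t then w • N s q else 0 := by
  fin_cases t <;> fin_cases p <;> fin_cases q <;> simp [fuseL, siteR]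

end Recursion

/-! ### Factorization of the dressing at a degenerate point -/

section Core

variable {A : Type*} [Ring A] [Algebra ℂ A] (Q : ℂ) (a d k k' : A)

/-- The R-matrices of a segment. -/
def segR {n : ℕ} (z : Fin n → ℂ) : Fin n → Matrix (Fin 2) (Fin 2) (Matrix (Fin 2) (Fin 2) ℂ) :=
  fun i => siteR (z i * Q - (z i * Q)⁻¹) (z i - (z i)⁻¹) (Q - Q⁻¹)

/-- The inverse R-matrices of a segment, up to scalar factors. -/
def segRCo {n : ℕ} (z : Fin n → ℂ) :
    Fin n → Matrix (Fin 2) (Fin 2) (Matrix (Fin 2) (Fin 2) ℂ) :=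
  fun i => siteR ((z i)⁻¹ * Q - z i * Q⁻¹) ((z i)⁻¹ - z i) (Q - Q⁻¹)

/-- The L-operators of a segment. -/
def segL {n : ℕ} (c z : Fin n → ℂ) : Fin n → Matrix (Fin 2) (Fin 2) A :=
  fun i => siteL (c i) (z i) Q a d k k'

/-- The inverse L-operators of a segment, up to scalar factors. -/
def segLCo {n : ℕ} (c z : Fin n → ℂ) : Fin n → Matrix (Fin 2) (Fin 2) A :=
  fun i => siteLCo (c i) (z i) a d k k'

/-- The dressing of `X` by all L-operators and R-matrices. -/
def fullDressed {n : ℕ} (c z : Fin n → ℂ) (X : SegOp n) : Conf n → Conf n → Fin 2 → Fin 2 → A :=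
  dressed (segRCo Q z) (segR Q z) (sandwich (segLCo a d k k' c z) (segL Q a d k k' c z) X)

/-- The operator `G` in the decomposition `v G w` of the dressing of `X` at a point where the
L-operator at site `j` is degenerate. -/
def core : ∀ {n : ℕ} (_ : Fin n) (_ _ : Fin n → ℂ) (_ : SegOp n) (_ _ : Conf n), A
  | 0, j, _, _, _, _, _ => j.elim0
  | n + 1, j, c, z, X, s, t => Fin.cases (motive := fun _ => A)
      (∑ e, ∑ f, rowV a e * fullDressed Q a d k k' (Fin.tail c) (Fin.tail z) (headBlock e f X)
        (Fin.tail s) (Fin.tail t) (s 0) (t 0) * colW a f)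
      (fun i => ∑ e, ∑ f, fusedU (c 0) (z 0) Q a d k k' (s 0) e *
        core i (Fin.tail c) (Fin.tail z) (headBlock e f X) (Fin.tail s) (Fin.tail t) *
          fusedL (c 0) (z 0) Q a d k k' f (t 0)) j

variable {n : ℕ}

theorem core_zero (c z : Fin (n + 1) → ℂ) (X : SegOp (n + 1)) (s t : Conf (n + 1)) :
    core Q a d k k' 0 c z X s t = ∑ e, ∑ f, rowV a e *
      fullDressed Q a d k k' (Fin.tail c) (Fin.tail z) (headBlock e f X)
        (Fin.tail s) (Fin.tail t) (s 0) (t 0) * colW a f := rfl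

theorem core_succ (i : Fin n) (c z : Fin (n + 1) → ℂ) (X : SegOp (n + 1))
    (s t : Conf (n + 1)) :
    core Q a d k k' i.succ c z X s t = ∑ e, ∑ f, fusedU (c 0) (z 0) Q a d k k' (s 0) e *
        core Q a d k k' i (Fin.tail c) (Fin.tail z) (headBlock e f X) (Fin.tail s) (Fin.tail t) *
          fusedL (c 0) (z 0) Q a d k k' f (t 0) := rfl

theorem fullDressed_add (c z : Fin n → ℂ) (X Y : SegOp n) (s t : Conf n) (p q : Fin 2) :
    fullDressed Q a d k k' c z (X + Y) s t p q =
      fullDressed Q a d k k' c z X s t p q + fullDressed Q a d k k' c z Y s t p q := by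
  rw [fullDressed, fullDressed, fullDressed, ← dressed_add]
  congr 1
  funext u v
  exact sandwich_add _ _ _ _ _ _

theorem fullDressed_smul (c z : Fin n → ℂ) (r : ℂ) (X : SegOp n) (s t : Conf n) (p q : Fin 2) :
    fullDressed Q a d k k' c z (r • X) s t p q =
      r • fullDressed Q a d k k' c z X s t p q := by
  rw [fullDressed, fullDressed, ← dressed_smul]
  congr 1
  funext u v
  exact sandwich_smul _ _ _ _ _ _

theorem core_add (j : Fin n) (c z : Fin n → ℂ) (X Y : SegOp n) (s t : Conf n) :
    core Q a d k k' j c z (X + Y) s t =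
      core Q a d k k' j c z X s t + core Q a d k k' j c z Y s t := by
  induction n with
  | zero => exact j.elim0
  | succ n ih =>
    have hb : ∀ e f, headBlock e f (X + Y) = headBlock e f X + headBlock e f Y := fun _ _ => rfl
    induction j using Fin.cases with
    | zero => simp only [core_zero, hb, fullDressed_add, mul_add, add_mul,
        Finset.sum_add_distrib]
    | succ i => simp only [core_succ, hb, ih, mul_add, add_mul, Finset.sum_add_distrib]

theorem core_smul (j : Fin n) (c z : Fin n → ℂ) (r : ℂ) (X : SegOp n) (s t : Conf n) :
    core Q a d k k' j c z (r • X) s t = r • core Q a d k k' j c z X s t := by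
  induction n with
  | zero => exact j.elim0
  | succ n ih =>
    have hb : ∀ e f, headBlock e f (r • X) = r • headBlock e f X := fun _ _ => rfl
    induction j using Fin.cases with
    | zero => simp only [core_zero, hb, fullDressed_smul, mul_smul_comm, smul_mul_assoc,
        Finset.smul_sum]
    | succ i => simp only [core_succ, hb, ih, mul_smul_comm, smul_mul_assoc, Finset.smul_sum]

variable {Q a d k k'}

/-- The decomposition of the dressing of `X` at a point where the L-operator at site `j` is
degenerate. -/
theorem fullDressed_eq_core (h : OscRel Q a d k k') (hQ : Q ≠ 0) (j : Fin n) {c z : Fin n → ℂ}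
    (hc : ∀ i, c i ≠ 0) (hz : ∀ i, z i ≠ 0) (hj : z j = 1) (X : SegOp n) (s t : Conf n)
    (p q : Fin 2) :
    fullDressed Q a d k k' c z X s t p q =
      (Q - Q⁻¹) ^ 2 • (colV d k k' p * core Q a d k k' j c z X s t * rowW d k k' q) := by
  induction n generalizing p q with
  | zero => exact j.elim0
  | succ n ih =>
    rw [fullDressed, dressed_succ]
    induction j using Fin.cases with
    | zero =>
      have h1 : segR Q z 0 = siteR (Q - Q⁻¹) 0 (Q - Q⁻¹) := by simp [segR, hj]
      have h2 : segRCo Q z 0 = siteR (Q - Q⁻¹) 0 (Q - Q⁻¹) := by simp [segRCo, hj]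
      have h3 : segL Q a d k k' c z 0 = siteL (c 0) 1 Q a d k k' := by rw [segL, hj]
      have h4 : segLCo a d k k' c z 0 = siteLCo (c 0) 1 a d k k' := by rw [segLCo, hj]
      rw [h1, h2, h3, h4]
      simp only [fuseU_degenerate, fuseL_degenerate, ite_mul, mul_ite, zero_mul, mul_zero,
        Finset.sum_ite_eq', Finset.mem_univ, if_true, siteL_one h (c 0) hQ,
        siteLCo_one h (c 0), core_zero, Finset.mul_sum, Finset.sum_mul, Finset.smul_sum]
      refine Finset.sum_congr rfl fun e _ => Finset.sum_congr rfl fun f _ => ?_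
      simp only [smul_mul_assoc, mul_smul_comm, smul_smul, mul_assoc]
      -- The prefactors of `L` and its inverse cancel; the two permutations contribute one factor `Q
      -- - Q⁻¹` each.
      have hcc : (Q - Q⁻¹) * ((c 0) * ((Q - Q⁻¹) * (c 0)⁻¹)) = (Q - Q⁻¹) ^ 2 := by
        field_simp [hc 0]
      rw [hcc]
      rfl
    | succ i =>
      rw [core_succ]
      simp only [Finset.mul_sum, Finset.sum_mul, Finset.smul_sum]
      refine Finset.sum_congr rfl fun e _ => Finset.sum_congr rfl fun f _ => ?_
      have ih' := fun p' q' => ih i (c := Fin.tail c) (z := Fin.tail z) (fun i => hc i.succ)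
        (fun i => hz i.succ) hj (headBlock e f X) (Fin.tail s) (Fin.tail t) p' q'
      have hv := fuse_colV h (hc 0) (hz 0) hQ (s 0) e p
      have hw := rowW_fuse h (c := c 0) (hz 0) hQ f (t 0) q
      -- With the inductive factorization inserted, the two auxiliary sums decouple: `v` moves out
      -- to the left through `R' L'`, and `w` to the right through `L R`.
      calc _ = ∑ p', ∑ q', fuseU (segRCo Q z 0) (segLCo a d k k' c z 0) (s 0) e p p' *
              ((Q - Q⁻¹) ^ 2 • (colV d k k' p' * core Q a d k k' i (Fin.tail c) (Fin.tail z)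
                (headBlock e f X) (Fin.tail s) (Fin.tail t) * rowW d k k' q')) *
              fuseL (segL Q a d k k' c z 0) (segR Q z 0) f (t 0) q' q := by
            refine Finset.sum_congr rfl fun p' _ => Finset.sum_congr rfl fun q' _ => ?_
            rw [← ih']
            rfl
        _ = (Q - Q⁻¹) ^ 2 • ((∑ p', fuseU (segRCo Q z 0) (segLCo a d k k' c z 0) (s 0) e p p' *
              colV d k k' p') * core Q a d k k' i (Fin.tail c) (Fin.tail z)
                (headBlock e f X) (Fin.tail s) (Fin.tail t) *
              ∑ q', rowW d k k' q' * fuseL (segL Q a d k k' c z 0) (segR Q z 0) f (t 0) q' q) := by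
            simp only [Finset.mul_sum, Finset.sum_mul, Finset.smul_sum, mul_smul_comm,
              smul_mul_assoc, mul_assoc]
            rw [Finset.sum_comm]
        _ = _ := by
            rw [show ∑ p', fuseU (segRCo Q z 0) (segLCo a d k k' c z 0) (s 0) e p p' *
                colV d k k' p' = _ from hv, show ∑ q', rowW d k k' q' *
                fuseL (segL Q a d k k' c z 0) (segR Q z 0) f (t 0) q' q = _ from hw]
            simp only [mul_assoc]

end Core

/-! ### Degree and `q^D`-filtration of the dressed operators -/

section Grading

variable {A : Type*} [Ring A] [Algebra ℂ A]

/-- A filtration by powers of `q^D` and grading by the degree, as in `oscGraded`. -/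
structure OscGrading (C : ℤ → ℤ → Submodule ℂ A) (a d k k' : A) : Prop where
  one_mem : 1 ∈ C 0 0
  mul_mem : ∀ {δ e δ' e' : ℤ} {x y : A}, x ∈ C δ e → y ∈ C δ' e' → x * y ∈ C (δ + δ') (e + e')
  mono : ∀ {δ e : ℤ} {x : A}, x ∈ C (2 + δ) e → x ∈ C δ e
  a_mem : a ∈ C 0 (-1)
  d_mem : d ∈ C 0 1
  k_mem : k ∈ C 1 0
  k'_mem : k' ∈ C (-1) 0

/-- The number of down spins in a configuration. -/
def numDown {n : ℕ} (s : Conf n) : ℤ := ∑ i, ((s i : ℕ) : ℤ)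

theorem numDown_succ {n : ℕ} (s : Conf (n + 1)) :
    numDown s = ((s 0 : ℕ) : ℤ) + numDown (Fin.tail s) := by
  rw [numDown, Fin.sum_univ_succ]
  rfl

theorem numDown_cons {n : ℕ} (c : Fin 2) (s : Conf n) :
    numDown (Fin.cons c s : Conf (n + 1)) = ((c : ℕ) : ℤ) + numDown s := by
  rw [numDown_succ, Fin.cons_zero, Fin.tail_cons]

theorem numDown_nil (s : Conf 0) : numDown s = 0 := rfl

/-- `X` changes the number of down spins by `p`. -/
def HasWeight {n : ℕ} (p : ℤ) (X : SegOp n) : Prop :=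
  ∀ s t, X s t ≠ 0 → numDown t - numDown s = p

/-- Blocks of a spin-zero operator need not have spin zero, so inductions over the sites must allow
every weight. -/
theorem HasWeight.headBlock {n : ℕ} {p : ℤ} {X : SegOp (n + 1)} (hX : HasWeight p X)
    (c d : Fin 2) : HasWeight (p + ((c : ℕ) : ℤ) - ((d : ℕ) : ℤ)) (headBlock c d X) := by
  intro s t h
  have := hX _ _ h
  rw [numDown_cons, numDown_cons] at this
  linarith

theorem mem_congr {C : ℤ → ℤ → Submodule ℂ A} {x : A} {δ e : ℤ} (δ' e' : ℤ) (h : x ∈ C δ' e')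
    (hδ : δ' = δ) (he : e' = e) : x ∈ C δ e := by
  subst hδ he
  exact h

section Site

variable {C : ℤ → ℤ → Submodule ℂ A} {a d k k' : A} (hC : OscGrading C a d k k')
include hC

theorem siteL_mem (c z Q : ℂ) (s t : Fin 2) :
    siteL c z Q a d k k' s t ∈ C (1 - 2 * ((t : ℕ) : ℤ)) (((t : ℕ) : ℤ) - ((s : ℕ) : ℤ)) := by
  fin_cases s <;> fin_cases t <;> simp [siteL]
  · exact Submodule.smul_mem _ _ hC.k_mem
  · exact Submodule.smul_mem _ _ (mem_congr _ _ (hC.mul_mem hC.d_mem hC.k'_mem) rfl rfl)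
  · exact Submodule.smul_mem _ _ (mem_congr _ _ (hC.mul_mem hC.a_mem hC.k_mem) rfl rfl)
  · exact Submodule.sub_mem _ (Submodule.smul_mem _ _ hC.k'_mem)
      (Submodule.smul_mem _ _ (hC.mono hC.k_mem))

theorem siteLCo_mem (c z : ℂ) (s t : Fin 2) :
    siteLCo c z a d k k' s t ∈
      C (2 * ((s : ℕ) : ℤ) - 1) (((t : ℕ) : ℤ) - ((s : ℕ) : ℤ)) := by
  fin_cases s <;> fin_cases t <;> simp [siteLCo]
  · exact Submodule.sub_mem _ (Submodule.smul_mem _ _ hC.k'_mem)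
      (Submodule.smul_mem _ _ (hC.mono hC.k_mem))
  · exact Submodule.smul_mem _ _ (mem_congr _ _ (hC.mul_mem hC.k'_mem hC.d_mem) rfl rfl)
  · exact Submodule.smul_mem _ _ (mem_congr _ _ (hC.mul_mem hC.k_mem hC.a_mem) rfl rfl)
  · exact Submodule.smul_mem _ _ hC.k_mem

theorem fusedL_mem (c z Q : ℂ) (s t : Fin 2) :
    fusedL c z Q a d k k' s t ∈
      C (1 - 2 * ((t : ℕ) : ℤ)) (((t : ℕ) : ℤ) - ((s : ℕ) : ℤ)) := by
  rw [fusedL, Matrix.smul_apply]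
  refine Submodule.smul_mem _ _ ?_
  fin_cases s <;> fin_cases t <;> simp
  · exact hC.k_mem
  · exact Submodule.smul_mem _ _ (mem_congr _ _ (hC.mul_mem hC.d_mem hC.k'_mem) rfl rfl)
  · exact Submodule.smul_mem _ _ (mem_congr _ _ (hC.mul_mem hC.a_mem hC.k_mem) rfl rfl)
  · exact Submodule.sub_mem _ (Submodule.smul_mem _ _ hC.k'_mem)
      (Submodule.smul_mem _ _ (hC.mono
        (mem_congr _ _ (hC.mul_mem hC.k'_mem (hC.mul_mem hC.k_mem hC.k_mem)) rfl rfl)))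

theorem fusedU_mem (c z Q : ℂ) (s t : Fin 2) :
    fusedU c z Q a d k k' s t ∈
      C (2 * ((s : ℕ) : ℤ) - 1) (((t : ℕ) : ℤ) - ((s : ℕ) : ℤ)) := by
  rw [fusedU, Matrix.smul_apply]
  refine Submodule.smul_mem _ _ ?_
  fin_cases s <;> fin_cases t <;> simp
  · exact Submodule.sub_mem _ hC.k'_mem (Submodule.smul_mem _ _ (hC.mono hC.k_mem))
  · exact Submodule.smul_mem _ _ (mem_congr _ _ (hC.mul_mem hC.k'_mem hC.d_mem) rfl rfl)
  · exact Submodule.smul_mem _ _ (mem_congr _ _ (hC.mul_mem hC.k_mem hC.a_mem) rfl rfl)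
  · exact Submodule.smul_mem _ _ hC.k_mem

theorem rowV_mem (e : Fin 2) : rowV a e ∈ C 0 (((e : ℕ) : ℤ) - 1) := by
  fin_cases e <;> simp [rowV]
  · exact hC.a_mem
  · exact hC.one_mem

theorem colW_mem (e : Fin 2) : colW a e ∈ C 0 (-((e : ℕ) : ℤ)) := by
  fin_cases e <;> simp [colW]
  · exact hC.one_mem
  · exact hC.a_mem

theorem crossDefect_mem (z Q : ℂ) (s t : Fin 2) :
    crossDefect z Q d k s t ∈ C (2 + 2 * (((s : ℕ) : ℤ) - ((t : ℕ) : ℤ)))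
      (1 + (((t : ℕ) : ℤ) - ((s : ℕ) : ℤ))) := by
  have hk := hC.mul_mem hC.k_mem hC.k_mem
  rw [crossDefect, Matrix.smul_apply]
  refine Submodule.smul_mem _ _ ?_
  fin_cases s <;> fin_cases t <;> simp
  · exact Submodule.smul_mem _ _ (mem_congr _ _ (hC.mul_mem hC.d_mem hk) rfl rfl)
  · exact Submodule.smul_mem _ _ (mem_congr _ _ (hC.mul_mem hC.d_mem hC.d_mem) rfl rfl)
  · exact Submodule.smul_mem _ _
      (mem_congr _ _ (hC.mul_mem hC.k_mem (hC.mul_mem hC.k_mem hk)) rfl rfl)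
  · exact Submodule.smul_mem _ _ (mem_congr _ _ (hC.mul_mem hC.d_mem hk) rfl rfl)

theorem sandwich_mem {n : ℕ} {U L : Fin n → Matrix (Fin 2) (Fin 2) A}
    (hU : ∀ i (s t : Fin 2), U i s t ∈ C (2 * ((s : ℕ) : ℤ) - 1) (((t : ℕ) : ℤ) - ((s : ℕ) : ℤ)))
    (hL : ∀ i (s t : Fin 2), L i s t ∈ C (1 - 2 * ((t : ℕ) : ℤ)) (((t : ℕ) : ℤ) - ((s : ℕ) : ℤ)))
    {p : ℤ} {X : SegOp n} (hX : HasWeight p X) (s t : Conf n) :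
    sandwich U L X s t ∈
      C (-2 * (numDown t - numDown s)) (numDown t - numDown s - p) := by
  induction n generalizing p with
  | zero =>
    rw [sandwich_nil]
    by_cases h : X s t = 0
    · rw [h, zero_smul]; exact Submodule.zero_mem _
    · have := hX s t h
      exact Submodule.smul_mem _ _ (mem_congr _ _ hC.one_mem (by simp [numDown_nil])
        (by rw [this, sub_self]))
  | succ n ih =>
    rw [sandwich_succ]
    refine Submodule.sum_mem _ fun e _ => Submodule.sum_mem _ fun f _ => ?_
    refine mem_congr _ _ (hC.mul_mem (hC.mul_mem (hU 0 (s 0) e)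
      (ih (U := Fin.tail U) (L := Fin.tail L) (fun i => hU i.succ) (fun i => hL i.succ)
        (hX.headBlock e f) (Fin.tail s) (Fin.tail t))) (hL 0 f (t 0))) ?_ ?_ <;>
    · rw [numDown_succ s, numDown_succ t]
      ring

omit hC in
theorem siteR_ne_zero {x y w : ℂ} {s t p q : Fin 2} (h : siteR x y w s t p q ≠ 0) :
    ((s : ℕ) : ℤ) + ((p : ℕ) : ℤ) = ((t : ℕ) : ℤ) + ((q : ℕ) : ℤ) := by
  revert h
  fin_cases s <;> fin_cases t <;> fin_cases p <;> fin_cases q <;> simp [siteR]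

omit hC in
-- The ice rule conserves the sum of the site spin and the auxiliary spin, so dressing by R-matrices
-- only redistributes charge. The one-parameter family `K` carries degree and filtration together,
-- and `m` absorbs the spins of the sites already peeled off.
theorem dressed_mem {n : ℕ} (K : ℤ → Submodule ℂ A) (Q : ℂ) (z : Fin n → ℂ)
    {Z : Conf n → Conf n → A} (m : ℤ) (hZ : ∀ u v, Z u v ∈ K (numDown v - numDown u + m))
    (s t : Conf n) (p q : Fin 2) :
    dressed (segRCo Q z) (segR Q z) Z s t p q ∈
      K (numDown t - numDown s + ((q : ℕ) : ℤ) - ((p : ℕ) : ℤ) + m) := by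
  induction n generalizing p q m with
  | zero =>
    refine Submodule.sum_mem _ fun u _ => Submodule.sum_mem _ fun v _ => ?_
    have h1 : ∀ u v : Conf 0, (1 : Matrix (Conf 0) (Conf 0) (Matrix (Fin 2) (Fin 2) ℂ)) u v = 1 :=
      fun u v => by rw [Subsingleton.elim u v, Matrix.one_apply_eq]
    simp only [inProd, outProd, h1, mul_one]
    by_cases hpq : p = q
    · subst hpq
      rw [Matrix.one_apply_eq, one_smul]
      have := hZ u v
      rw [numDown_nil, numDown_nil] at this ⊢
      simpa using this
    · rw [Matrix.one_apply_ne hpq, zero_smul]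
      exact Submodule.zero_mem _
  | succ n ih =>
    rw [dressed_succ_aux]
    refine Submodule.sum_mem _ fun e _ => Submodule.sum_mem _ fun f _ =>
      Submodule.sum_mem _ fun p' _ => Submodule.sum_mem _ fun q' _ => ?_
    by_cases h0 : segRCo Q z 0 (s 0) e p p' * segR Q z 0 f (t 0) q' q = 0
    · rw [h0, zero_smul]
      exact Submodule.zero_mem _
    · have h1 := siteR_ne_zero (left_ne_zero_of_mul h0)
      have h2 := siteR_ne_zero (right_ne_zero_of_mul h0)
      have h3 := ih (Fin.tail z) (Z := fun u v => Z (Fin.cons e u) (Fin.cons f v))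
        (m := m + ((f : ℕ) : ℤ) - ((e : ℕ) : ℤ)) (fun u v => by
          have := hZ (Fin.cons e u) (Fin.cons f v)
          rw [numDown_cons, numDown_cons] at this
          rwa [show ((f : ℕ) : ℤ) + numDown v - (((e : ℕ) : ℤ) + numDown u) + m =
            numDown v - numDown u + (m + ((f : ℕ) : ℤ) - ((e : ℕ) : ℤ)) by ring] at this)
        (Fin.tail s) (Fin.tail t) p' q'
      refine Submodule.smul_mem _ _ ?_
      have h4 : numDown t - numDown s + ((q : ℕ) : ℤ) - ((p : ℕ) : ℤ) + m =
          numDown (Fin.tail t) - numDown (Fin.tail s) + ((q' : ℕ) : ℤ) - ((p' : ℕ) : ℤ) +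
            (m + ((f : ℕ) : ℤ) - ((e : ℕ) : ℤ)) := by
        rw [numDown_succ s, numDown_succ t]
        linarith
      rw [h4]
      exact h3

theorem fullDressed_mem {n : ℕ} (Q : ℂ) (c z : Fin n → ℂ) {p : ℤ} {X : SegOp n}
    (hX : HasWeight p X) (s t : Conf n) (e f : Fin 2) :
    fullDressed Q a d k k' c z X s t e f ∈
      C (-2 * (numDown t - numDown s + ((f : ℕ) : ℤ) - ((e : ℕ) : ℤ)))
        (numDown t - numDown s + ((f : ℕ) : ℤ) - ((e : ℕ) : ℤ) - p) := by
  have := dressed_mem (fun m => C (-2 * m) (m - p)) Q z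
    (Z := sandwich (segLCo a d k k' c z) (segL Q a d k k' c z) X) 0 (fun u v => by
      rw [add_zero]
      exact sandwich_mem hC (fun i => siteLCo_mem hC _ _) (fun i => siteL_mem hC _ _ _) hX u v)
    s t e f
  rwa [add_zero] at this

/-- Filtration and degree are governed by the same charge. For spin-zero `X` and charge `m`, the
operator `G a*` has degree `m` and filtration index `-2m`, so an additional `q^{2D}` leaves a
positive index whenever the degree is zero. -/
theorem core_mem {n : ℕ} (Q : ℂ) (j : Fin n) (c z : Fin n → ℂ) {p : ℤ} {X : SegOp n}
    (hX : HasWeight p X) (s t : Conf n) :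
    core Q a d k k' j c z X s t ∈
      C (-2 * (numDown t - numDown s)) (numDown t - numDown s - 1 - p) := by
  induction n generalizing p with
  | zero => exact j.elim0
  | succ n ih =>
    induction j using Fin.cases with
    | zero =>
      rw [core_zero]
      refine Submodule.sum_mem _ fun e _ => Submodule.sum_mem _ fun f _ => ?_
      refine mem_congr _ _ (hC.mul_mem (hC.mul_mem (rowV_mem hC e)
        (fullDressed_mem hC Q _ _ (hX.headBlock e f) (Fin.tail s) (Fin.tail t) (s 0) (t 0)))
          (colW_mem hC f)) ?_ ?_ <;>
      · rw [numDown_succ s, numDown_succ t]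
        ring
    | succ i =>
      rw [core_succ]
      refine Submodule.sum_mem _ fun e _ => Submodule.sum_mem _ fun f _ => ?_
      refine mem_congr _ _ (hC.mul_mem (hC.mul_mem (fusedU_mem hC _ _ Q (s 0) e)
        (ih i _ _ (hX.headBlock e f) (Fin.tail s) (Fin.tail t)))
          (fusedL_mem hC _ _ Q f (t 0))) ?_ ?_ <;>
      · rw [numDown_succ s, numDown_succ t]
        ring

end Site

/-- A trace on the q-oscillator algebra that vanishes on operators of nonzero degree and on
positive powers of `q^D`. -/
structure ResidueTrace (C : ℤ → ℤ → Submodule ℂ A) (O : Submodule ℂ A) (ε : A → ℂ) : Prop where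
  le : ∀ {δ e : ℤ} {x : A}, x ∈ C δ e → x ∈ O
  mul_mem : ∀ {x y : A}, x ∈ O → y ∈ O → x * y ∈ O
  add : ∀ {x y : A}, x ∈ O → y ∈ O → ε (x + y) = ε x + ε y
  smul : ∀ {x : A} (r : ℂ), x ∈ O → ε (r • x) = r * ε x
  comm : ∀ {x y : A}, x ∈ O → y ∈ O → ε (x * y) = ε (y * x)
  eq_zero : ∀ {δ e : ℤ} {x : A}, (e ≠ 0 ∨ 0 < δ) → x ∈ C δ e → ε x = 0

/-! ### Left reduction for the residue trace -/

section Trace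

variable {C : ℤ → ℤ → Submodule ℂ A} {O : Submodule ℂ A} {ε : A → ℂ} {Q : ℂ} {a d k k' : A}

variable (hC : OscGrading C a d k k') (hε : ResidueTrace C O ε) (h : OscRel Q a d k k')
include hC hε h

/-- Reduction from the left at the degenerate site. -/
theorem eps_core_zero_tensorIdLeft {n : ℕ} (c z : Fin (n + 1) → ℂ) {X : SegOp n}
    (hX : HasWeight 0 X) (s t : Conf (n + 1)) :
    ε (core Q a d k k' 0 c z (tensorIdLeft X) s t * d) = 0 := by
  set D := fullDressed Q a d k k' (Fin.tail c) (Fin.tail z) X (Fin.tail s) (Fin.tail t)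
    (s 0) (t 0) with hDdef
  have hD := fullDressed_mem hC Q (Fin.tail c) (Fin.tail z) hX (Fin.tail s) (Fin.tail t)
    (s 0) (t 0)
  rw [← hDdef] at hD
  have h0 : ∀ s t p q,
      fullDressed Q a d k k' (Fin.tail c) (Fin.tail z) (0 : SegOp n) s t p q = 0 := by
    intro s t p q
    simpa using fullDressed_smul Q a d k k' (Fin.tail c) (Fin.tail z) 0 (0 : SegOp n) s t p q
  have hcore : core Q a d k k' 0 c z (tensorIdLeft X) s t = a * D - D * a := by
    rw [core_zero]
    simp [headBlock_tensorIdLeft, Fin.sum_univ_two, h0, rowV, colW, ← hDdef, sub_eq_add_neg]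
  have hDO := hε.le hD
  have haO := hε.le hC.a_mem
  have hdO := hε.le hC.d_mem
  have h1 : ε (a * D * d) = ε (D * (d * a)) := by
    rw [mul_assoc, hε.comm haO (hε.mul_mem hDO hdO), mul_assoc]
  have h2 : (a * D - D * a) * d = a * D * d + (-1 : ℂ) • (D * (a * d)) := by
    rw [neg_one_smul, sub_mul, sub_eq_add_neg, mul_assoc D]
  rw [hcore, h2, hε.add (hε.mul_mem (hε.mul_mem haO hDO) hdO)
    (O.smul_mem _ (hε.mul_mem hDO (hε.mul_mem haO hdO))), h1,
    ← hε.add (hε.mul_mem hDO (hε.mul_mem hdO haO))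
    (O.smul_mem _ (hε.mul_mem hDO (hε.mul_mem haO hdO)))]
  -- The constant terms of `a* a` and `a a*` cancel, and only a multiple of `q^{2D}` remains.
  have h3 : D * (d * a) + (-1 : ℂ) • (D * (a * d)) = (Q ^ 2 - 1) • (D * (k * k)) := by
    rw [h.d_a, h.a_d, mul_sub, mul_sub, mul_smul_comm, mul_one]
    module
  rw [h3, hε.smul _ (hε.mul_mem hDO (hε.mul_mem (hε.le hC.k_mem) (hε.le hC.k_mem)))]
  have h4 := hC.mul_mem hD (hC.mul_mem hC.k_mem hC.k_mem)
  rw [hε.eq_zero ?_ h4, mul_zero]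
  -- At zero charge the two factors `k` give filtration index `2`; otherwise the degree is nonzero.
  by_cases hm : numDown (Fin.tail t) - numDown (Fin.tail s) + ((t 0 : ℕ) : ℤ) -
      ((s 0 : ℕ) : ℤ) = 0
  · right
    rw [hm]
    norm_num
  · left
    simpa using hm

/-- Reduction from the left at a regular site. -/
theorem eps_core_succ_tensorIdLeft {n : ℕ} (hQ : Q ≠ 0) (i : Fin n) (c z : Fin (n + 1) → ℂ)
    (hc : c 0 ≠ 0) (hz : z 0 ≠ 0) {X : SegOp n} (hX : HasWeight 0 X) (s t : Conf (n + 1)) :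
    ε (core Q a d k k' i.succ c z (tensorIdLeft X) s t * d) =
      if s 0 = t 0 then ((z 0 * Q - (z 0 * Q)⁻¹) * ((z 0)⁻¹ * Q - z 0 * Q⁻¹) * (1 - z 0 ^ 2)) *
        ε (core Q a d k k' i (Fin.tail c) (Fin.tail z) X (Fin.tail s) (Fin.tail t) * d)
      else 0 := by
  set G := core Q a d k k' i (Fin.tail c) (Fin.tail z) X (Fin.tail s) (Fin.tail t) with hGdef
  have hG := core_mem hC Q i (Fin.tail c) (Fin.tail z) hX (Fin.tail s) (Fin.tail t)
  rw [← hGdef] at hG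
  have h0 : ∀ s t, core Q a d k k' i (Fin.tail c) (Fin.tail z) (0 : SegOp n) s t = 0 := by
    intro s t
    simpa using core_smul Q a d k k' i (Fin.tail c) (Fin.tail z) 0 (0 : SegOp n) s t
  have hcore : core Q a d k k' i.succ c z (tensorIdLeft X) s t =
      fusedU (c 0) (z 0) Q a d k k' (s 0) 0 * (G * fusedL (c 0) (z 0) Q a d k k' 0 (t 0)) +
      fusedU (c 0) (z 0) Q a d k k' (s 0) 1 * (G * fusedL (c 0) (z 0) Q a d k k' 1 (t 0)) := by
    rw [core_succ]
    simp [headBlock_tensorIdLeft, Fin.sum_univ_two, h0, ← hGdef, mul_assoc]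
  have hGO := hε.le hG
  have hdO := hε.le hC.d_mem
  have hU := fun e => hε.le (fusedU_mem hC (c 0) (z 0) Q (s 0) e)
  have hL := fun e => hε.le (fusedL_mem hC (c 0) (z 0) Q e (t 0))
  have hcomm : ∀ e, ε (fusedU (c 0) (z 0) Q a d k k' (s 0) e *
      (G * fusedL (c 0) (z 0) Q a d k k' e (t 0)) * d) =
      ε (G * (fusedL (c 0) (z 0) Q a d k k' e (t 0) *
        (d * fusedU (c 0) (z 0) Q a d k k' (s 0) e))) := by
    intro e
    rw [mul_assoc, hε.comm (hU e) (hε.mul_mem (hε.mul_mem hGO (hL e)) hdO)]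
    simp only [mul_assoc]
  have hO := fun e => hε.mul_mem hGO (hε.mul_mem (hL e) (hε.mul_mem hdO (hU e)))
  have hO' := fun e => hε.mul_mem (hε.mul_mem (hU e) (hε.mul_mem hGO (hL e))) hdO
  have hcross := fused_cross h (c := c 0) hc hz hQ (s 0) (t 0)
  rw [Fin.sum_univ_two] at hcross
  rw [hcore, add_mul, hε.add (hO' 0) (hO' 1), hcomm, hcomm, ← hε.add (hO 0) (hO 1), ← mul_add,
    hcross, mul_add]
  have hdef := hC.mul_mem hG (crossDefect_mem hC (z 0) Q (s 0) (t 0))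
  -- The product has degree equal to the total charge `m` and filtration index `2 - 2m`, so one of
  -- the two vanishing criteria always applies.
  have hdef0 : ε (G * crossDefect (z 0) Q d k (s 0) (t 0)) = 0 := by
    refine hε.eq_zero ?_ hdef
    by_cases hm : numDown (Fin.tail t) - numDown (Fin.tail s) + ((t 0 : ℕ) : ℤ) -
      ((s 0 : ℕ) : ℤ) = 0
    · right
      linarith
    · left
      intro h1
      apply hm
      linarith
  split_ifs
  · rw [mul_smul_comm, hε.add (O.smul_mem _ (hε.mul_mem hGO hdO)) (hε.le hdef), hdef0, add_zero,
      hε.smul _ (hε.mul_mem hGO hdO)]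
  · rw [mul_zero, zero_add, hdef0]

end Trace

end Grading

/-! ### The q-oscillator representation -/

section Concrete

variable (η : ℂ)

theorem oscRel : OscRel (Complex.exp η) (oscA η) oscAdag (qPow η 1) (qPow η (-1)) where
  k_k' := by rw [qPow_mul]; exact qPow_zero η
  k'_k := by rw [qPow_mul]; exact qPow_zero η
  d_k := by
    rw [qPow_mul_adag, smul_smul]
    simp
  d_k' := by
    rw [qPow_mul_adag, smul_smul, ← Complex.exp_add]
    simp
  a_k := by rw [a_mul_qPow]; simp
  a_k' := by rw [a_mul_qPow]; simp [Complex.exp_neg]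
  d_a := by rw [qPow_mul]; exact adag_mul_a η
  a_d := by
    rw [qPow_mul, ← Complex.exp_nat_mul]
    exact a_mul_adag η

theorem oscGrading : OscGrading (oscGraded η) (oscA η) oscAdag (qPow η 1) (qPow η (-1)) where
  one_mem := one_mem_oscGraded
  mul_mem := oscGraded_mul
  mono h := oscGraded_mono 1 (by simpa using h)
  a_mem := a_mem_oscGraded
  d_mem := adag_mem_oscGraded
  k_mem := qPow_mem_oscGraded 1
  k'_mem := qPow_mem_oscGraded (-1)

theorem residueTrace (hη : ∀ m : ℕ, 0 < m → Complex.exp (m * η) ≠ 1) :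
    ResidueTrace (oscGraded η) (oscAlg η) (eps η) where
  le h := oscGraded_le _ _ h
  mul_mem := oscAlg_mul
  add := eps_add hη
  smul r h := eps_smul hη h r
  comm := eps_mul_comm hη
  eq_zero h hx := eps_eq_zero hη h hx

/-- The scalar prefactor of `L⁺`. -/
def lPref (μ : ℂ) : ℂ := Complex.I * Complex.exp (-μ / 2) * Complex.exp (-η / 4)

theorem lPref_ne_zero (μ : ℂ) : lPref η μ ≠ 0 :=
  mul_ne_zero (mul_ne_zero Complex.I_ne_zero (Complex.exp_ne_zero _)) (Complex.exp_ne_zero _)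

theorem siteL_of_rel {A : Type*} [Ring A] [Algebra ℂ A] {Q : ℂ} {a d k k' : A}
    (h : OscRel Q a d k k') (c z : ℂ) :
    c • (!![1, -(z • d); -(z • a), 1 - (z ^ 2 * Q ^ 2) • (k * k)] * !![k, 0; 0, k']) =
      siteL c z Q a d k k' := by
  ext i j
  fin_cases i <;> fin_cases j <;>
  simp [siteL, sub_mul, smul_sub, smul_smul, mul_assoc,
    h.k_k']

theorem lPlus_eq (μ : ℂ) : lPlus η μ = siteL (lPref η μ) (Complex.exp μ) (Complex.exp η)
    (oscA η) oscAdag (qPow η 1) (qPow η (-1)) := by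
  rw [← siteL_of_rel (oscRel η), ← Complex.exp_nat_mul, ← Complex.exp_nat_mul, ← qD_eq, ← qDinv_eq]
  rfl

theorem rMat_eq (μ : ℂ) : rMat η μ =
    siteR (Complex.exp μ * Complex.exp η - (Complex.exp μ * Complex.exp η)⁻¹)
      (Complex.exp μ - (Complex.exp μ)⁻¹) (Complex.exp η - (Complex.exp η)⁻¹) := by
  simp only [rMat, siteR, ← Complex.exp_add, ← Complex.exp_neg]

end Concrete

theorem siteR_mul {z Q : ℂ} (hz : z ≠ 0) (hQ : Q ≠ 0) :
    siteR (z * Q - (z * Q)⁻¹) (z - z⁻¹) (Q - Q⁻¹) *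
      siteR (z⁻¹ * Q - z * Q⁻¹) (z⁻¹ - z) (Q - Q⁻¹) =
      ((z * Q - (z * Q)⁻¹) * (z⁻¹ * Q - z * Q⁻¹)) •
        (1 : Matrix (Fin 2) (Fin 2) (Matrix (Fin 2) (Fin 2) ℂ)) := by
  ext i j p q
  fin_cases i <;> fin_cases j <;> fin_cases p <;> fin_cases q <;>
  simp [siteR, Matrix.mul_apply, Fin.sum_univ_two]
  all_goals
    field_simp
    try ring

theorem siteR_mul' {z Q : ℂ} (hz : z ≠ 0) (hQ : Q ≠ 0) :
    siteR (z⁻¹ * Q - z * Q⁻¹) (z⁻¹ - z) (Q - Q⁻¹) *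
      siteR (z * Q - (z * Q)⁻¹) (z - z⁻¹) (Q - Q⁻¹) =
      ((z * Q - (z * Q)⁻¹) * (z⁻¹ * Q - z * Q⁻¹)) •
        (1 : Matrix (Fin 2) (Fin 2) (Matrix (Fin 2) (Fin 2) ℂ)) := by
  have := siteR_mul (inv_ne_zero hz) hQ
  rw [inv_inv] at this
  have h1 : (z⁻¹ * Q)⁻¹ = z * Q⁻¹ := by rw [mul_inv, inv_inv]
  have h2 : z⁻¹ * Q⁻¹ = (z * Q)⁻¹ := by rw [mul_inv]
  rw [h1, h2] at this
  rw [this, mul_comm]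

/-! ### Continuous families of operators in the q-oscillator algebra -/

section Family

variable {η : ℂ}

/-- Families of operators of the form `μ ↦ ∑ g_i(μ) B_i` with continuous functions `g_i` and
elements `B_i` of the q-oscillator algebra. -/
def famAlg (η : ℂ) : Submodule ℂ (ℂ → Module.End ℂ Fock) :=
  Submodule.span ℂ {F | ∃ g : ℂ → ℂ, Continuous g ∧ ∃ B ∈ oscAlg η, F = fun μ => g μ • B}

theorem fam_mem {g : ℂ → ℂ} (hg : Continuous g) {B : Module.End ℂ Fock} (hB : B ∈ oscAlg η) :
    (fun μ => g μ • B) ∈ famAlg η :=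
  Submodule.subset_span ⟨g, hg, B, hB, rfl⟩

theorem fam_add {F G : ℂ → Module.End ℂ Fock} (hF : F ∈ famAlg η) (hG : G ∈ famAlg η) :
    (fun μ => F μ + G μ) ∈ famAlg η := Submodule.add_mem _ hF hG

theorem fam_mul {F G : ℂ → Module.End ℂ Fock} (hF : F ∈ famAlg η) (hG : G ∈ famAlg η) :
    (fun μ => F μ * G μ) ∈ famAlg η := by
  induction hF using Submodule.span_induction with
  | mem F hF =>
    obtain ⟨g, hg, B, hB, rfl⟩ := hF
    induction hG using Submodule.span_induction with
    | mem G hG =>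
      obtain ⟨g', hg', B', hB', rfl⟩ := hG
      have := fam_mem (hg.mul hg') (oscAlg_mul hB hB')
      convert this using 2 with μ
      rw [smul_mul_smul_comm]
      rfl
    | zero =>
      convert (famAlg η).zero_mem using 1
      funext μ
      simp
    | add x y _ _ hx hy =>
      convert (famAlg η).add_mem hx hy using 1
      funext μ
      simp [mul_add]
    | smul c x _ hx =>
      convert (famAlg η).smul_mem c hx using 1
      funext μ
      simp
  | zero =>
    convert (famAlg η).zero_mem using 1
    funext μ
    simp
  | add x y _ _ hx hy =>
    convert (famAlg η).add_mem hx hy using 1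
    funext μ
    simp [add_mul]
  | smul c x _ hx =>
    convert (famAlg η).smul_mem c hx using 1
    funext μ
    simp

/-- For small `α ≠ 0` the trace of a continuous family exists and is continuous. -/
theorem fam_trace (hη : ∀ m : ℕ, 0 < m → Complex.exp (m * η) ≠ 1)
    {F : ℂ → Module.End ℂ Fock} (hF : F ∈ famAlg η) :
    ∀ᶠ α in 𝓝[≠] (0 : ℂ), (∀ μ, F μ ∈ traceDomain (Complex.exp (2 * α * η))) ∧
      Continuous fun μ => oscTrace (Complex.exp (2 * α * η)) (F μ) := by
  induction hF using Submodule.span_induction with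
  | mem F hF =>
    obtain ⟨g, hg, B, hB, rfl⟩ := hF
    -- The operator `B` does not depend on `μ`, so one punctured neighbourhood of `α = 0` serves all
    -- `μ`.
    filter_upwards [(hasEps_eps hη hB).1] with α hα
    refine ⟨fun μ => Submodule.smul_mem _ _ hα, ?_⟩
    simp only [oscTrace_smul hα]
    exact hg.mul continuous_const
  | zero =>
    refine Eventually.of_forall fun α => ⟨fun μ => Submodule.zero_mem _, ?_⟩
    simp only [Pi.zero_apply]
    exact continuous_const
  | add x y _ _ hx hy =>
    filter_upwards [hx, hy] with α h1 h2
    refine ⟨fun μ => Submodule.add_mem _ (h1.1 μ) (h2.1 μ), ?_⟩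
    simp only [Pi.add_apply, oscTrace_add (h1.1 _) (h2.1 _)]
    exact h1.2.add h2.2
  | smul c x _ hx =>
    filter_upwards [hx] with α h1
    refine ⟨fun μ => Submodule.smul_mem _ _ (h1.1 μ), ?_⟩
    simp only [Pi.smul_apply, oscTrace_smul (h1.1 _)]
    exact continuous_const.mul h1.2

theorem one_fam : (fun _ => 1) ∈ famAlg η := by
  have := fam_mem (η := η) (continuous_const (y := (1 : ℂ))) one_mem
  simpa using this

theorem fam_inProd {n : ℕ} {U : ℂ → Fin n → Matrix (Fin 2) (Fin 2) (Module.End ℂ Fock)}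
    (hU : ∀ i s t, (fun μ => U μ i s t) ∈ famAlg η) (s t : Conf n) :
    (fun μ => inProd (U μ) s t) ∈ famAlg η := by
  induction n with
  | zero =>
    have : (fun μ => inProd (U μ) s t) = fun _ => 1 := by
      funext μ
      rw [Subsingleton.elim s t]
      exact Matrix.one_apply_eq _
    rw [this]
    exact one_fam
  | succ n ih =>
    exact fam_mul (hU 0 (s 0) (t 0)) (ih (U := fun μ => Fin.tail (U μ)) (fun i => hU i.succ)
      (Fin.tail s) (Fin.tail t))

theorem fam_outProd {n : ℕ} {L : ℂ → Fin n → Matrix (Fin 2) (Fin 2) (Module.End ℂ Fock)}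
    (hL : ∀ i s t, (fun μ => L μ i s t) ∈ famAlg η) (s t : Conf n) :
    (fun μ => outProd (L μ) s t) ∈ famAlg η := by
  induction n with
  | zero =>
    have : (fun μ => outProd (L μ) s t) = fun _ => 1 := by
      funext μ
      rw [Subsingleton.elim s t]
      exact Matrix.one_apply_eq _
    rw [this]
    exact one_fam
  | succ n ih =>
    exact fam_mul (ih (L := fun μ => Fin.tail (L μ)) (fun i => hL i.succ)
      (Fin.tail s) (Fin.tail t)) (hL 0 (s 0) (t 0))

theorem sub_smul_eq {A : Type*} [Ring A] [Algebra ℂ A] (c c' : ℂ) (x y : A) :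
    c • x - c' • y = c • x + (-c') • y := by
  rw [neg_smul, sub_eq_add_neg]

theorem fam_siteL (lam : ℂ) (s t : Fin 2) :
    (fun μ => siteL (lPref η (μ - lam)) (Complex.exp (μ - lam)) (Complex.exp η) (oscA η) oscAdag
      (qPow η 1) (qPow η (-1)) s t) ∈ famAlg η := by
  have hc : Continuous fun μ => lPref η (μ - lam) := by
    unfold lPref
    fun_prop
  have hz : Continuous fun μ => Complex.exp (μ - lam) := by fun_prop
  fin_cases s <;> fin_cases t
  · exact fam_mem hc (qPow_mem 1)
  · exact fam_mem (hc.mul hz).neg (oscAlg_mul adag_mem (qPow_mem _))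
  · exact fam_mem (hc.mul hz).neg (oscAlg_mul a_mem (qPow_mem _))
  · have := fam_add (fam_mem (η := η) hc (qPow_mem (-1)))
      (fam_mem (((hc.mul (hz.pow 2)).mul (continuous_const (y := Complex.exp η ^ 2))).neg)
        (qPow_mem (η := η) 1))
    convert this using 2 with μ
    exact sub_smul_eq (A := Module.End ℂ Fock) _ _ _ _

theorem fam_siteLCo (lam : ℂ) (s t : Fin 2) :
    (fun μ => siteLCo (lPref η (μ - lam)) (Complex.exp (μ - lam)) (oscA η) oscAdag
      (qPow η 1) (qPow η (-1)) s t) ∈ famAlg η := by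
  have hc : Continuous fun μ => (lPref η (μ - lam))⁻¹ := by
    refine Continuous.inv₀ ?_ fun μ => lPref_ne_zero η _
    unfold lPref
    fun_prop
  have hz : Continuous fun μ => Complex.exp (μ - lam) := by fun_prop
  fin_cases s <;> fin_cases t
  · have := fam_add (fam_mem (η := η) hc (qPow_mem (-1)))
      (fam_mem ((hc.mul (hz.pow 2)).neg) (qPow_mem (η := η) 1))
    convert this using 2 with μ
    exact sub_smul_eq (A := Module.End ℂ Fock) _ _ _ _
  · exact fam_mem (hc.mul hz) (oscAlg_mul (qPow_mem _) adag_mem)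
  · exact fam_mem (hc.mul hz) (oscAlg_mul (qPow_mem _) a_mem)
  · exact fam_mem hc (qPow_mem 1)

end Family

/-! ### The residues of `H` -/

section Residue

variable {n : ℕ}

/-- The ratios `ζ / ξ_j` of the spectral parameters. -/
def segZ (lam : Fin n → ℂ) (μ : ℂ) : Fin n → ℂ := fun i => Complex.exp (μ - lam i)

/-- The prefactors of the L-operators of a segment. -/
def segC (η : ℂ) (lam : Fin n → ℂ) (μ : ℂ) : Fin n → ℂ := fun i => lPref η (μ - lam i)

/-- The L-operators of a segment as operators on `W⁺`. -/
def oscL (η : ℂ) (lam : Fin n → ℂ) (μ : ℂ) :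
    Fin n → Matrix (Fin 2) (Fin 2) (Module.End ℂ Fock) :=
  segL (Complex.exp η) (oscA η) oscAdag (qPow η 1) (qPow η (-1)) (segC η lam μ) (segZ lam μ)

/-- The inverse L-operators of a segment, up to scalar factors. -/
def oscLCo (η : ℂ) (lam : Fin n → ℂ) (μ : ℂ) :
    Fin n → Matrix (Fin 2) (Fin 2) (Module.End ℂ Fock) :=
  segLCo (oscA η) oscAdag (qPow η 1) (qPow η (-1)) (segC η lam μ) (segZ lam μ)

/-- `R R' = rNorm` for the R-matrix and its inverse up to a scalar factor. -/
def rNorm (Q z : ℂ) : ℂ := (z * Q - (z * Q)⁻¹) * (z⁻¹ * Q - z * Q⁻¹)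

variable (η : ℂ) (lam : Fin n → ℂ)

theorem oscL_mul_oscLCo (μ : ℂ) (i : Fin n) :
    oscL η lam μ i * oscLCo η lam μ i = (1 - segZ lam μ i ^ 2) • 1 :=
  siteL_mul_siteLCo (oscRel η) (lPref_ne_zero η _) (Complex.exp_ne_zero _)

theorem oscLCo_mul_oscL (μ : ℂ) (i : Fin n) :
    oscLCo η lam μ i * oscL η lam μ i = (1 - segZ lam μ i ^ 2) • 1 :=
  siteLCo_mul_siteL (oscRel η) (lPref_ne_zero η _) (Complex.exp_ne_zero _)

theorem monodromy_lPlus (μ : ℂ) :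
    (monodromy fun j => lPlus η (μ - lam j)) = monodromy (oscL η lam μ) := by
  congr 1
  funext j
  exact lPlus_eq η _

theorem oscAdj_eq {μ : ℂ} (hμ : ∀ i, 1 - segZ lam μ i ^ 2 ≠ 0) (X : SegOp n) (s t : Conf n) :
    oscAdj η lam μ X s t = (∏ i, (1 - segZ lam μ i ^ 2))⁻¹ •
      sandwich (oscLCo η lam μ) (oscL η lam μ) X s t := by
  rw [oscAdj, monodromy_lPlus]
  exact invAdj_eq_sandwich (oscL_mul_oscLCo η lam μ) (oscLCo_mul_oscL η lam μ) hμ X s t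

theorem isUnit_of_mul_eq_smul {A : Type*} [Ring A] [Algebra ℂ A] {L U : A} {κ : ℂ} (hκ : κ ≠ 0)
    (h : L * U = κ • 1) (h' : U * L = κ • 1) : IsUnit L :=
  ⟨⟨L, κ⁻¹ • U, by rw [mul_smul_comm, h, smul_smul, inv_mul_cancel₀ hκ, one_smul],
    by rw [smul_mul_assoc, h', smul_smul, inv_mul_cancel₀ hκ, one_smul]⟩, rfl⟩

theorem annihilator_ne_zero {A : Type*} [Ring A] [Nontrivial A] (x : A) :
    (!![x, 1; x, 1] : Matrix (Fin 2) (Fin 2) A) ≠ 0 := by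
  intro h
  have := congrFun (congrFun h 0) 1
  simp at this

theorem not_isUnit_of_mul_eq_zero {A : Type*} [Ring A] {N L : A} (hN : N ≠ 0) (h : N * L = 0) :
    ¬ IsUnit L := fun hL => hN (hL.mul_left_eq_zero.1 h)

/-- At degenerate spectral parameters `Ring.inverse` takes its default value zero. The defining
trace is then trivial there, and existence can be asserted for every `μ`. -/
theorem oscAdj_eq_zero {μ : ℂ} (hμ : ∃ i, 1 - segZ lam μ i ^ 2 = 0) (X : SegOp n) :
    oscAdj η lam μ X = 0 := by
  have hann : ∀ i, 1 - segZ lam μ i ^ 2 = 0 →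
      !![segZ lam μ i • oscA η, 1; segZ lam μ i • oscA η, 1] * oscL η lam μ i = 0 := by
    intro i hi
    exact annihilator_mul_siteL (oscRel η) (segC η lam μ i) (sub_eq_zero.1 hi).symm
      (Complex.exp_ne_zero η)
  have hinv := ring_inverse_monodromy_eq_zero (L := oscL η lam μ)
    (N := fun i => !![segZ lam μ i • oscA η, 1; segZ lam μ i • oscA η, 1])
    (fun i => by
      by_cases hi : 1 - segZ lam μ i ^ 2 = 0
      · exact Or.inr ⟨annihilator_ne_zero (A := Module.End ℂ Fock) _, hann i hi⟩
      · exact Or.inl (isUnit_of_mul_eq_smul (A := Matrix (Fin 2) (Fin 2) (Module.End ℂ Fock)) hi (oscL_mul_oscLCo η lam μ i)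
          (oscLCo_mul_oscL η lam μ i)))
    (hμ.imp fun i hi => not_isUnit_of_mul_eq_zero
      (A := Matrix (Fin 2) (Fin 2) (Module.End ℂ Fock)) (annihilator_ne_zero (A := Module.End ℂ Fock) _) (hann i hi))
  rw [oscAdj, monodromy_lPlus, invAdj, hinv, zero_mul, zero_mul]

theorem opT_eq {μ : ℂ} (hμ : ∀ i, rNorm (Complex.exp η) (segZ lam μ i) ≠ 0) (X : SegOp n)
    (s t : Conf n) :
    opT η lam μ X s t = (∏ i, rNorm (Complex.exp η) (segZ lam μ i))⁻¹ *
      (sandwich (segRCo (Complex.exp η) (segZ lam μ)) (segR (Complex.exp η) (segZ lam μ))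
        X s t).trace := by
  have hR : (fun j => rMat η (μ - lam j)) = segR (Complex.exp η) (segZ lam μ) := by
    funext j
    exact rMat_eq η _
  rw [opT, hR, Matrix.of_apply, invAdj_eq_sandwich (U := segRCo (Complex.exp η) (segZ lam μ))
    (κ := fun i => rNorm (Complex.exp η) (segZ lam μ i)) _ _ hμ, Matrix.trace_smul, smul_eq_mul]
  · exact fun j => siteR_mul (Complex.exp_ne_zero _) (Complex.exp_ne_zero _)
  · exact fun j => siteR_mul' (Complex.exp_ne_zero _) (Complex.exp_ne_zero _)

variable {η}

theorem fam_prod (s u v t : Conf n) :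
    (fun μ => inProd (oscLCo η lam μ) s u * outProd (oscL η lam μ) v t) ∈ famAlg η :=
  fam_mul (fam_inProd (fun i s t => fam_siteLCo (lam i) s t) s u)
    (fam_outProd (fun i s t => fam_siteL (lam i) s t) v t)

theorem fam_sandwich (X : SegOp n) (s t : Conf n) :
    (fun μ => sandwich (oscLCo η lam μ) (oscL η lam μ) X s t) ∈ famAlg η := by
  have : (fun μ => sandwich (oscLCo η lam μ) (oscL η lam μ) X s t) =
      ∑ u, ∑ v, X u v • fun μ => inProd (oscLCo η lam μ) s u * outProd (oscL η lam μ) v t := by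
    funext μ
    simp [sandwich, Finset.sum_apply]
  rw [this]
  exact Submodule.sum_mem _ fun u _ => Submodule.sum_mem _ fun v _ =>
    Submodule.smul_mem _ _ (fam_prod lam s u v t)

/-- The traces in the definition of `Q` exist for all small `α ≠ 0`. -/
theorem eventually_hasOscTrace (hη : ∀ m : ℕ, 0 < m → Complex.exp (m * η) ≠ 1) :
    ∀ᶠ α in 𝓝[≠] (0 : ℂ), ∀ (μ : ℂ) (X : SegOp n) (s t : Conf n),
      HasOscTrace (Complex.exp (2 * α * η)) (oscAdj η lam μ X s t) (opQ η lam μ α X s t) := by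
  have h : ∀ᶠ α in 𝓝[≠] (0 : ℂ), ∀ s u v t : Conf n, ∀ μ,
      inProd (oscLCo η lam μ) s u * outProd (oscL η lam μ) v t ∈
        traceDomain (Complex.exp (2 * α * η)) := by
    simp only [eventually_all]
    intro s u v t
    filter_upwards [fam_trace hη (fam_prod lam s u v t)] with α hα using hα.1
  filter_upwards [h] with α hα μ X s t
  refine hasOscTrace_of_mem ?_
  by_cases hμ : ∃ i, 1 - segZ lam μ i ^ 2 = 0
  · rw [oscAdj_eq_zero η lam hμ]
    exact Submodule.zero_mem _
  · push Not at hμ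
    rw [oscAdj_eq η lam hμ]
    exact Submodule.smul_mem _ _ (Submodule.sum_mem _ fun u _ => Submodule.sum_mem _ fun v _ =>
      Submodule.smul_mem _ _ (hα s u v t μ))

end Residue

/-! ### Genericity and the simple poles in the spectral parameter -/

section Residue

variable {n : ℕ} {η : ℂ} {lam : Fin n → ℂ}

/-- The genericity of the inhomogeneities of a segment. -/
def Generic (η : ℂ) (lam : Fin n → ℂ) : Prop :=
  ∀ i j, i ≠ j → Complex.sinh (lam i - lam j) ≠ 0 ∧ Complex.sinh (lam i - lam j + η) ≠ 0

theorem one_sub_exp_sq (x : ℂ) :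
    1 - Complex.exp x ^ 2 = -(2 * Complex.exp x * Complex.sinh x) := by
  have h : Complex.exp x * Complex.exp (-x) = 1 := by rw [← Complex.exp_add]; simp
  rw [Complex.sinh]
  linear_combination (-1 : ℂ) * h

theorem one_sub_exp_sq_ne_zero {x : ℂ} (h : Complex.sinh x ≠ 0) : 1 - Complex.exp x ^ 2 ≠ 0 := by
  rw [one_sub_exp_sq]
  exact neg_ne_zero.2 (mul_ne_zero (mul_ne_zero two_ne_zero (Complex.exp_ne_zero x)) h)

theorem rNorm_exp (η x : ℂ) : rNorm (Complex.exp η) (Complex.exp x) =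
    2 * Complex.sinh (x + η) * (2 * Complex.sinh (-x + η)) := by
  rw [rNorm, Complex.sinh, Complex.sinh]
  simp only [← Complex.exp_neg, ← Complex.exp_add, neg_add, neg_neg]
  ring

theorem sinh_eta_ne_zero (hη : ∀ m : ℕ, 0 < m → Complex.exp (m * η) ≠ 1) :
    Complex.sinh η ≠ 0 := by
  intro h
  have h1 := one_sub_exp_sq η
  rw [h, mul_zero, neg_zero, sub_eq_zero] at h1
  apply hη 2 two_pos
  rw [Complex.exp_nat_mul]
  exact h1.symm

theorem Generic.segZ_ne (hlam : Generic η lam) {i j : Fin n} (h : i ≠ j) :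
    1 - segZ lam (lam j) i ^ 2 ≠ 0 :=
  one_sub_exp_sq_ne_zero (hlam j i h.symm).1

/-- For distinct sites both orders of the pair are needed, one for each factor of `rNorm`. On the
diagonal the value is `(2 sinh η)²`, nonzero because `q² ≠ 1`. -/
theorem Generic.rNorm_ne (hlam : Generic η lam)
    (hη : ∀ m : ℕ, 0 < m → Complex.exp (m * η) ≠ 1) (i j : Fin n) :
    rNorm (Complex.exp η) (segZ lam (lam j) i) ≠ 0 := by
  rw [segZ, rNorm_exp]
  by_cases h : i = j
  · subst h
    simpa using sinh_eta_ne_zero hη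
  · rw [neg_sub]
    exact mul_ne_zero (mul_ne_zero two_ne_zero (hlam j i (Ne.symm h)).2)
      (mul_ne_zero two_ne_zero (hlam i j h).2)

theorem continuous_segZ (lam : Fin n → ℂ) (i : Fin n) : Continuous fun μ => segZ lam μ i := by
  unfold segZ
  fun_prop

theorem continuous_rNorm (η : ℂ) (lam : Fin n → ℂ) (i : Fin n) :
    Continuous fun μ => rNorm (Complex.exp η) (segZ lam μ i) := by
  simp only [segZ, rNorm_exp]
  fun_prop

/-- Only `1 - z_j²` vanishes at `λ_j`, and its derivative `-2` makes this zero isolated; every other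
factor is nonzero by continuity. -/
theorem Generic.eventually_ne (hlam : Generic η lam)
    (hη : ∀ m : ℕ, 0 < m → Complex.exp (m * η) ≠ 1) (j : Fin n) :
    ∀ᶠ μ in 𝓝[≠] (lam j), ∀ i, 1 - segZ lam μ i ^ 2 ≠ 0 ∧
      rNorm (Complex.exp η) (segZ lam μ i) ≠ 0 := by
  rw [eventually_all]
  intro i
  refine Eventually.and ?_ (nhdsWithin_le_nhds
    ((continuous_rNorm η lam i).continuousAt.eventually_ne (hlam.rNorm_ne hη i j)))
  by_cases h : i = j
  · subst h
    have hd : HasDerivAt (fun μ => 1 - segZ lam μ i ^ 2) (-2) (lam i) := by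
      have h1 : HasDerivAt (fun μ => segZ lam μ i) 1 (lam i) := by
        have := ((hasDerivAt_id (lam i)).sub_const (lam i)).cexp
        simpa [segZ] using this
      have := (h1.pow 2).const_sub 1
      simpa [segZ] using this
    have := hd.eventually_ne (c := 0) (by norm_num)
    exact this
  · exact nhdsWithin_le_nhds ((continuous_const.sub
      ((continuous_segZ lam i).pow 2)).continuousAt.eventually_ne (hlam.segZ_ne h))

theorem tendsto_div_one_sub_segZ (lam : Fin n → ℂ) (j : Fin n) :
    Tendsto (fun μ => (μ - lam j) * (1 - segZ lam μ j ^ 2)⁻¹) (𝓝[≠] (lam j)) (𝓝 (-1 / 2)) := by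
  have hd : HasDerivAt (fun μ => 1 - segZ lam μ j ^ 2) (-2) (lam j) := by
    have h1 : HasDerivAt (fun μ => segZ lam μ j) 1 (lam j) := by
      have := ((hasDerivAt_id (lam j)).sub_const (lam j)).cexp
      simpa [segZ] using this
    have := (h1.pow 2).const_sub 1
    simpa [segZ] using this
  have h := (hasDerivAt_iff_tendsto_slope.1 hd).inv₀ (by norm_num)
  convert h using 2 with μ
  · simp [slope_def_field, segZ, div_eq_mul_inv]
  · norm_num

/-- The regular part of the normalization of `H` at `μ = λ_j`. -/
def segNorm (Q : ℂ) (j : Fin n) (z : Fin n → ℂ) : ℂ :=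
  ∏ i, ((if i = j then 1 else 1 - z i ^ 2) * rNorm Q (z i))

theorem prod_mul_prod_eq (Q : ℂ) (j : Fin n) (z : Fin n → ℂ) :
    (∏ i, rNorm Q (z i)) * ∏ i, (1 - z i ^ 2) = (1 - z j ^ 2) * segNorm Q j z := by
  rw [segNorm, Finset.prod_mul_distrib, mul_comm, ← mul_assoc]
  congr 1
  rw [← Finset.mul_prod_erase Finset.univ (fun i => 1 - z i ^ 2) (Finset.mem_univ j),
    ← Finset.mul_prod_erase Finset.univ (fun i => if i = j then 1 else 1 - z i ^ 2)
      (Finset.mem_univ j), if_pos rfl, one_mul]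
  congr 1
  exact Finset.prod_congr rfl fun i hi => (if_neg (Finset.ne_of_mem_erase hi)).symm

theorem Generic.segNorm_ne (hlam : Generic η lam)
    (hη : ∀ m : ℕ, 0 < m → Complex.exp (m * η) ≠ 1) (j : Fin n) :
    segNorm (Complex.exp η) j (segZ lam (lam j)) ≠ 0 := by
  refine Finset.prod_ne_zero_iff.2 fun i _ => mul_ne_zero ?_ (hlam.rNorm_ne hη i j)
  split_ifs with h
  · exact one_ne_zero
  · exact hlam.segZ_ne h

theorem continuous_segNorm (η : ℂ) (lam : Fin n → ℂ) (j : Fin n) :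
    Continuous fun μ => segNorm (Complex.exp η) j (segZ lam μ) := by
  refine continuous_finsetProd _ fun i _ => Continuous.mul ?_ (continuous_rNorm η lam i)
  split_ifs
  · exact continuous_const
  · exact continuous_const.sub ((continuous_segZ lam i).pow 2)

theorem continuous_inProd {U : ℂ → Fin n → Matrix (Fin 2) (Fin 2) (Matrix (Fin 2) (Fin 2) ℂ)}
    (hU : ∀ i s t, Continuous fun μ => U μ i s t) (s t : Conf n) :
    Continuous fun μ => inProd (U μ) s t := by
  induction n with
  | zero => exact continuous_const
  | succ n ih => exact (hU 0 (s 0) (t 0)).mul (ih (U := fun μ => Fin.tail (U μ))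
      (fun i => hU i.succ) (Fin.tail s) (Fin.tail t))

theorem continuous_outProd {U : ℂ → Fin n → Matrix (Fin 2) (Fin 2) (Matrix (Fin 2) (Fin 2) ℂ)}
    (hU : ∀ i s t, Continuous fun μ => U μ i s t) (s t : Conf n) :
    Continuous fun μ => outProd (U μ) s t := by
  induction n with
  | zero => exact continuous_const
  | succ n ih => exact (ih (U := fun μ => Fin.tail (U μ))
      (fun i => hU i.succ) (Fin.tail s) (Fin.tail t)).mul (hU 0 (s 0) (t 0))

theorem continuous_siteR {x y w : ℂ → ℂ} (hx : Continuous x) (hy : Continuous y)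
    (hw : Continuous w) (s t : Fin 2) : Continuous fun μ => siteR (x μ) (y μ) (w μ) s t := by
  refine continuous_matrix fun p q => ?_
  fin_cases s <;> fin_cases t <;> fin_cases p <;> fin_cases q <;>
  first
    | exact hx
    | exact hy
    | exact hw
    | exact continuous_const

theorem continuous_segR (Q : ℂ) (hQ : Q ≠ 0) (lam : Fin n → ℂ) (i : Fin n) (s t : Fin 2) :
    Continuous fun μ => segR Q (segZ lam μ) i s t := by
  have hz := continuous_segZ lam i
  have hz0 : ∀ μ, segZ lam μ i ≠ 0 := fun μ => Complex.exp_ne_zero _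
  exact continuous_siteR
    ((hz.mul continuous_const).sub ((hz.mul continuous_const).inv₀ fun μ => mul_ne_zero (hz0 μ) hQ))
    (hz.sub (hz.inv₀ hz0)) continuous_const s t

theorem continuous_segRCo (Q : ℂ) (lam : Fin n → ℂ) (i : Fin n) (s t : Fin 2) :
    Continuous fun μ => segRCo Q (segZ lam μ) i s t := by
  have hz := continuous_segZ lam i
  have hz0 : ∀ μ, segZ lam μ i ≠ 0 := fun μ => Complex.exp_ne_zero _
  exact continuous_siteR
    (((hz.inv₀ hz0).mul continuous_const).sub (hz.mul continuous_const))
    ((hz.inv₀ hz0).sub hz) continuous_const s t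

variable (η lam)

/-- The unnormalized `Q(ζ; α)(X)`. -/
def traceQ (α μ : ℂ) (X : SegOp n) : SegOp n :=
  Matrix.of fun u v => oscTrace (Complex.exp (2 * α * η))
    (sandwich (oscLCo η lam μ) (oscL η lam μ) X u v)

/-- The unnormalized `t(ζ)(Y)`. -/
def traceT (μ : ℂ) (Y : SegOp n) : SegOp n :=
  Matrix.of fun s t => (sandwich (segRCo (Complex.exp η) (segZ lam μ))
    (segR (Complex.exp η) (segZ lam μ)) Y s t).trace

/-- The value of the residue of `H(exp μ; α)(X)` at `μ = λ_j`. -/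
def resVal (j : Fin n) (α : ℂ) (X : SegOp n) : SegOp n :=
  (-1 / 2 * (segNorm (Complex.exp η) j (segZ lam (lam j)))⁻¹) •
    traceT η lam (lam j) (traceQ η lam α (lam j) X)

variable {η lam}

theorem traceT_smul (μ c : ℂ) (Y : SegOp n) : traceT η lam μ (c • Y) = c • traceT η lam μ Y := by
  ext s t
  simp only [traceT, Matrix.of_apply, sandwich_smul, Matrix.smul_apply, Matrix.trace_smul]

theorem traceT_apply (μ : ℂ) (Y : SegOp n) (s t : Conf n) :
    traceT η lam μ Y s t = ∑ u, ∑ v, Y u v * (inProd (segRCo (Complex.exp η) (segZ lam μ)) s u *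
      outProd (segR (Complex.exp η) (segZ lam μ)) v t).trace := by
  simp only [traceT, Matrix.of_apply, sandwich, Matrix.trace_sum, Matrix.trace_smul, smul_eq_mul]

/-- All poles in `μ` sit in one scalar prefactor. The remaining traces are continuous in `μ`, with
the condition on `α` uniform in `μ`. -/
theorem opH_eq (hη : ∀ m : ℕ, 0 < m → Complex.exp (m * η) ≠ 1) (X : SegOp n) :
    ∀ᶠ α in 𝓝[≠] (0 : ℂ), (∀ s t, Continuous fun μ => traceQ η lam α μ X s t) ∧
      ∀ μ, (∀ i, 1 - segZ lam μ i ^ 2 ≠ 0 ∧ rNorm (Complex.exp η) (segZ lam μ i) ≠ 0) →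
        opH η lam μ α X = ((∏ i, rNorm (Complex.exp η) (segZ lam μ i)) *
          ∏ i, (1 - segZ lam μ i ^ 2))⁻¹ • traceT η lam μ (traceQ η lam α μ X) := by
  have h : ∀ᶠ α in 𝓝[≠] (0 : ℂ), ∀ s t : Conf n, (∀ μ,
      sandwich (oscLCo η lam μ) (oscL η lam μ) X s t ∈ traceDomain (Complex.exp (2 * α * η))) ∧
      Continuous fun μ => oscTrace (Complex.exp (2 * α * η))
        (sandwich (oscLCo η lam μ) (oscL η lam μ) X s t) := by
    simp only [eventually_all]
    exact fun s t => fam_trace hη (fam_sandwich lam X s t)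
  filter_upwards [h] with α hα
  refine ⟨fun s t => (hα s t).2, fun μ hμ => ?_⟩
  have hQ : opQ η lam μ α X = (∏ i, (1 - segZ lam μ i ^ 2))⁻¹ • traceQ η lam α μ X := by
    ext s t
    rw [opQ, Matrix.of_apply, oscAdj_eq η lam fun i => (hμ i).1, oscTrace_smul ((hα s t).1 μ)]
    rfl
  rw [opH, hQ, mul_inv, mul_smul, ← traceT_smul]
  ext s t
  exact opT_eq η lam (fun i => (hμ i).2) _ s t

/-- The single vanishing factor `1 - z_j²` gives a simple pole, and its slope `-2` gives the
constant `-1/2` of `resVal`. Spin zero is not needed at this stage. -/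
theorem tendsto_opH (hη : ∀ m : ℕ, 0 < m → Complex.exp (m * η) ≠ 1) (hlam : Generic η lam)
    (j : Fin n) (X : SegOp n) :
    ∀ᶠ α in 𝓝[≠] (0 : ℂ), Tendsto (fun μ => (μ - lam j) • opH η lam μ α X) (𝓝[≠] (lam j))
      (𝓝 (resVal η lam j α X)) := by
  filter_upwards [opH_eq (lam := lam) hη X] with α hα
  have hcont : Continuous fun μ => traceT η lam μ (traceQ η lam α μ X) := by
    refine continuous_matrix fun s t => ?_
    simp only [traceT_apply]
    refine continuous_finsetSum _ fun u _ => continuous_finsetSum _ fun v _ =>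
      (hα.1 u v).mul (Continuous.matrix_trace ?_)
    exact (continuous_inProd (continuous_segRCo _ lam) s u).mul
      (continuous_outProd (continuous_segR _ (Complex.exp_ne_zero _) lam) v t)
  have h1 : Tendsto (fun μ => ((μ - lam j) * (1 - segZ lam μ j ^ 2)⁻¹ *
      (segNorm (Complex.exp η) j (segZ lam μ))⁻¹) • traceT η lam μ (traceQ η lam α μ X))
      (𝓝[≠] (lam j)) (𝓝 (resVal η lam j α X)) := by
    refine Tendsto.smul (Tendsto.mul (tendsto_div_one_sub_segZ lam j) ?_) ?_
    · exact (((continuous_segNorm η lam j).tendsto (lam j)).inv₀ (hlam.segNorm_ne hη j)).mono_left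
        nhdsWithin_le_nhds
    · exact (hcont.tendsto (lam j)).mono_left nhdsWithin_le_nhds
  refine h1.congr' ?_
  filter_upwards [hlam.eventually_ne hη j] with μ hμ
  rw [hα.2 μ hμ, prod_mul_prod_eq _ j, smul_smul, mul_inv, mul_assoc]

theorem resH_eq (hη : ∀ m : ℕ, 0 < m → Complex.exp (m * η) ≠ 1) (hlam : Generic η lam)
    (j : Fin n) (X : SegOp n) :
    ∀ᶠ α in 𝓝[≠] (0 : ℂ), resH η lam j α X = resVal η lam j α X := by
  filter_upwards [tendsto_opH hη hlam j X] with α hα using hα.limUnder_eq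

end Residue

/-! ### The limit `α → 0` -/

section Limit

variable {n : ℕ} {η : ℂ} {lam : Fin n → ℂ}

theorem qPow_single_one (m : ℤ) (k : ℕ) : qPow η m (Finsupp.single k 1) =
    Complex.exp (m * k * η) • Finsupp.single k 1 := by
  rw [qPow_single]
  simp

/-- Conjugation by `q^D` does not change the diagonal, and moving `a*` from the left to the right
shifts it by one step, which costs a factor `x`. The boundary entry is zero because `a*` never
reaches the vacuum. -/
theorem hasOscTrace_shift {x v : ℂ} {G : Module.End ℂ Fock}
    (h : HasOscTrace x (G * oscAdag) v) :
    HasOscTrace x (qPow η (-1) * oscAdag * G * qPow η 1) (x * v) := by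
  have h0 : ∀ f : Fock, oscAdag f 0 = 0 := by
    intro f
    induction f using Finsupp.induction_linear with
    | zero => simp
    | add f g hf hg => simp [hf, hg]
    | single m c => simp [oscAdag_single]
  have hd : ∀ k, (qPow η (-1) * oscAdag * G * qPow η 1) (Finsupp.single k 1) k =
      oscAdag (G (Finsupp.single k 1)) k := by
    intro k
    rw [Module.End.mul_apply, Module.End.mul_apply, Module.End.mul_apply, qPow_apply,
      qPow_single_one, map_smul, map_smul, Finsupp.smul_apply, smul_eq_mul, ← mul_assoc,
      ← Complex.exp_add]
    simp
  have := h.of_shift (C := qPow η (-1) * oscAdag * G * qPow η 1) fun k => by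
    rw [hd, adag_apply, Module.End.mul_apply, oscAdag_single]
  rwa [hd, h0, zero_add] at this

theorem hasOscTrace_conj {x v : ℂ} {G : Module.End ℂ Fock}
    (h : HasOscTrace x (G * oscAdag) v) :
    HasOscTrace x (qPow η 1 * G * (-(oscAdag * qPow η (-1)))) (-v) := by
  have h1 := h.smul (-1)
  rw [neg_one_mul] at h1
  refine h1.congr_diag fun k => ?_
  have h2 : (-(oscAdag * qPow η (-1))) (Finsupp.single k 1) =
      (-Complex.exp (-(k * η))) • oscAdag (Finsupp.single k 1) := by
    rw [LinearMap.neg_apply, Module.End.mul_apply, qPow_single_one, map_smul, neg_smul]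
    simp
  rw [Module.End.mul_apply, Module.End.mul_apply, h2, map_smul, qPow_apply, LinearMap.smul_apply,
    Finsupp.smul_apply, Finsupp.smul_apply, Module.End.mul_apply, smul_eq_mul, smul_eq_mul,
    ← mul_assoc, mul_neg, ← Complex.exp_add]
  simp

/-- The operator `G` of a segment in the q-oscillator representation. -/
def oscCore (η : ℂ) (lam : Fin n → ℂ) (j : Fin n) (X : SegOp n) (s t : Conf n) :
    Module.End ℂ Fock :=
  core (Complex.exp η) (oscA η) oscAdag (qPow η 1) (qPow η (-1)) j (segC η lam (lam j))
    (segZ lam (lam j)) X s t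

theorem oscCore_mul_mem (j : Fin n) {X : SegOp n} (hX : HasWeight 0 X) (s t : Conf n) :
    oscCore η lam j X s t * oscAdag ∈ oscAlg η :=
  oscAlg_mul (oscGraded_le _ _ (core_mem (oscGrading η) _ j _ _ hX s t)) adag_mem

/-- The two diagonal auxiliary entries of `v G w` contribute `x tr(G a*)` and `-tr(G a*)`. Their sum
carries the factor `x - 1`, which turns the limit `α → 0` into `eps`. -/
theorem traceT_traceQ (j : Fin n) (X : SegOp n) (s t : Conf n) {α : ℂ}
    (h1 : ∀ u v, sandwich (oscLCo η lam (lam j)) (oscL η lam (lam j)) X u v ∈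
      traceDomain (Complex.exp (2 * α * η)))
    (h2 : oscCore η lam j X s t * oscAdag ∈ traceDomain (Complex.exp (2 * α * η))) :
    traceT η lam (lam j) (traceQ η lam α (lam j) X) s t =
      (Complex.exp η - (Complex.exp η)⁻¹) ^ 2 * ((Complex.exp (2 * α * η) - 1) *
        oscTrace (Complex.exp (2 * α * η)) (oscCore η lam j X s t * oscAdag)) := by
  set x := Complex.exp (2 * α * η) with hx
  have h1' : ∀ u v, sandwich (segLCo (oscA η) oscAdag (qPow η 1) (qPow η (-1))
      (segC η lam (lam j)) (segZ lam (lam j))) (segL (Complex.exp η) (oscA η) oscAdag (qPow η 1)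
      (qPow η (-1)) (segC η lam (lam j)) (segZ lam (lam j))) X u v ∈ traceDomain x := h1
  have hD : ∀ p, fullDressed (Complex.exp η) (oscA η) oscAdag (qPow η 1) (qPow η (-1))
      (segC η lam (lam j)) (segZ lam (lam j)) X s t p p =
      (Complex.exp η - (Complex.exp η)⁻¹) ^ 2 • (colV oscAdag (qPow η 1) (qPow η (-1)) p *
        oscCore η lam j X s t * rowW oscAdag (qPow η 1) (qPow η (-1)) p) := fun p =>
    fullDressed_eq_core (oscRel η) (Complex.exp_ne_zero η) j (fun i => lPref_ne_zero η _)
      (fun i => Complex.exp_ne_zero _) (by simp) X s t p p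
  have hD0 := (hasOscTrace_shift (η := η) (hasOscTrace_of_mem h2)).smul
    ((Complex.exp η - (Complex.exp η)⁻¹) ^ 2)
  have hD1 := (hasOscTrace_conj (η := η) (hasOscTrace_of_mem h2)).smul
    ((Complex.exp η - (Complex.exp η)⁻¹) ^ 2)
  have hsum : ∀ p, oscTrace x (fullDressed (Complex.exp η) (oscA η) oscAdag (qPow η 1)
      (qPow η (-1)) (segC η lam (lam j)) (segZ lam (lam j)) X s t p p) =
      ∑ u, ∑ v, traceQ η lam α (lam j) X u v *
        (inProd (segRCo (Complex.exp η) (segZ lam (lam j))) s u *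
          outProd (segR (Complex.exp η) (segZ lam (lam j))) v t) p p := by
    intro p
    rw [fullDressed, dressed, oscTrace_sum _ fun u _ => Submodule.sum_mem _ fun v _ =>
      Submodule.smul_mem _ _ (h1' u v)]
    refine Finset.sum_congr rfl fun u _ => ?_
    rw [oscTrace_sum _ fun v _ => Submodule.smul_mem _ _ (h1' u v)]
    refine Finset.sum_congr rfl fun v _ => ?_
    rw [oscTrace_smul (h1' u v), mul_comm]
    rfl
  have h3 : traceT η lam (lam j) (traceQ η lam α (lam j) X) s t =
      ∑ p, oscTrace x (fullDressed (Complex.exp η) (oscA η) oscAdag (qPow η 1)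
      (qPow η (-1)) (segC η lam (lam j)) (segZ lam (lam j)) X s t p p) := by
    rw [traceT_apply]
    simp only [hsum, Matrix.trace, Matrix.diag_apply, Fin.sum_univ_two, mul_add,
      Finset.sum_add_distrib]
  rw [h3, Fin.sum_univ_two, hD, hD]
  have e0 := hD0.oscTrace_eq
  have e1 := hD1.oscTrace_eq
  refine (congrArg₂ (· + ·) e0 e1).trans ?_
  ring

/-- The value of `H_j(X)` for `X` of spin zero. -/
def limVal (η : ℂ) (lam : Fin n → ℂ) (j : Fin n) (X : SegOp n) : SegOp n :=
  Matrix.of fun s t => 1 / 2 * (segNorm (Complex.exp η) j (segZ lam (lam j)))⁻¹ *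
    ((Complex.exp η - (Complex.exp η)⁻¹) ^ 2 * eps η (oscCore η lam j X s t * oscAdag))

/-- Spin zero enters through the grading, which places `G a*` in the oscillator algebra where `eps`
exists. The factor `x - 1` together with `-1/2` gives the sign of `limVal`. -/
theorem tendsto_resVal (hη : ∀ m : ℕ, 0 < m → Complex.exp (m * η) ≠ 1)
    (j : Fin n) {X : SegOp n} (hX : HasWeight 0 X) :
    Tendsto (fun α => resVal η lam j α X) (𝓝[≠] (0 : ℂ)) (𝓝 (limVal η lam j X)) := by
  have h1 : ∀ᶠ α in 𝓝[≠] (0 : ℂ), ∀ u v : Conf n,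
      sandwich (oscLCo η lam (lam j)) (oscL η lam (lam j)) X u v ∈
      traceDomain (Complex.exp (2 * α * η)) := by
    simp only [eventually_all]
    intro u v
    exact (fam_trace hη (fam_sandwich lam X u v)).mono fun α hα => hα.1 (lam j)
  refine tendsto_pi_nhds.2 fun s => tendsto_pi_nhds.2 fun t => ?_
  have h2 := hasEps_eps hη (oscCore_mul_mem (lam := lam) j hX s t)
  refine ((h2.2.const_mul _).const_mul _).congr' ?_
  filter_upwards [h1, h2.1] with α h3 h4
  rw [resVal, Matrix.smul_apply, traceT_traceQ j X s t h3 h4, smul_eq_mul]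
  ring

theorem hasWeight_spinZeroPart (X : SegOp n) : HasWeight 0 (spinZeroPart X) := by
  intro s t h
  simp only [spinZeroPart, Matrix.of_apply, ne_eq, ite_eq_right_iff, Classical.not_imp] at h
  rw [numDown, numDown, sub_eq_zero]
  exact_mod_cast h.1.symm

theorem tendsto_resH (hη : ∀ m : ℕ, 0 < m → Complex.exp (m * η) ≠ 1) (hlam : Generic η lam)
    (j : Fin n) {X : SegOp n} (hX : HasWeight 0 X) :
    Tendsto (fun α => resH η lam j α X) (𝓝[≠] (0 : ℂ)) (𝓝 (limVal η lam j X)) :=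
  (tendsto_resVal hη j hX).congr' ((resH_eq hη hlam j X).mono fun _ h => h.symm)

theorem opHj_eq (hη : ∀ m : ℕ, 0 < m → Complex.exp (m * η) ≠ 1) (hlam : Generic η lam)
    (j : Fin n) (X : SegOp n) : opHj η lam j X = limVal η lam j (spinZeroPart X) :=
  (tendsto_resH hη hlam j (hasWeight_spinZeroPart X)).limUnder_eq

theorem spinZeroPart_add (X Y : SegOp n) :
    spinZeroPart (X + Y) = spinZeroPart X + spinZeroPart Y := by
  ext s t
  simp only [spinZeroPart, Matrix.of_apply, Matrix.add_apply]
  split_ifs <;> simp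

theorem spinZeroPart_smul (c : ℂ) (X : SegOp n) :
    spinZeroPart (c • X) = c • spinZeroPart X := by
  ext s t
  simp [spinZeroPart]

theorem spinZeroPart_tensorIdRight (X : SegOp n) :
    spinZeroPart (tensorIdRight X) = tensorIdRight (spinZeroPart X) := by
  ext s t
  simp only [spinZeroPart, tensorIdRight, Matrix.of_apply, Fin.sum_univ_castSucc, Fin.init]
  by_cases h : s (Fin.last n) = t (Fin.last n)
  · simp only [h, if_true, Nat.add_right_cancel_iff]
    rfl
  · simp [h]

theorem spinZeroPart_tensorIdLeft (X : SegOp n) :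
    spinZeroPart (tensorIdLeft X) = tensorIdLeft (spinZeroPart X) := by
  ext s t
  simp only [spinZeroPart, tensorIdLeft, Matrix.of_apply, Fin.sum_univ_succ, Fin.tail]
  by_cases h : s 0 = t 0
  · simp only [h, if_true, Nat.add_left_cancel_iff]
    rfl
  · simp [h]

theorem limVal_add (hη : ∀ m : ℕ, 0 < m → Complex.exp (m * η) ≠ 1) (j : Fin n) {X Y : SegOp n}
    (hX : HasWeight 0 X) (hY : HasWeight 0 Y) :
    limVal η lam j (X + Y) = limVal η lam j X + limVal η lam j Y := by
  ext s t
  simp only [limVal, Matrix.of_apply, Matrix.add_apply]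
  have h : oscCore η lam j (X + Y) s t * oscAdag =
      oscCore η lam j X s t * oscAdag + oscCore η lam j Y s t * oscAdag := by
    rw [← add_mul]
    exact congrArg (· * oscAdag) (core_add _ _ _ _ _ j _ _ X Y s t)
  rw [h, eps_add hη (oscCore_mul_mem j hX s t) (oscCore_mul_mem j hY s t)]
  ring

theorem limVal_smul (hη : ∀ m : ℕ, 0 < m → Complex.exp (m * η) ≠ 1) (j : Fin n) (c : ℂ)
    {X : SegOp n} (hX : HasWeight 0 X) :
    limVal η lam j (c • X) = c • limVal η lam j X := by
  ext s t
  simp only [limVal, Matrix.of_apply, Matrix.smul_apply, smul_eq_mul]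
  have h : oscCore η lam j (c • X) s t * oscAdag = c • (oscCore η lam j X s t * oscAdag) := by
    rw [← smul_mul_assoc]
    exact congrArg (· * oscAdag) (core_smul _ _ _ _ _ j _ _ c X s t)
  rw [h, eps_smul hη (oscCore_mul_mem j hX s t)]
  ring

/-- Additivity is not automatic for `limUnder`; it comes from the closed value of the limit and the
linearity of `eps`. -/
theorem opHj_add (hη : ∀ m : ℕ, 0 < m → Complex.exp (m * η) ≠ 1) (hlam : Generic η lam)
    (j : Fin n) (X Y : SegOp n) :
    opHj η lam j (X + Y) = opHj η lam j X + opHj η lam j Y := by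
  simp only [opHj_eq hη hlam, spinZeroPart_add,
    limVal_add hη j (hasWeight_spinZeroPart X) (hasWeight_spinZeroPart Y)]

theorem opHj_smul (hη : ∀ m : ℕ, 0 < m → Complex.exp (m * η) ≠ 1) (hlam : Generic η lam)
    (j : Fin n) (c : ℂ) (X : SegOp n) :
    opHj η lam j (c • X) = c • opHj η lam j X := by
  simp only [opHj_eq hη hlam, spinZeroPart_smul, limVal_smul hη j c (hasWeight_spinZeroPart X)]

/-- The regularized definition of `Ω₂`. -/
theorem tendsto_omega2 (hη : ∀ m : ℕ, 0 < m → Complex.exp (m * η) ≠ 1) (hlam : Generic η lam)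
    (φ : ℂ → ℂ → ℂ) (X : SegOp n)
    (hφ : ∀ j : Fin n, (∀ᶠ α in 𝓝[≠] (0 : ℂ), ContinuousAt (fun μ => φ μ α) (lam j)) ∧
      ContinuousAt (fun α => φ (lam j) α) 0) :
    Tendsto (fun α => -∑ j : Fin n, simpleResidue
        (fun μ => φ μ α • opH η lam μ α (spinZeroPart X)) (lam j))
      (𝓝[≠] (0 : ℂ)) (𝓝 (omega2 η φ lam X)) := by
  refine (tendsto_finsetSum _ fun j _ => ?_).neg
  have h1 : Tendsto (fun α => φ (lam j) α • resVal η lam j α (spinZeroPart X)) (𝓝[≠] (0 : ℂ))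
      (𝓝 (φ (lam j) 0 • opHj η lam j X)) := by
    rw [opHj_eq hη hlam]
    exact ((hφ j).2.tendsto.mono_left nhdsWithin_le_nhds).smul
      (tendsto_resVal hη j (hasWeight_spinZeroPart X))
  refine h1.congr' ?_
  filter_upwards [(hφ j).1, tendsto_opH hη hlam j (spinZeroPart X)] with α h2 h3
  refine (Tendsto.limUnder_eq ?_).symm
  refine ((h2.tendsto.mono_left nhdsWithin_le_nhds).smul h3).congr fun μ => ?_
  rw [smul_comm]

end Limit

/-! ### Right and left reduction of the residues -/

section Reduction

variable {n : ℕ} {η : ℂ} {lam : Fin (n + 1) → ℂ}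

theorem Generic.init (h : Generic η lam) : Generic η (Fin.init lam) := fun i j hij =>
  h i.castSucc j.castSucc fun h' => hij (Fin.castSucc_injective n h')

theorem Generic.tail (h : Generic η lam) : Generic η (Fin.tail lam) := fun i j hij =>
  h i.succ j.succ fun h' => hij (Fin.succ_injective n h')

theorem tensorIdRight_add (X Y : SegOp n) :
    tensorIdRight (X + Y) = tensorIdRight X + tensorIdRight Y := by
  ext s t
  simp only [tensorIdRight, Matrix.of_apply, Matrix.add_apply]
  split_ifs <;> simp

theorem tensorIdRight_smul (c : ℂ) (X : SegOp n) :
    tensorIdRight (c • X) = c • tensorIdRight X := by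
  ext s t
  simp [tensorIdRight]

theorem tensorIdLeft_add (X Y : SegOp n) :
    tensorIdLeft (X + Y) = tensorIdLeft X + tensorIdLeft Y := by
  ext s t
  simp only [tensorIdLeft, Matrix.of_apply, Matrix.add_apply]
  split_ifs <;> simp

theorem tensorIdLeft_smul (c : ℂ) (X : SegOp n) :
    tensorIdLeft (c • X) = c • tensorIdLeft X := by
  ext s t
  simp [tensorIdLeft]

theorem traceT_tensorIdRight (μ : ℂ) (Y : SegOp n) :
    traceT η lam μ (tensorIdRight Y) = rNorm (Complex.exp η) (segZ lam μ (Fin.last n)) •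
      tensorIdRight (traceT η (Fin.init lam) μ Y) := by
  ext s t
  have h : segRCo (Complex.exp η) (segZ lam μ) (Fin.last n) *
      segR (Complex.exp η) (segZ lam μ) (Fin.last n) =
      rNorm (Complex.exp η) (segZ lam μ (Fin.last n)) • 1 :=
    siteR_mul' (Complex.exp_ne_zero _) (Complex.exp_ne_zero _)
  rw [traceT, Matrix.of_apply, sandwich_tensorIdRight _ _ _ h, Matrix.smul_apply]
  simp only [tensorIdRight, Matrix.of_apply]
  split_ifs
  · rw [Matrix.trace_smul]
    rfl
  · simp

theorem traceQ_tensorIdRight (α μ : ℂ) (X : SegOp n)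
    (hX : ∀ s t, sandwich (oscLCo η (Fin.init lam) μ) (oscL η (Fin.init lam) μ) X s t ∈
      traceDomain (Complex.exp (2 * α * η))) :
    traceQ η lam α μ (tensorIdRight X) = (1 - segZ lam μ (Fin.last n) ^ 2) •
      tensorIdRight (traceQ η (Fin.init lam) α μ X) := by
  ext s t
  rw [traceQ, Matrix.of_apply, sandwich_tensorIdRight _ _ _ (oscLCo_mul_oscL η lam μ (Fin.last n)),
    Matrix.smul_apply]
  simp only [tensorIdRight, Matrix.of_apply]
  split_ifs
  · exact oscTrace_smul (hX _ _) _
  · rw [oscTrace_zero, smul_zero]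

theorem eventually_traceQ_tensorIdRight (hη : ∀ m : ℕ, 0 < m → Complex.exp (m * η) ≠ 1)
    (μ : ℂ) (X : SegOp n) : ∀ᶠ α in 𝓝[≠] (0 : ℂ),
      traceQ η lam α μ (tensorIdRight X) = (1 - segZ lam μ (Fin.last n) ^ 2) •
        tensorIdRight (traceQ η (Fin.init lam) α μ X) := by
  have h : ∀ᶠ α in 𝓝[≠] (0 : ℂ), ∀ s t,
      sandwich (oscLCo η (Fin.init lam) μ) (oscL η (Fin.init lam) μ) X s t ∈
      traceDomain (Complex.exp (2 * α * η)) := by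
    simp only [eventually_all]
    intro s t
    exact (fam_trace hη (fam_sandwich (Fin.init lam) X s t)).mono fun α hα => hα.1 μ
  filter_upwards [h] with α hα using traceQ_tensorIdRight α μ X hα

theorem segNorm_castSucc (Q : ℂ) (j : Fin n) (z : Fin (n + 1) → ℂ) :
    segNorm Q j.castSucc z = segNorm Q j (Fin.init z) *
      ((1 - z (Fin.last n) ^ 2) * rNorm Q (z (Fin.last n))) := by
  rw [segNorm, Fin.prod_univ_castSucc, if_neg (Fin.castSucc_lt_last j).ne']
  simp only [Fin.castSucc_inj]
  rfl

theorem segNorm_succ (Q : ℂ) (j : Fin n) (z : Fin (n + 1) → ℂ) :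
    segNorm Q j.succ z = (1 - z 0 ^ 2) * rNorm Q (z 0) * segNorm Q j (Fin.tail z) := by
  rw [segNorm, Fin.prod_univ_succ, if_neg (Fin.succ_ne_zero j).symm]
  simp only [Fin.succ_inj]
  rfl

/-- The scalars released by the last site are exactly its factors in `segNorm`, so the identity
holds at small nonzero `α`. -/
theorem resVal_castSucc_tensorIdRight (hη : ∀ m : ℕ, 0 < m → Complex.exp (m * η) ≠ 1)
    (hlam : Generic η lam) (j : Fin n) (X : SegOp n) : ∀ᶠ α in 𝓝[≠] (0 : ℂ),
      resVal η lam j.castSucc α (tensorIdRight X) =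
        tensorIdRight (resVal η (Fin.init lam) j α X) := by
  filter_upwards [eventually_traceQ_tensorIdRight (lam := lam) hη (lam j.castSucc) X] with α hα
  have h1 := hlam.segZ_ne (Fin.castSucc_lt_last j).ne'
  have h2 := hlam.rNorm_ne hη (Fin.last n) j.castSucc
  rw [resVal, hα, traceT_smul, traceT_tensorIdRight, segNorm_castSucc, resVal, tensorIdRight_smul,
    smul_smul, smul_smul]
  congr 1
  have h3 : segNorm (Complex.exp η) j (Fin.init (segZ lam (lam j.castSucc))) ≠ 0 :=
    hlam.init.segNorm_ne hη j
  change _ = -1 / 2 * (segNorm (Complex.exp η) j (Fin.init (segZ lam (lam j.castSucc))))⁻¹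
  field_simp

theorem resVal_last_tensorIdRight (hη : ∀ m : ℕ, 0 < m → Complex.exp (m * η) ≠ 1)
    (X : SegOp n) : ∀ᶠ α in 𝓝[≠] (0 : ℂ),
      resVal η lam (Fin.last n) α (tensorIdRight X) = 0 := by
  filter_upwards [eventually_traceQ_tensorIdRight (lam := lam) hη (lam (Fin.last n)) X] with α hα
  rw [resVal, hα, traceT_smul]
  simp [segZ]

theorem continuous_tensorIdRight : Continuous (tensorIdRight : SegOp n → SegOp (n + 1)) := by
  refine continuous_matrix fun s t => ?_
  simp only [tensorIdRight, Matrix.of_apply]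
  split_ifs
  · exact continuous_id.matrix_elem _ _
  · exact continuous_const

theorem hasWeight_tensorIdRight {X : SegOp n} (hX : HasWeight 0 X) :
    HasWeight 0 (tensorIdRight X) := by
  intro s t h
  simp only [tensorIdRight, Matrix.of_apply, ne_eq, ite_eq_right_iff, Classical.not_imp] at h
  have := hX _ _ h.2
  rw [numDown, numDown, Fin.sum_univ_castSucc, Fin.sum_univ_castSucc, h.1]
  simpa [numDown, Fin.init] using this

/-- The reduction of the residues passes to the limit by continuity of `tensorIdRight` and
uniqueness of limits. -/
theorem opHj_castSucc_tensorIdRight (hη : ∀ m : ℕ, 0 < m → Complex.exp (m * η) ≠ 1)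
    (hlam : Generic η lam) (j : Fin n) (X : SegOp n) :
    opHj η lam j.castSucc (tensorIdRight X) = tensorIdRight (opHj η (Fin.init lam) j X) := by
  have hX := hasWeight_spinZeroPart X
  rw [opHj_eq hη hlam, opHj_eq hη hlam.init, spinZeroPart_tensorIdRight]
  have h1 := tendsto_resVal (lam := lam) hη j.castSucc (hasWeight_tensorIdRight hX)
  have h2 := (continuous_tensorIdRight.tendsto _).comp
    (tendsto_resVal (lam := Fin.init lam) hη j hX)
  exact tendsto_nhds_unique h1
    (h2.congr' ((resVal_castSucc_tensorIdRight hη hlam j _).mono fun _ h => h.symm))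

theorem opHj_last_tensorIdRight (hη : ∀ m : ℕ, 0 < m → Complex.exp (m * η) ≠ 1)
    (hlam : Generic η lam) (X : SegOp n) :
    opHj η lam (Fin.last n) (tensorIdRight X) = 0 := by
  rw [opHj_eq hη hlam, spinZeroPart_tensorIdRight]
  exact tendsto_nhds_unique
    (tendsto_resVal (lam := lam) hη _ (hasWeight_tensorIdRight (hasWeight_spinZeroPart X)))
    (tendsto_const_nhds.congr' ((resVal_last_tensorIdRight hη _).mono fun _ h => h.symm))

theorem opHj_zero_tensorIdLeft (hη : ∀ m : ℕ, 0 < m → Complex.exp (m * η) ≠ 1)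
    (hlam : Generic η lam) (X : SegOp n) :
    opHj η lam 0 (tensorIdLeft X) = 0 := by
  rw [opHj_eq hη hlam, spinZeroPart_tensorIdLeft]
  ext s t
  have := eps_core_zero_tensorIdLeft (oscGrading η) (residueTrace η hη) (oscRel η)
    (segC η lam (lam 0)) (segZ lam (lam 0)) (hasWeight_spinZeroPart X) s t
  rw [limVal, Matrix.of_apply, oscCore, this, mul_zero, mul_zero]
  rfl

/-- Unlike on the right, this uses the limit value: the scalar from the cyclicity argument under
`eps` cancels the first-site factor of `segNorm`. -/
theorem opHj_succ_tensorIdLeft (hη : ∀ m : ℕ, 0 < m → Complex.exp (m * η) ≠ 1)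
    (hlam : Generic η lam) (j : Fin n) (X : SegOp n) :
    opHj η lam j.succ (tensorIdLeft X) = tensorIdLeft (opHj η (Fin.tail lam) j X) := by
  rw [opHj_eq hη hlam, opHj_eq hη hlam.tail, spinZeroPart_tensorIdLeft]
  ext s t
  have h := eps_core_succ_tensorIdLeft (oscGrading η) (residueTrace η hη) (oscRel η)
    (Complex.exp_ne_zero η) j (segC η lam (lam j.succ)) (segZ lam (lam j.succ))
    (lPref_ne_zero η _) (Complex.exp_ne_zero _) (hasWeight_spinZeroPart X) s t
  have h1 := hlam.segZ_ne (Fin.succ_ne_zero j).symm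
  have h2 := hlam.rNorm_ne hη 0 j.succ
  have h3 : segNorm (Complex.exp η) j (Fin.tail (segZ lam (lam j.succ))) ≠ 0 :=
    hlam.tail.segNorm_ne hη j
  rw [limVal, Matrix.of_apply, oscCore, h, segNorm_succ]
  simp only [tensorIdLeft, Matrix.of_apply]
  split_ifs
  · change _ = 1 / 2 * (segNorm (Complex.exp η) j (Fin.tail (segZ lam (lam j.succ))))⁻¹ *
      ((Complex.exp η - (Complex.exp η)⁻¹) ^ 2 * eps η (core (Complex.exp η) (oscA η) oscAdag
        (qPow η 1) (qPow η (-1)) j (Fin.tail (segC η lam (lam j.succ)))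
        (Fin.tail (segZ lam (lam j.succ))) (spinZeroPart X) (Fin.tail s) (Fin.tail t) * oscAdag))
    rw [← rNorm, mul_inv, mul_inv]
    generalize eps η _ = e
    generalize (Complex.exp η - (Complex.exp η)⁻¹) ^ 2 = w
    field_simp
  · rw [mul_zero, mul_zero]

theorem omega2_tensorIdRight (hη : ∀ m : ℕ, 0 < m → Complex.exp (m * η) ≠ 1)
    (hlam : Generic η lam) (φ : ℂ → ℂ → ℂ) (X : SegOp n) :
    omega2 η φ lam (tensorIdRight X) = tensorIdRight (omega2 η φ (Fin.init lam) X) := by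
  -- Bundled as a linear map so that it commutes with the sum over sites.
  let T : SegOp n →ₗ[ℂ] SegOp (n + 1) :=
    { toFun := tensorIdRight, map_add' := tensorIdRight_add, map_smul' := tensorIdRight_smul }
  change _ = T _
  rw [omega2, omega2, Fin.sum_univ_castSucc, opHj_last_tensorIdRight hη hlam, smul_zero, add_zero,
    map_neg, map_sum]
  congr 1
  refine Finset.sum_congr rfl fun j _ => ?_
  rw [opHj_castSucc_tensorIdRight hη hlam, map_smul]
  rfl

theorem omega2_tensorIdLeft (hη : ∀ m : ℕ, 0 < m → Complex.exp (m * η) ≠ 1)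
    (hlam : Generic η lam) (φ : ℂ → ℂ → ℂ) (X : SegOp n) :
    omega2 η φ lam (tensorIdLeft X) = tensorIdLeft (omega2 η φ (Fin.tail lam) X) := by
  let T : SegOp n →ₗ[ℂ] SegOp (n + 1) :=
    { toFun := tensorIdLeft, map_add' := tensorIdLeft_add, map_smul' := tensorIdLeft_smul }
  change _ = T _
  rw [omega2, omega2, Fin.sum_univ_succ, opHj_zero_tensorIdLeft hη hlam, smul_zero, zero_add,
    map_neg, map_sum]
  congr 1
  refine Finset.sum_congr rfl fun j _ => ?_
  rw [opHj_succ_tensorIdLeft hη hlam, map_smul]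
  rfl

end Reduction

section Linear

variable {n : ℕ} {η : ℂ} {lam : Fin n → ℂ}

theorem omega2_add (hη : ∀ m : ℕ, 0 < m → Complex.exp (m * η) ≠ 1) (hlam : Generic η lam)
    (φ : ℂ → ℂ → ℂ) (X Y : SegOp n) :
    omega2 η φ lam (X + Y) = omega2 η φ lam X + omega2 η φ lam Y := by
  simp only [omega2, opHj_add hη hlam, smul_add, Finset.sum_add_distrib, neg_add]

theorem omega2_smul (hη : ∀ m : ℕ, 0 < m → Complex.exp (m * η) ≠ 1) (hlam : Generic η lam)
    (φ : ℂ → ℂ → ℂ) (c : ℂ) (X : SegOp n) :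
    omega2 η φ lam (c • X) = c • omega2 η φ lam X := by
  simp only [omega2, opHj_smul hη hlam, smul_neg, Finset.smul_sum, smul_comm c]

end Linear

/-! ### The infinite chain -/

section Chain

variable {n : ℕ}

theorem overwrite_add (k : ℤ) (s : ℤ → Fin 2) (t : Conf n) (i : Fin n) :
    overwrite k s t (k + i) = t i := by
  have h : (k + (i : ℤ) - k).toNat = i := by omega
  rw [overwrite, dif_pos ⟨by rw [h]; exact i.2, by omega⟩]
  exact congrArg t (Fin.ext h)

theorem overwrite_of_notMem (k : ℤ) (s : ℤ → Fin 2) (t : Conf n) {j : ℤ}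
    (h : ∀ i : Fin n, j ≠ k + i) : overwrite k s t j = s j := by
  rw [overwrite, dif_neg]
  rintro ⟨h1, h2⟩
  refine h ⟨_, h1⟩ ?_
  simp only
  omega

theorem overwrite_eq {k : ℤ} {s σ : ℤ → Fin 2} {t : Conf n} (h1 : ∀ i : Fin n, σ (k + i) = t i)
    (h2 : ∀ j, (∀ i : Fin n, j ≠ k + i) → σ j = s j) : overwrite k s t = σ := by
  funext j
  by_cases h : ∃ i : Fin n, j = k + i
  · obtain ⟨i, rfl⟩ := h
    rw [overwrite_add, h1]
  · push Not at h
    rw [overwrite_of_notMem k s t h, h2 j h]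

theorem overwrite_snoc (k : ℤ) (s : ℤ → Fin 2) (t : Conf n) :
    overwrite k s (Fin.snoc t (s (k + n)) : Conf (n + 1)) = overwrite k s t := by
  refine overwrite_eq (fun i => ?_) fun j hj => ?_
  · induction i using Fin.lastCases with
    | last =>
      rw [Fin.snoc_last, overwrite_of_notMem, Fin.val_last]
      intro i
      have := i.2
      rw [Fin.val_last]
      omega
    | cast i => rw [Fin.snoc_castSucc, Fin.val_castSucc, overwrite_add]
  · exact overwrite_of_notMem _ _ _ fun i => hj i.castSucc

theorem overwrite_cons (k : ℤ) (s : ℤ → Fin 2) (t : Conf n) :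
    overwrite k s (Fin.cons (s k) t : Conf (n + 1)) = overwrite (k + 1) s t := by
  have hs : ∀ i : Fin n, k + ((i.succ : Fin (n + 1)) : ℕ) = k + 1 + ((i : ℕ) : ℤ) := by
    intro i
    rw [Fin.val_succ]
    push_cast
    ring
  refine overwrite_eq (fun i => ?_) fun j hj => ?_
  · induction i using Fin.cases with
    | zero =>
      rw [Fin.cons_zero, overwrite_of_notMem]
      · simp
      · intro i
        rw [Fin.val_zero]
        omega
    | succ i => rw [Fin.cons_succ, hs, overwrite_add]
  · exact overwrite_of_notMem _ _ _ fun i => hs i ▸ hj i.succ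

theorem embed_apply (k : ℤ) (X : SegOp n) (f : (ℤ → Fin 2) → ℂ) (s : ℤ → Fin 2) :
    embed k X f s = ∑ t : Conf n, X (fun i => s (k + i)) t * f (overwrite k s t) := rfl

theorem embed_tensorIdRight (k : ℤ) (X : SegOp n) : embed k (tensorIdRight X) = embed k X := by
  refine LinearMap.ext fun f => funext fun s => ?_
  rw [embed_apply, embed_apply]
  have hsum : ∀ F : Conf (n + 1) → ℂ,
      ∑ t, F t = ∑ c, ∑ t : Conf n, F (Fin.snoc t c : Conf (n + 1)) := by
    intro F
    rw [← Fintype.sum_prod_type']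
    exact (Fintype.sum_equiv (Fin.snocEquiv fun _ => Fin 2) _ _ fun _ => rfl).symm
  rw [hsum, Finset.sum_eq_single (s (k + n))]
  · refine Finset.sum_congr rfl fun t _ => ?_
    rw [overwrite_snoc, tensorIdRight, Matrix.of_apply, Fin.snoc_last, Fin.init_snoc, if_pos]
    · rfl
    · simp only [Fin.val_last]
  · intro c _ hc
    refine Finset.sum_eq_zero fun t _ => ?_
    rw [tensorIdRight, Matrix.of_apply, Fin.snoc_last, if_neg, zero_mul]
    simpa only [Fin.val_last] using hc.symm
  · simp

theorem embed_tensorIdLeft (k : ℤ) (X : SegOp n) :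
    embed k (tensorIdLeft X) = embed (k + 1) X := by
  refine LinearMap.ext fun f => funext fun s => ?_
  rw [embed_apply, embed_apply, sum_conf_succ, Finset.sum_eq_single (s k)]
  · refine Finset.sum_congr rfl fun t _ => ?_
    rw [overwrite_cons, tensorIdLeft, Matrix.of_apply, Fin.cons_zero, Fin.tail_cons, if_pos]
    · congr 2
      funext i
      simp only [Fin.tail, Fin.val_succ]
      congr 1
      push_cast
      ring
    · simp
  · intro c _ hc
    refine Finset.sum_eq_zero fun t _ => ?_
    rw [tensorIdLeft, Matrix.of_apply, Fin.cons_zero, if_neg, zero_mul]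
    simpa using hc.symm
  · simp

theorem embed_injective (k : ℤ) : Function.Injective (embed k : SegOp n → _) := by
  intro X Y h
  ext s t
  -- Matrix elements are recovered by testing on the indicator of `t` and evaluating at a chain
  -- configuration that extends `s`.
  have key : ∀ Z : SegOp n, embed k Z (fun σ => if (fun i : Fin n => σ (k + i)) = t then 1 else 0)
      (overwrite k (fun _ => 0) s) = Z s t := by
    intro Z
    simp [embed_apply, overwrite_add]
  rw [← key X, ← key Y, h]

theorem toLocal_injective (k : ℤ) : Function.Injective (toLocal k : SegOp n → _) :=
  fun _ _ h => embed_injective k (congrArg Subtype.val h)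

theorem toLocal_tensorIdRight (k : ℤ) (X : SegOp n) :
    toLocal k (tensorIdRight X) = toLocal k X := Subtype.ext (embed_tensorIdRight k X)

theorem toLocal_tensorIdLeft (k : ℤ) (X : SegOp n) :
    toLocal k (tensorIdLeft X) = toLocal (k + 1) X := Subtype.ext (embed_tensorIdLeft k X)

theorem toLocal_add (k : ℤ) (X Y : SegOp n) :
    toLocal k (X + Y) = toLocal k X + toLocal k Y := by
  refine Subtype.ext (LinearMap.ext fun f => funext fun s => ?_)
  simp [toLocal, embed_apply, add_mul, Finset.sum_add_distrib]

theorem toLocal_smul (k : ℤ) (c : ℂ) (X : SegOp n) :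
    toLocal k (c • X) = c • toLocal k X := by
  refine Subtype.ext (LinearMap.ext fun f => funext fun s => ?_)
  simp [toLocal, embed_apply, mul_assoc, Finset.mul_sum]

variable {η : ℂ} {lam : ℤ → ℂ}

theorem tail_seg (lam : ℤ → ℂ) (k : ℤ) (n : ℕ) :
    Fin.tail (seg lam k (n + 1)) = seg lam (k + 1) n := by
  funext i
  simp only [Fin.tail, seg, Fin.val_succ]
  congr 1
  push_cast
  ring

variable (hη : ∀ m : ℕ, 0 < m → Complex.exp (m * η) ≠ 1)
  (hlam : ∀ i j : ℤ, i ≠ j →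
    Complex.sinh (lam i - lam j) ≠ 0 ∧ Complex.sinh (lam i - lam j + η) ≠ 0)
  (φ : ℂ → ℂ → ℂ)

include hlam in
theorem generic_seg (k : ℤ) (n : ℕ) : Generic η (seg lam k n) := fun i j hij =>
  hlam _ _ fun h => hij (Fin.ext (by omega))

include hη hlam

theorem omega2_seg_tensorIdRight (k : ℤ) (X : SegOp n) :
    omega2 η φ (seg lam k (n + 1)) (tensorIdRight X) =
      tensorIdRight (omega2 η φ (seg lam k n) X) :=
  omega2_tensorIdRight hη (generic_seg hlam k (n + 1)) φ X

theorem omega2_seg_tensorIdLeft (k : ℤ) (X : SegOp n) :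
    omega2 η φ (seg lam k (n + 1)) (tensorIdLeft X) =
      tensorIdLeft (omega2 η φ (seg lam (k + 1) n) X) := by
  rw [← tail_seg]
  exact omega2_tensorIdLeft hη (generic_seg hlam k (n + 1)) φ X

/-- An operator on a segment acts on every larger segment, compatibly with `Ω₂`. -/
theorem exists_extension {k k' : ℤ} {n' : ℕ} (h1 : k' ≤ k) (h2 : k + n ≤ k' + n') (X : SegOp n) :
    ∃ X' : SegOp n', toLocal k' X' = toLocal k X ∧
      toLocal k' (omega2 η φ (seg lam k' n') X') = toLocal k (omega2 η φ (seg lam k n) X) := by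
  have right : ∀ m : ℕ, ∃ X' : SegOp (n + m), toLocal k X' = toLocal k X ∧
      toLocal k (omega2 η φ (seg lam k (n + m)) X') =
        toLocal k (omega2 η φ (seg lam k n) X) := by
    intro m
    induction m with
    | zero => exact ⟨X, rfl, rfl⟩
    | succ m ih =>
      obtain ⟨X', h1, h2⟩ := ih
      refine ⟨tensorIdRight X', ?_, ?_⟩
      · rw [toLocal_tensorIdRight, h1]
      · exact (congrArg (toLocal k) (omega2_seg_tensorIdRight hη hlam φ k X')).trans
          ((toLocal_tensorIdRight k _).trans h2)
  have left : ∀ m p : ℕ, ∃ X' : SegOp (n + m + p), toLocal (k - p) X' = toLocal k X ∧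
      toLocal (k - p) (omega2 η φ (seg lam (k - p) (n + m + p)) X') =
        toLocal k (omega2 η φ (seg lam k n) X) := by
    intro m p
    induction p with
    | zero => simpa using right m
    | succ p ih =>
      obtain ⟨X', h1, h2⟩ := ih
      have hk : k - (p : ℤ) = k - ((p + 1 : ℕ) : ℤ) + 1 := by push_cast; ring
      rw [hk] at h1 h2
      refine ⟨tensorIdLeft X', ?_, ?_⟩
      · rw [toLocal_tensorIdLeft, h1]
      · exact (congrArg (toLocal _) (omega2_seg_tensorIdLeft hη hlam φ _ X')).trans
          ((toLocal_tensorIdLeft _ _).trans h2)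
  -- The larger segment adds `p` sites on the left and `m` sites on the right.
  obtain ⟨p, rfl⟩ : ∃ p : ℕ, k' = k - p := ⟨(k - k').toNat, by omega⟩
  obtain ⟨m, rfl⟩ : ∃ m : ℕ, n' = n + m + p := ⟨n' - n - p, by omega⟩
  exact left m p

/-- The graph of `Ω₂` on local operators. -/
def omegaGraph (η : ℂ) (lam : ℤ → ℂ) (φ : ℂ → ℂ → ℂ) (O O' : localOps) : Prop :=
  ∃ (k : ℤ) (n : ℕ) (X : SegOp n),
    toLocal k X = O ∧ toLocal k (omega2 η φ (seg lam k n) X) = O'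

/-- Both representatives are moved to the hull of their two segments, where sums and comparisons are
made with matrices of the same size. -/
theorem omegaGraph_common {O₁ O₁' O₂ O₂' : localOps} (h1 : omegaGraph η lam φ O₁ O₁')
    (h2 : omegaGraph η lam φ O₂ O₂') : ∃ (k : ℤ) (n : ℕ) (X Y : SegOp n),
      (toLocal k X = O₁ ∧ toLocal k (omega2 η φ (seg lam k n) X) = O₁') ∧
      (toLocal k Y = O₂ ∧ toLocal k (omega2 η φ (seg lam k n) Y) = O₂') := by
  obtain ⟨k, n, X, rfl, rfl⟩ := h1
  obtain ⟨l, m, Y, rfl, rfl⟩ := h2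
  obtain ⟨X', hX⟩ := exists_extension hη hlam φ (k := k) (k' := min k l)
    (n' := (max (k + n) (l + m) - min k l).toNat) (by omega) (by omega) X
  obtain ⟨Y', hY⟩ := exists_extension hη hlam φ (k := l) (k' := min k l)
    (n' := (max (k + n) (l + m) - min k l).toNat) (by omega) (by omega) Y
  exact ⟨_, _, X', Y', hX, hY⟩

/-- On a common segment the representative of `O` is unique because the embedding is injective. -/
theorem omegaGraph_unique {O O₁ O₂ : localOps} (h1 : omegaGraph η lam φ O O₁)
    (h2 : omegaGraph η lam φ O O₂) : O₁ = O₂ := by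
  obtain ⟨k, n, X, Y, ⟨hX, rfl⟩, ⟨hY, rfl⟩⟩ := omegaGraph_common hη hlam φ h1 h2
  rw [toLocal_injective k (hX.trans hY.symm)]

theorem omegaGraph_add {O₁ O₁' O₂ O₂' : localOps} (h1 : omegaGraph η lam φ O₁ O₁')
    (h2 : omegaGraph η lam φ O₂ O₂') : omegaGraph η lam φ (O₁ + O₂) (O₁' + O₂') := by
  obtain ⟨k, n, X, Y, ⟨rfl, rfl⟩, ⟨rfl, rfl⟩⟩ := omegaGraph_common hη hlam φ h1 h2
  exact ⟨k, n, X + Y, toLocal_add k X Y,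
    by rw [omega2_add hη (generic_seg hlam k n), toLocal_add]⟩

theorem omegaGraph_smul (c : ℂ) {O O' : localOps} (h : omegaGraph η lam φ O O') :
    omegaGraph η lam φ (c • O) (c • O') := by
  obtain ⟨k, n, X, rfl, rfl⟩ := h
  exact ⟨k, n, c • X, toLocal_smul k c X,
    by rw [omega2_smul hη (generic_seg hlam k n), toLocal_smul]⟩

theorem exists_omegaGraph (O : localOps) : ∃ O', omegaGraph η lam φ O O' := by
  obtain ⟨O, hO⟩ := O
  induction hO using Submodule.span_induction with
  | mem O h =>
    obtain ⟨k, n, X, rfl⟩ := h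
    exact ⟨_, k, n, X, rfl, rfl⟩
  -- Zero is written as `0 • 0` so that `toLocal_smul` identifies it on the empty segment.
  | zero => exact ⟨_, 0, 0, (0 : ℂ) • 0, toLocal_smul 0 0 0 |>.trans (zero_smul _ _), rfl⟩
  | add O₁ O₂ _ _ h1 h2 =>
    obtain ⟨O₁', h1⟩ := h1
    obtain ⟨O₂', h2⟩ := h2
    exact ⟨_, omegaGraph_add hη hlam φ h1 h2⟩
  | smul c O _ h =>
    obtain ⟨O', h⟩ := h
    exact ⟨_, omegaGraph_smul hη hlam φ c h⟩

theorem exists_chain_operator : ∃ Ω : localOps →ₗ[ℂ] localOps,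
    ∀ O, omegaGraph η lam φ O (Ω O) := by
  choose Ω hΩ using exists_omegaGraph hη hlam φ
  exact ⟨{ toFun := Ω
           map_add' := fun O₁ O₂ => omegaGraph_unique hη hlam φ (hΩ _)
             (omegaGraph_add hη hlam φ (hΩ O₁) (hΩ O₂))
           map_smul' := fun c O => omegaGraph_unique hη hlam φ (hΩ _)
             (omegaGraph_smul hη hlam φ c (hΩ O)) }, hΩ⟩

end Chain

end XXZ

end

/-! ### Assembly of the proposition -/

theorem mainTheorem5 (η : ℂ)
    (hη : ∀ m : ℕ, 0 < m → Complex.exp (m * η) ≠ 1)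
    (lam : ℤ → ℂ)
    (hlam : ∀ i j : ℤ, i ≠ j →
      Complex.sinh (lam i - lam j) ≠ 0 ∧ Complex.sinh (lam i - lam j + η) ≠ 0)
    (φ : ℂ → ℂ → ℂ) :
    -- the traces, residues and limits in the definition of `H_j` exist
    (∀ (k : ℤ) (n : ℕ),
      (∀ᶠ α in 𝓝[≠] (0 : ℂ), ∀ (μ : ℂ) (X : XXZ.SegOp n) (s t : XXZ.Conf n),
        XXZ.HasOscTrace (Complex.exp (2 * α * η))
          (XXZ.oscAdj η (XXZ.seg lam k n) μ X s t)
          (XXZ.opQ η (XXZ.seg lam k n) μ α X s t)) ∧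
      ∀ (j : Fin n) (X : XXZ.SegOp n),
        (∀ᶠ α in 𝓝[≠] (0 : ℂ),
          Tendsto
            (fun μ => (μ - XXZ.seg lam k n j) •
              XXZ.opH η (XXZ.seg lam k n) μ α (XXZ.spinZeroPart X))
            (𝓝[≠] (XXZ.seg lam k n j))
            (𝓝 (XXZ.resH η (XXZ.seg lam k n) j α (XXZ.spinZeroPart X)))) ∧
        Tendsto (fun α => XXZ.resH η (XXZ.seg lam k n) j α (XXZ.spinZeroPart X))
          (𝓝[≠] (0 : ℂ)) (𝓝 (XXZ.opHj η (XXZ.seg lam k n) j X))) ∧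
    -- if `φ` is regular at the inhomogeneities, then `- ∑ φ(λ_j; 0) H_j` is the
    -- restriction to the segment of `- lim_{α → 0} ∫ dμ/(2πi) φ(μ; α) H(exp μ; α)`
    (∀ (k : ℤ) (n : ℕ) (X : XXZ.SegOp n),
      (∀ j : Fin n,
        (∀ᶠ α in 𝓝[≠] (0 : ℂ), ContinuousAt (fun μ => φ μ α) (XXZ.seg lam k n j)) ∧
        ContinuousAt (fun α => φ (XXZ.seg lam k n j) α) 0) →
      Tendsto
        (fun α => -∑ j : Fin n, XXZ.simpleResidue
          (fun μ => φ μ α • XXZ.opH η (XXZ.seg lam k n) μ α (XXZ.spinZeroPart X))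
          (XXZ.seg lam k n j))
        (𝓝[≠] (0 : ℂ)) (𝓝 (XXZ.omega2 η φ (XXZ.seg lam k n) X))) ∧
    -- right and left reduction
    (∀ (k : ℤ) (n : ℕ) (X : XXZ.SegOp n),
      XXZ.omega2 η φ (XXZ.seg lam k (n + 1)) (XXZ.tensorIdRight X) =
        XXZ.tensorIdRight (XXZ.omega2 η φ (XXZ.seg lam k n) X) ∧
      XXZ.omega2 η φ (XXZ.seg lam k (n + 1)) (XXZ.tensorIdLeft X) =
        XXZ.tensorIdLeft (XXZ.omega2 η φ (XXZ.seg lam (k + 1) n) X)) ∧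
    -- the inductive limit `Ω₂ = lim_{k → -∞} lim_{l → ∞} (Ω₂)_{[k,l]}`
    (∃ Ω : XXZ.localOps →ₗ[ℂ] XXZ.localOps,
      (∀ (k : ℤ) (n : ℕ) (X : XXZ.SegOp n),
        Ω (XXZ.toLocal k X) = XXZ.toLocal k (XXZ.omega2 η φ (XXZ.seg lam k n) X)) ∧
      (∀ O : XXZ.localOps, ∀ᶠ k : ℤ in atBot, ∀ᶠ l : ℤ in atTop,
        ∃ X : XXZ.SegOp (l + 1 - k).toNat,
          XXZ.toLocal k X = O ∧
          Ω O = XXZ.toLocal k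
            (XXZ.omega2 η φ (XXZ.seg lam k (l + 1 - k).toNat) X)) ∧
      (∀ Ω' : XXZ.localOps →ₗ[ℂ] XXZ.localOps,
        (∀ (k : ℤ) (n : ℕ) (X : XXZ.SegOp n),
          Ω' (XXZ.toLocal k X) =
            XXZ.toLocal k (XXZ.omega2 η φ (XXZ.seg lam k n) X)) → Ω' = Ω)) := by
  have hgen := fun k n => XXZ.generic_seg (η := η) hlam k n
  refine ⟨fun k n => ⟨XXZ.eventually_hasOscTrace _ hη, fun j X => ⟨?_, ?_⟩⟩, ?_, ?_, ?_⟩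
  · filter_upwards [XXZ.tendsto_opH hη (hgen k n) j (XXZ.spinZeroPart X),
      XXZ.resH_eq hη (hgen k n) j (XXZ.spinZeroPart X)] with α h1 h2
    rwa [h2]
  · rw [XXZ.opHj_eq hη (hgen k n)]
    exact XXZ.tendsto_resH hη (hgen k n) j (XXZ.hasWeight_spinZeroPart X)
  · exact fun k n X hφ => XXZ.tendsto_omega2 hη (hgen k n) φ X hφ
  · exact fun k n X => ⟨XXZ.omega2_seg_tensorIdRight hη hlam φ k X,
      XXZ.omega2_seg_tensorIdLeft hη hlam φ k X⟩
  · obtain ⟨Ω, hΩ⟩ := XXZ.exists_chain_operator hη hlam φ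
    have hloc : ∀ (k : ℤ) (n : ℕ) (X : XXZ.SegOp n),
        Ω (XXZ.toLocal k X) = XXZ.toLocal k (XXZ.omega2 η φ (XXZ.seg lam k n) X) :=
      fun k n X => XXZ.omegaGraph_unique hη hlam φ (hΩ _) ⟨k, n, X, rfl, rfl⟩
    refine ⟨Ω, hloc, fun O => ?_, fun Ω' hΩ' => LinearMap.ext fun O => ?_⟩
    · obtain ⟨k, n, X, hX, hX'⟩ := hΩ O
      filter_upwards [eventually_le_atBot k] with k' hk
      -- The term `k + n` makes `[k', l]` contain the support; the term `k'` keeps it nonempty, so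
      -- its length `l + 1 - k'` is not truncated.
      filter_upwards [eventually_ge_atTop (max (k + n) k')] with l hl
      obtain ⟨Y, hY, hY'⟩ := XXZ.exists_extension hη hlam φ (n' := (l + 1 - k').toNat) hk
        (by omega) X
      exact ⟨Y, hY.trans hX, (hY'.trans hX').symm⟩
    -- Every local operator is supported on a single segment, so prescribing the values on segments
    -- determines the operator.
    · obtain ⟨k, n, X, hX, hX'⟩ := hΩ O
      rw [← hX', ← hX, hΩ']
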